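/- Let $k$ be a field of characteristic different from $2$ with algebraic closure $\bar k$, let $F=f_0+f_1X+\dots+f_5X^5+X^6\in k[X]$ (so $f_6=1$) be separable with all its roots in $\bar k$ nonzero, and let $\mathcal C$ be the smooth projective curve of genus $2$ with affine equation $Y^2=F(X)$. Put $$F_0(x,u)=2f_0+f_1(x+u)+2f_2xu+f_3xu(x+u)+2f_4(xu)^2+f_5(xu)^2(x+u)+2f_6(xu)^3 .$$ Let $\kappa$ be the morphism from the classes of divisors of degree $2$ on $\mathcal C$ (over $\bar k$) to $\mathbb P^3$ with $$\kappa([(x,y)+(u,v)])=\Big(1:x+u:xu:\tfrac{F_0(x,u)-2yv}{(x-u)^2}\Big)$$ for $x\ne u$, which sends the canonical class to $(0:0:0:1)$. The Kummer surface $\mathcal K\subset\mathbb P^3$ is the image of $\kappa$, and $\mathcal K^*\subset(\mathbb P^3)^\vee$ is its projective dual, the Zariski closure of the set of tangent planes of $\mathcal K$ at smooth points; the plane $\sum_j\eta_j\xi_j=0$ has dual coordinates $(\eta_1:\eta_2:\eta_3:\eta_4)$. Let $\theta_i\in\bar k$ be a root of $F$ and $\mathfrak a_i=(\theta_i,0)$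 the corresponding Weierstrass point. Then there is exactly one map $W_i:\mathcal K\to\mathcal K^*$ induced by the addition of $\mathfrak a_i$, that is, such that for every divisor class $\mathfrak X$ of degree $2$ the plane $W_i(\kappa(\mathfrak X))$ contains the points $\kappa(\mathfrak X+[\mathfrak a_i]-[\mathfrak r])$ for all $\mathfrak r\in\mathcal C(\bar k)$. It is the restriction to $\mathcal K$ of the linear isomorphism $\xi\mapsto A_i\xi$ from $\mathbb P^3$ to $(\mathbb P^3)^\vee$ (with $\xi$ a column vector) given by the invertible antisymmetric matrix $$A_i=\begin{pmatrix}0&-f_1-2\frac{f_0}{\theta_i}&a_{13}&\theta_i^2\\ f_1+2\frac{f_0}{\theta_i}&0&\theta_i^2(f_5+2\theta_i)&-\theta_i\\ -a_{13}&-\theta_i^2(f_5+2\theta_i)&0&1\\ -\theta_i^2&\theta_i&-1&0\end{pmatrix},\qquad a_{13}=\theta_i(f_3+2f_4\theta_i+2f_5\theta_i^2+2\theta_i^3).$$ -/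

import Mathlib

open Polynomial
open scoped LinearAlgebra.Projectivization

namespace GenusTwo

/-- The points, over the field `K`, of the smooth projective model of `Y² = F(X)`, for `F` of
degree `6`.  With `f₆ = F.coeff 6`, the points at infinity are given by the value `s` of `Y / X³`,
where `s² = f₆`. -/
inductive CurvePoint {K : Type*} [Field K] (F : K[X]) : Type _
  | affine (x y : K) (h : y ^ 2 = F.eval x) : CurvePoint F
  | infinity (s : K) (h : s ^ 2 = F.coeff 6) : CurvePoint F

/-- The Weierstrass point `(θ, 0)` of a root `θ` of `F`. -/
def weierstrassPoint {K : Type*} [Field K] (F : K[X]) (θ : K) (h : F.eval θ = 0) :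
    CurvePoint F :=
  .affine θ 0 (by simp [h])

namespace CurvePoint

/-- Weighted homogeneous coordinates `(X : Z : Y)`, of weights `1, 1, 3`, on the smooth model
`Y² = ∑ fⱼ Xʲ Z⁶⁻ʲ`; they are normalised by `Z = 1`, or by `Z = 0` and `X = 1`. -/
def xCoord {K : Type*} [Field K] {F : K[X]} : CurvePoint F → K
  | affine x _ _ => x
  | infinity _ _ => 1

/-- See `CurvePoint.xCoord`. -/
def zCoord {K : Type*} [Field K] {F : K[X]} : CurvePoint F → K
  | affine _ _ _ => 1
  | infinity _ _ => 0

/-- See `CurvePoint.xCoord`. -/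
def yCoord {K : Type*} [Field K] {F : K[X]} : CurvePoint F → K
  | affine _ y _ => y
  | infinity s _ => s

end CurvePoint

/-! ### Divisors and linear equivalence -/

/-- The coordinate ring `K[X, Y] / (Y² - F(X))` of an affine curve. -/
abbrev AffineRing {K : Type*} [Field K] (F : K[X]) : Type _ :=
  AdjoinRoot ((X : K[X][X]) ^ 2 - C F)

/-- The ideal `(X - x, Y - y)` of the point `(x, y)` in the coordinate ring. -/
noncomputable def pointIdeal {K : Type*} [Field K] (F : K[X]) (x y : K) : Ideal (AffineRing F) :=
  Ideal.span {AdjoinRoot.of _ (X - C x), AdjoinRoot.root _ - AdjoinRoot.of _ (C y)}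

/-- The order of vanishing at the smooth point `(x, y)` of the function `A(X) + B(X) Y` on the
curve `Y² = F(X)`: the largest `n` such that the function lies in the `n`-th power of the ideal of
the point.  (For the zero function there is no such `n`; it is never used.) -/
noncomputable def affineOrd {K : Type*} [Field K] (F : K[X]) (x y : K) (A B : K[X]) : ℕ :=
  sSup {n : ℕ | AdjoinRoot.of _ A + AdjoinRoot.of _ B * AdjoinRoot.root _ ∈ pointIdeal F x y ^ n}

/-- A weighted homogeneous form `A(X, Z) + B(X, Z) Y` of weight `d + 3` on the curve, with `A` and
`B` binary forms of degrees `d + 3` and `d`, written in the chart `Z = 1`. -/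
structure CurveForm (K : Type*) [Field K] (d : ℕ) where
  A : K[X]
  B : K[X]
  natDegree_A_le : A.natDegree ≤ d + 3
  natDegree_B_le : B.natDegree ≤ d

/-- The form is not identically zero on the curve. -/
def CurveForm.IsNonzero {K : Type*} [Field K] {d : ℕ} (g : CurveForm K d) : Prop :=
  g.A ≠ 0 ∨ g.B ≠ 0

/-- The order of vanishing of a form at a point of the curve.  At infinity we use the chart
`X = 1`, in which binary forms of degree `n` become the reflected polynomials. -/
noncomputable def CurveForm.ord {K : Type*} [Field K] {F : K[X]} {d : ℕ} (g : CurveForm K d) :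
    CurvePoint F → ℕ
  | .affine x y _ => affineOrd F x y g.A g.B
  | .infinity s _ => affineOrd (F.reflect 6) 0 s (g.A.reflect (d + 3)) (g.B.reflect d)

/-- A divisor is principal if it is the divisor of a nonzero rational function `g / h` on the
curve, where `g` and `h` are nonzero forms of the same weight. -/
def IsPrincipal {K : Type*} [Field K] {F : K[X]} (D : CurvePoint F →₀ ℤ) : Prop :=
  ∃ (d : ℕ) (g h : CurveForm K d), g.IsNonzero ∧ h.IsNonzero ∧
    ∀ p : CurvePoint F, D p = (g.ord p : ℤ) - (h.ord p : ℤ)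

/-- Linear equivalence of divisors. -/
def LinEquiv {K : Type*} [Field K] {F : K[X]} (D E : CurvePoint F →₀ ℤ) : Prop :=
  IsPrincipal (D - E)

/-- A point, as a divisor of degree `1`. -/
noncomputable def CurvePoint.div {K : Type*} [Field K] {F : K[X]} (p : CurvePoint F) :
    CurvePoint F →₀ ℤ :=
  Finsupp.single p 1

/-! ### The Kummer surface

The equation of the Kummer surface is `K₂ ξ₄² + K₁ ξ₄ + K₀ = 0`, with the following forms in
`ξ₁, ξ₂, ξ₃`, where `K₁ = -2 F₀`. -/

/-- `F₀`: in affine coordinates `ξ₁ = 1`, `ξ₂ = x + u`, `ξ₃ = x u` it is `F₀(x, u)`. -/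
def formF0 {R : Type*} [CommRing R] (f : ℕ → R) (a b c : R) : R :=
  2 * f 0 * a ^ 3 + f 1 * a ^ 2 * b + 2 * f 2 * a ^ 2 * c + f 3 * a * b * c
    + 2 * f 4 * a * c ^ 2 + f 5 * b * c ^ 2 + 2 * f 6 * c ^ 3

/-- `K₂ = ξ₂² - 4 ξ₁ ξ₃`. -/
def formK2 {R : Type*} [CommRing R] (a b c : R) : R := b ^ 2 - 4 * a * c

/-- `K₀`: in affine coordinates it is `(F₀(x, u)² - 4 F(x) F(u)) / (x - u)²`. -/
def formK0 {R : Type*} [CommRing R] (f : ℕ → R) (a b c : R) : R :=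
  (f 1 ^ 2 - 4 * f 0 * f 2) * a ^ 4 - 4 * f 0 * f 3 * a ^ 3 * b - 2 * f 1 * f 3 * a ^ 3 * c
    - 4 * f 0 * f 4 * a ^ 2 * b ^ 2 + 4 * (f 0 * f 5 - f 1 * f 4) * a ^ 2 * b * c
    + (f 3 ^ 2 + 2 * f 1 * f 5 - 4 * f 2 * f 4 - 4 * f 0 * f 6) * a ^ 2 * c ^ 2
    - 4 * f 0 * f 5 * a * b ^ 3 + 4 * (2 * f 0 * f 6 - f 1 * f 5) * a * b ^ 2 * c
    + 4 * (f 1 * f 6 - f 2 * f 5) * a * b * c ^ 2 - 2 * f 3 * f 5 * a * c ^ 3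
    - 4 * f 0 * f 6 * b ^ 4 - 4 * f 1 * f 6 * b ^ 3 * c - 4 * f 2 * f 6 * b ^ 2 * c ^ 2
    - 4 * f 3 * f 6 * b * c ^ 3 + (f 5 ^ 2 - 4 * f 4 * f 6) * c ^ 4

/-- The quartic form `K₂ ξ₄² + K₁ ξ₄ + K₀` defining the Kummer surface. -/
noncomputable def kummerQuartic {K : Type*} [Field K] (F : K[X]) : MvPolynomial (Fin 4) K :=
  let ξ : Fin 4 → MvPolynomial (Fin 4) K := MvPolynomial.X
  let f : ℕ → MvPolynomial (Fin 4) K := fun j => MvPolynomial.C (F.coeff j)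
  formK2 (ξ 0) (ξ 1) (ξ 2) * ξ 3 ^ 2 - 2 * formF0 f (ξ 0) (ξ 1) (ξ 2) * ξ 3
    + formK0 f (ξ 0) (ξ 1) (ξ 2)

open Classical in
/-- The Kummer coordinates `(ξ₁, ξ₂, ξ₃, ξ₄)` of the divisor `p + q`.

If `p` and `q` have different `X`-coordinates these are the homogenised values of
`1, x + u, x u, β₀ = (F₀(x, u) - 2 y v) / (x - u)²`.  If `q` is the conjugate of `p`, so that
`p + q` is canonical, we get `(0 : 0 : 0 : 1)`.  In the remaining case `p = q` is not a Weierstrass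
point, and `ξ₄` is the only root of the equation of the surface, in which `K₂ = 0 ≠ K₁` (the
limiting value of `β₀`). -/
noncomputable def kummerVec {K : Type*} [Field K] {F : K[X]} (p q : CurvePoint F) : Fin 4 → K :=
  let a := p.zCoord * q.zCoord
  let b := p.xCoord * q.zCoord + q.xCoord * p.zCoord
  let c := p.xCoord * q.xCoord
  let δ := p.xCoord * q.zCoord - q.xCoord * p.zCoord
  if δ ≠ 0 then ![a, b, c, (formF0 F.coeff a b c - 2 * p.yCoord * q.yCoord) / δ ^ 2]
  else if p.yCoord = -q.yCoord then ![0, 0, 0, 1]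
  else ![a, b, c, formK0 F.coeff a b c / (2 * formF0 F.coeff a b c)]

theorem kummerVec_ne_zero {K : Type*} [Field K] {F : K[X]} (p q : CurvePoint F) :
    kummerVec p q ≠ 0 := by
  have key : ∀ t : K, ![p.zCoord * q.zCoord,
      p.xCoord * q.zCoord + q.xCoord * p.zCoord, p.xCoord * q.xCoord, t] ≠ 0 := by
    intro t h
    have h0 := congrFun h 0
    have h1 := congrFun h 1
    have h2 := congrFun h 2
    cases p <;> cases q <;> simp_all [CurvePoint.zCoord, CurvePoint.xCoord]
  unfold kummerVec
  dsimp only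
  split_ifs
  · exact key _
  · intro h
    simpa using congrFun h 3
  · exact key _

/-- The point of `ℙ³` attached to the divisor `p + q`. -/
noncomputable def kummerPoint {K : Type*} [Field K] {F : K[X]} (p q : CurvePoint F) :
    ℙ K (Fin 4 → K) :=
  Projectivization.mk K (kummerVec p q) (kummerVec_ne_zero p q)

/-- The Kummer surface belonging to the curve: the locus of the points `kummerPoint p q`. -/
def kummerSurface {K : Type*} [Field K] (F : K[X]) : Set (ℙ K (Fin 4 → K)) :=
  {ξ | ∃ p q : CurvePoint F, ξ = kummerPoint p q}

theorem kummerPoint_mem {K : Type*} [Field K] {F : K[X]} (p q : CurvePoint F) :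
    kummerPoint p q ∈ kummerSurface F :=
  ⟨p, q, rfl⟩

/-! ### The projective dual -/

/-- The gradient of the Kummer quartic. -/
noncomputable def kummerGradient {K : Type*} [Field K] (F : K[X]) (v : Fin 4 → K) : Fin 4 → K :=
  fun j => MvPolynomial.eval v (MvPolynomial.pderiv j (kummerQuartic F))

/-- The tangent planes of the Kummer surface at its smooth points, in dual coordinates: the plane
`∑ ηⱼ ξⱼ = 0` is the point `η`. -/
def tangentPlanes {K : Type*} [Field K] (F : K[X]) : Set (ℙ K (Fin 4 → K)) :=
  {η | ∃ ξ ∈ kummerSurface F, ∃ h : kummerGradient F ξ.rep ≠ 0,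
    η = Projectivization.mk K (kummerGradient F ξ.rep) h}

/-- The projective dual of the Kummer surface: the Zariski closure, in the dual space, of the set
of tangent planes at smooth points. -/
def dualKummerSurface {K : Type*} [Field K] (F : K[X]) : Set (ℙ K (Fin 4 → K)) :=
  {η | ∀ (n : ℕ) (P : MvPolynomial (Fin 4) K), P.IsHomogeneous n →
    (∀ τ ∈ tangentPlanes F, MvPolynomial.eval τ.rep P = 0) → MvPolynomial.eval η.rep P = 0}

/-! ### Addition of a point -/

/-- The map `W` from the Kummer surface to its dual is induced by the addition of the point `a`:
it sends the point of `[p + q]` to the plane of the divisor class `[p + q + a]` of degree `3`, that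
is, to a plane which contains the points of all the classes `[p + q + a - r]` of degree `2`, for
`r` on the curve. -/
def IsInducedByAddition {K : Type*} [Field K] {F : K[X]} (a : CurvePoint F)
    (W : kummerSurface F → dualKummerSurface F) : Prop :=
  ∀ p q r s t : CurvePoint F,
    LinEquiv (s.div + t.div) (p.div + q.div + a.div - r.div) →
      Projectivization.orthogonal (W ⟨kummerPoint p q, kummerPoint_mem p q⟩ : ℙ K (Fin 4 → K))
        (kummerPoint s t)

/-- The matrix attached to a root `θ` of `F`. -/
def weierstrassMatrix {K : Type*} [Field K] (F : K[X]) (θ : K) : Matrix (Fin 4) (Fin 4) K :=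
  let f := F.coeff
  let a₁₃ := θ * (f 3 + 2 * f 4 * θ + 2 * f 5 * θ ^ 2 + 2 * θ ^ 3)
  !![0, -f 1 - 2 * (f 0 / θ), a₁₃, θ ^ 2;
     f 1 + 2 * (f 0 / θ), 0, θ ^ 2 * (f 5 + 2 * θ), -θ;
     -a₁₃, -(θ ^ 2 * (f 5 + 2 * θ)), 0, 1;
     -θ ^ 2, θ, -1, 0]

end GenusTwo

/-!
For a root `θ` of `F`, with Weierstrass point `a = (θ, 0)`, the antisymmetric matrix `A` of the
theorem defines a null polarity `polar`. The equation of `θ` removes the denominator from `A`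
(`weierstrassMatrix_mulVec`), and the permuted matrix `pole` inverts it up to `-F'(θ) ≠ 0`
(`pole_polar`). The map `W` sends the point `κ(p + q)` to its polar plane, and three things have
to be shown.

*The polar plane of `κ(p + q)` contains `κ(s + t)` whenever `s + t ~ p + q + a - r`.* The orders
of vanishing are those of discrete valuations at the smooth points of the curve (`HasOrd.mul`), so
a function whose divisor is `s + t + r - p - q - a` can be multiplied by the cubic form which
vanishes at `p`, `q`, `a` and their conjugates, and the result divided by the norm of the
denominator (`LinEquiv.exists_form`). This gives a form `A₃(X) + βY` of weight `3` with divisor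
`s + t + r + p̄ + q̄ + a`. If `β = 0` the six points fall into conjugate pairs and only incidences
that follow from the antisymmetry of `A` are needed (`orthogonal_of_conjPaired`). If `β ≠ 0` the
points lie on a cubic `Y = M(X)` with `M(θ) = 0`, and `F - M²` is, up to a scalar, the product of
the linear forms of the six points. The Kummer coordinates of a pair of points on
`Y = M(X)` are polynomials in `M` and the residual factor of `F - M²` (`kummerVec_of_interp`), and the incidence becomes a
polynomial identity (`interp_orthogonal`). The two cases are joined in
`LinEquiv.dotProduct_polar_eq_zero`.

*A map with this property is unique.* For each class the points `κ(p + q + a - r)` span a plane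
(`exists_linearIndependent_translates`). For `p ≠ q` the choices `r = a, p, q` usually suffice.
For `p = q` the third point comes from a cubic through `a` which touches the curve at the
conjugate of `p` (`exists_linEquiv_double`); in the pencil of such cubics some member has contact
of order exactly two there.

*The polar planes belong to the dual surface.* For generic `ξ` on the surface put `η = ∇Q(ξ)`,
with `Q` the Kummer quartic, and let `τ` be the pole of `η`. Then `Q(τ) = 0` and `∇Q(τ)` is a
multiple of `A ξ` (`polarIsTangent_of_ne`), so that `A ξ` is the tangent plane at `τ`, provided
that `∇Q(τ) ≠ 0`. The identity is proved in a normal form, in which the three values `x`, `u`, `θ`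
of `X` are moved to `0`, `∞`, `1` by two translations and an inversion. For a fixed point `p` the
gradient `∇Q(τ)` is not identically zero in `q`: after division of `∇Q(ξ)` by `K₂` it has a
nonzero value at the conjugate of `p` (`quarticGrad_pole_reducedGrad_conj`). Hence a form which
vanishes on all tangent planes vanishes at `A κ(p + q)` for generic `p` and `q`, and since the
coordinate ring of the curve is a domain it does so everywhere (`eval_polar_kummerVec`).
-/

namespace GenusTwo

/-! ### The Kummer quartic and its gradient -/

/-- The Kummer quartic as a function of its coefficients and of a point. -/
def quartic {R : Type*} [CommRing R] (f : ℕ → R) (ξ : Fin 4 → R) : R :=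
  formK2 (ξ 0) (ξ 1) (ξ 2) * ξ 3 ^ 2 - 2 * formF0 f (ξ 0) (ξ 1) (ξ 2) * ξ 3
    + formK0 f (ξ 0) (ξ 1) (ξ 2)

/-- The gradient of the Kummer quartic as a function of its coefficients and of a point. -/
def quarticGrad {R : Type*} [CommRing R] (f : ℕ → R) (ξ : Fin 4 → R) : Fin 4 → R :=
  let a := ξ 0
  let b := ξ 1
  let c := ξ 2
  let d := ξ 3
  ![-4 * c * d ^ 2
      - 2 * d * (6 * f 0 * a ^ 2 + 2 * f 1 * a * b + 4 * f 2 * a * c + f 3 * b * c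
        + 2 * f 4 * c ^ 2)
      + (4 * (f 1 ^ 2 - 4 * f 0 * f 2) * a ^ 3 - 12 * f 0 * f 3 * a ^ 2 * b
        - 6 * f 1 * f 3 * a ^ 2 * c - 8 * f 0 * f 4 * a * b ^ 2
        + 8 * (f 0 * f 5 - f 1 * f 4) * a * b * c
        + 2 * (f 3 ^ 2 + 2 * f 1 * f 5 - 4 * f 2 * f 4 - 4 * f 0 * f 6) * a * c ^ 2
        - 4 * f 0 * f 5 * b ^ 3 + 4 * (2 * f 0 * f 6 - f 1 * f 5) * b ^ 2 * c
        + 4 * (f 1 * f 6 - f 2 * f 5) * b * c ^ 2 - 2 * f 3 * f 5 * c ^ 3),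
    2 * b * d ^ 2 - 2 * d * (f 1 * a ^ 2 + f 3 * a * c + f 5 * c ^ 2)
      + (-4 * f 0 * f 3 * a ^ 3 - 8 * f 0 * f 4 * a ^ 2 * b
        + 4 * (f 0 * f 5 - f 1 * f 4) * a ^ 2 * c - 12 * f 0 * f 5 * a * b ^ 2
        + 8 * (2 * f 0 * f 6 - f 1 * f 5) * a * b * c
        + 4 * (f 1 * f 6 - f 2 * f 5) * a * c ^ 2 - 16 * f 0 * f 6 * b ^ 3
        - 12 * f 1 * f 6 * b ^ 2 * c - 8 * f 2 * f 6 * b * c ^ 2 - 4 * f 3 * f 6 * c ^ 3),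
    -4 * a * d ^ 2
      - 2 * d * (2 * f 2 * a ^ 2 + f 3 * a * b + 4 * f 4 * a * c + 2 * f 5 * b * c
        + 6 * f 6 * c ^ 2)
      + (-2 * f 1 * f 3 * a ^ 3 + 4 * (f 0 * f 5 - f 1 * f 4) * a ^ 2 * b
        + 2 * (f 3 ^ 2 + 2 * f 1 * f 5 - 4 * f 2 * f 4 - 4 * f 0 * f 6) * a ^ 2 * c
        + 4 * (2 * f 0 * f 6 - f 1 * f 5) * a * b ^ 2
        + 8 * (f 1 * f 6 - f 2 * f 5) * a * b * c - 6 * f 3 * f 5 * a * c ^ 2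
        - 4 * f 1 * f 6 * b ^ 3 - 8 * f 2 * f 6 * b ^ 2 * c - 12 * f 3 * f 6 * b * c ^ 2
        + 4 * (f 5 ^ 2 - 4 * f 4 * f 6) * c ^ 3),
    2 * formK2 a b c * d - 2 * formF0 f a b c]

theorem kummerGradient_eq {K : Type*} [Field K] (F : K[X]) (v : Fin 4 → K) :
    kummerGradient F v = quarticGrad F.coeff v := by
  have h2 : ∀ j : Fin 4, MvPolynomial.pderiv j (2 : MvPolynomial (Fin 4) K) = 0 := fun j => by
    exact_mod_cast (MvPolynomial.pderiv j).map_natCast 2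
  have h4 : ∀ j : Fin 4, MvPolynomial.pderiv j (4 : MvPolynomial (Fin 4) K) = 0 := fun j => by
    exact_mod_cast (MvPolynomial.pderiv j).map_natCast 4
  funext j
  fin_cases j <;>
  · simp [kummerGradient, kummerQuartic, formK2, formF0, formK0, quarticGrad,
      MvPolynomial.pderiv_X, h2, h4, Derivation.leibniz, Derivation.leibniz_pow]
    ring

theorem quartic_smul {R : Type*} [CommRing R] (f : ℕ → R) (t : R) (ξ : Fin 4 → R) :
    quartic f (t • ξ) = t ^ 4 * quartic f ξ := by
  simp only [quartic, formK2, formF0, formK0, Pi.smul_apply, smul_eq_mul]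
  ring

theorem quarticGrad_smul {R : Type*} [CommRing R] (f : ℕ → R) (t : R) (ξ : Fin 4 → R) :
    quarticGrad f (t • ξ) = t ^ 3 • quarticGrad f ξ := by
  funext j
  fin_cases j <;>
  · simp [quarticGrad, formK2, formF0]
    ring

/-! ### The null polarity of a root -/

/-- The plane with coordinates `A ξ`, where `A` is the antisymmetric matrix attached to the root
`θ`; the entry `-f₁ - 2 f₀ / θ` is written without denominators by means of the equation of `θ`,
and the leading coefficient `f 6` is arbitrary. -/
def polar {R : Type*} [CommRing R] (f : ℕ → R) (θ : R) (ξ : Fin 4 → R) : Fin 4 → R :=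
  let a₁₂ := f 1 + 2 * (f 2 * θ + f 3 * θ ^ 2 + f 4 * θ ^ 3 + f 5 * θ ^ 4 + f 6 * θ ^ 5)
  let a₁₃ := θ * (f 3 + 2 * f 4 * θ + 2 * f 5 * θ ^ 2 + 2 * f 6 * θ ^ 3)
  let a₂₃ := θ ^ 2 * (f 5 + 2 * f 6 * θ)
  ![a₁₂ * ξ 1 + a₁₃ * ξ 2 + θ ^ 2 * ξ 3,
    -a₁₂ * ξ 0 + a₂₃ * ξ 2 - θ * ξ 3,
    -a₁₃ * ξ 0 - a₂₃ * ξ 1 + ξ 3,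
    -θ ^ 2 * ξ 0 + θ * ξ 1 - ξ 2]

/-- The point which is, up to a scalar, the pole of the plane `η` in the null polarity `polar`: the
entries of the matrix are those of `A`, permuted. -/
def pole {R : Type*} [CommRing R] (f : ℕ → R) (θ : R) (η : Fin 4 → R) : Fin 4 → R :=
  let a₁₂ := f 1 + 2 * (f 2 * θ + f 3 * θ ^ 2 + f 4 * θ ^ 3 + f 5 * θ ^ 4 + f 6 * θ ^ 5)
  let a₁₃ := θ * (f 3 + 2 * f 4 * θ + 2 * f 5 * θ ^ 2 + 2 * f 6 * θ ^ 3)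
  let a₂₃ := θ ^ 2 * (f 5 + 2 * f 6 * θ)
  ![η 1 + θ * η 2 + a₂₃ * η 3,
    -η 0 + θ ^ 2 * η 2 - a₁₃ * η 3,
    -θ * η 0 - θ ^ 2 * η 1 + a₁₂ * η 3,
    -a₂₃ * η 0 + a₁₃ * η 1 - a₁₂ * η 2]

theorem polar_smul {R : Type*} [CommRing R] (f : ℕ → R) (θ t : R) (ξ : Fin 4 → R) :
    polar f θ (t • ξ) = t • polar f θ ξ := by
  funext j
  fin_cases j <;>
  · simp [polar]
    ring

theorem pole_smul {R : Type*} [CommRing R] (f : ℕ → R) (θ t : R) (η : Fin 4 → R) :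
    pole f θ (t • η) = t • pole f θ η := by
  funext j
  fin_cases j <;>
  · simp [pole]
    ring

theorem dotProduct_polar_self {R : Type*} [CommRing R] (f : ℕ → R) (θ : R) (ξ : Fin 4 → R) :
    ξ ⬝ᵥ polar f θ ξ = 0 := by
  simp [polar, dotProduct, Fin.sum_univ_four]
  ring

theorem dotProduct_polar_comm {R : Type*} [CommRing R] (f : ℕ → R) (θ : R) (ξ ζ : Fin 4 → R) :
    ξ ⬝ᵥ polar f θ ζ = -(ζ ⬝ᵥ polar f θ ξ) := by
  simp [polar, dotProduct, Fin.sum_univ_four]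
  ring

/-- The matrix of `pole` inverts `A` up to the scalar `-F'(θ)`, which is nonzero when `θ` is a
simple root. -/
theorem pole_polar {R : Type*} [CommRing R] (f : ℕ → R) (θ : R) (ξ : Fin 4 → R) :
    pole f θ (polar f θ ξ) = (-(f 1 + 2 * f 2 * θ + 3 * f 3 * θ ^ 2 + 4 * f 4 * θ ^ 3
      + 5 * f 5 * θ ^ 4 + 6 * f 6 * θ ^ 5)) • ξ := by
  funext j
  fin_cases j <;>
  · simp [polar, pole]
    ring

theorem weierstrassMatrix_mulVec {K : Type*} [Field K] {F : K[X]} {θ : K} (h6 : F.coeff 6 = 1)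
    (hθ0 : θ ≠ 0) (hθ : F.coeff 0 + F.coeff 1 * θ + F.coeff 2 * θ ^ 2 + F.coeff 3 * θ ^ 3
      + F.coeff 4 * θ ^ 4 + F.coeff 5 * θ ^ 5 + F.coeff 6 * θ ^ 6 = 0) (ξ : Fin 4 → K) :
    (weierstrassMatrix F θ).mulVec ξ = polar F.coeff θ ξ := by
  have h12 : -F.coeff 1 - 2 * (F.coeff 0 / θ) = F.coeff 1 + 2 * (F.coeff 2 * θ
      + F.coeff 3 * θ ^ 2 + F.coeff 4 * θ ^ 3 + F.coeff 5 * θ ^ 4 + F.coeff 6 * θ ^ 5) := by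
    field_simp
    linear_combination -2 * hθ
  have h12' : F.coeff 1 + 2 * (F.coeff 0 / θ) = -(F.coeff 1 + 2 * (F.coeff 2 * θ
      + F.coeff 3 * θ ^ 2 + F.coeff 4 * θ ^ 3 + F.coeff 5 * θ ^ 4 + F.coeff 6 * θ ^ 5)) := by
    rw [← h12]; ring
  funext j
  fin_cases j <;>
  · simp only [weierstrassMatrix, h12, h12']
    simp [polar, Matrix.mulVec, dotProduct, Fin.sum_univ_four, h6] <;> ring

/-! ### Tangency of the polar plane -/

/-- The polar plane of `ξ` is, up to a scalar, given by the gradient of the quartic at the pole of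
the gradient at `ξ`, and this pole lies on the quartic. -/
def PolarIsTangent {R : Type*} [CommRing R] (f : ℕ → R) (θ : R) (ξ : Fin 4 → R) : Prop :=
  quartic f (pole f θ (quarticGrad f ξ)) = 0 ∧
    ∃ h : R, quarticGrad f (pole f θ (quarticGrad f ξ)) = h • polar f θ ξ

theorem PolarIsTangent.smul {R : Type*} [CommRing R] {f : ℕ → R} {θ : R} {ξ : Fin 4 → R}
    (H : PolarIsTangent f θ ξ) (t : R) : PolarIsTangent f θ (t • ξ) := by
  obtain ⟨h0, h, hh⟩ := H
  rw [PolarIsTangent, quarticGrad_smul, pole_smul, quartic_smul, quarticGrad_smul, polar_smul, h0,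
    hh, mul_zero]
  refine ⟨rfl, h * t ^ 8, ?_⟩
  rw [smul_smul, smul_smul]
  congr 1
  ring

/-- The coefficients of `F(X + t)`, where `f` are those of `F`. -/
def shiftCoeff {R : Type*} [CommRing R] (f : ℕ → R) (t : R) : ℕ → R
  | 0 => f 0 + f 1 * t + f 2 * t ^ 2 + f 3 * t ^ 3 + f 4 * t ^ 4 + f 5 * t ^ 5 + f 6 * t ^ 6
  | 1 => f 1 + 2 * f 2 * t + 3 * f 3 * t ^ 2 + 4 * f 4 * t ^ 3 + 5 * f 5 * t ^ 4
      + 6 * f 6 * t ^ 5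
  | 2 => f 2 + 3 * f 3 * t + 6 * f 4 * t ^ 2 + 10 * f 5 * t ^ 3 + 15 * f 6 * t ^ 4
  | 3 => f 3 + 4 * f 4 * t + 10 * f 5 * t ^ 2 + 20 * f 6 * t ^ 3
  | 4 => f 4 + 5 * f 5 * t + 15 * f 6 * t ^ 2
  | 5 => f 5 + 6 * f 6 * t
  | 6 => f 6
  | _ => 0

/-- The action on the Kummer coordinates of the substitution of `X + t` for `X` in the equation of
the curve. -/
def shiftPoint {R : Type*} [CommRing R] (f : ℕ → R) (t : R) (ξ : Fin 4 → R) : Fin 4 → R :=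
  ![ξ 0, ξ 1 - 2 * t * ξ 0, ξ 2 - t * ξ 1 + t ^ 2 * ξ 0,
    ξ 3 + (-f 3 * t - 2 * f 4 * t ^ 2 - 4 * f 5 * t ^ 3 - 8 * f 6 * t ^ 4) * ξ 0
      + (f 5 * t ^ 2 + 4 * f 6 * t ^ 3) * ξ 1 + (-2 * f 5 * t - 6 * f 6 * t ^ 2) * ξ 2]

/-- The transpose of `shiftPoint`. -/
def shiftPlane {R : Type*} [CommRing R] (f : ℕ → R) (t : R) (η : Fin 4 → R) : Fin 4 → R :=
  ![η 0 - 2 * t * η 1 + t ^ 2 * η 2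
      + (-f 3 * t - 2 * f 4 * t ^ 2 - 4 * f 5 * t ^ 3 - 8 * f 6 * t ^ 4) * η 3,
    η 1 - t * η 2 + (f 5 * t ^ 2 + 4 * f 6 * t ^ 3) * η 3,
    η 2 + (-2 * f 5 * t - 6 * f 6 * t ^ 2) * η 3,
    η 3]

set_option maxHeartbeats 1000000 in
theorem quartic_shift {R : Type*} [CommRing R] (f : ℕ → R) (t : R) (ξ : Fin 4 → R) :
    quartic (shiftCoeff f t) (shiftPoint f t ξ) = quartic f ξ := by
  simp [quartic, formK2, formF0, formK0, shiftCoeff, shiftPoint]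
  ring

set_option maxHeartbeats 4000000 in
theorem quarticGrad_shift {R : Type*} [CommRing R] (f : ℕ → R) (t : R) (ξ : Fin 4 → R) :
    shiftPlane f t (quarticGrad (shiftCoeff f t) (shiftPoint f t ξ)) = quarticGrad f ξ := by
  funext j
  fin_cases j <;>
  · simp [quarticGrad, formK2, formF0, shiftCoeff, shiftPoint, shiftPlane]
    ring

theorem polar_shift {R : Type*} [CommRing R] (f : ℕ → R) (θ t : R) (ξ : Fin 4 → R) :
    shiftPlane f t (polar (shiftCoeff f t) (θ - t) (shiftPoint f t ξ)) = polar f θ ξ := by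
  funext j
  fin_cases j <;>
  · simp [polar, shiftCoeff, shiftPoint, shiftPlane]
    ring

theorem pole_shift {R : Type*} [CommRing R] (f : ℕ → R) (θ t : R) (η : Fin 4 → R) :
    shiftPoint f t (pole f θ (shiftPlane f t η)) = pole (shiftCoeff f t) (θ - t) η := by
  funext j
  fin_cases j <;>
  · simp [pole, shiftCoeff, shiftPoint, shiftPlane]
    ring

theorem shiftPlane_smul {R : Type*} [CommRing R] (f : ℕ → R) (t c : R) (η : Fin 4 → R) :
    shiftPlane f t (c • η) = c • shiftPlane f t η := by
  funext j
  fin_cases j <;> simp [shiftPlane] <;> ring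

theorem PolarIsTangent.of_shift {R : Type*} [CommRing R] {f : ℕ → R} {θ : R} (t : R)
    {ξ : Fin 4 → R} (H : PolarIsTangent (shiftCoeff f t) (θ - t) (shiftPoint f t ξ)) :
    PolarIsTangent f θ ξ := by
  obtain ⟨h0, h, hh⟩ := H
  rw [← pole_shift, quarticGrad_shift] at h0 hh
  refine ⟨by rw [← h0, quartic_shift], h, ?_⟩
  rw [← quarticGrad_shift f t, hh, shiftPlane_smul, polar_shift]

/-- The coefficients of `X⁶ F(s / X)`, where `f` are those of `F`. -/
def invCoeff {R : Type*} [CommRing R] (f : ℕ → R) (s : R) (j : ℕ) : R :=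
  f (6 - j) * s ^ (6 - j)

/-- The action on the Kummer coordinates of the substitution of `s / X` for `X` in the equation of
the curve. -/
def invPoint {R : Type*} [CommRing R] (s : R) (ξ : Fin 4 → R) : Fin 4 → R :=
  ![ξ 2, s * ξ 1, s ^ 2 * ξ 0, s ^ 4 * ξ 3]

/-- The transpose of `invPoint`. -/
def invPlane {R : Type*} [CommRing R] (s : R) (η : Fin 4 → R) : Fin 4 → R :=
  ![s ^ 2 * η 2, s * η 1, η 0, s ^ 4 * η 3]

theorem quartic_inv {R : Type*} [CommRing R] (f : ℕ → R) (s : R) (ξ : Fin 4 → R) :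
    quartic (invCoeff f s) (invPoint s ξ) = s ^ 10 * quartic f ξ := by
  simp [quartic, formK2, formF0, formK0, invCoeff, invPoint]
  ring

theorem quarticGrad_inv {R : Type*} [CommRing R] (f : ℕ → R) (s : R) (ξ : Fin 4 → R) :
    invPlane s (quarticGrad (invCoeff f s) (invPoint s ξ)) = s ^ 10 • quarticGrad f ξ := by
  funext j
  fin_cases j <;>
  · simp [quarticGrad, formK2, formF0, invCoeff, invPoint, invPlane]
    ring

section Inversion

variable {K : Type*} [Field K] {f : ℕ → K} {θ : K}

theorem polar_inv (hθ0 : θ ≠ 0) (hθ : f 0 + f 1 * θ + f 2 * θ ^ 2 + f 3 * θ ^ 3 + f 4 * θ ^ 4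
      + f 5 * θ ^ 5 + f 6 * θ ^ 6 = 0) (s : K) (ξ : Fin 4 → K) :
    invPlane s (polar (invCoeff f s) (s / θ) (invPoint s ξ)) = (s ^ 6 / θ ^ 2) • polar f θ ξ := by
  have h0 : f 0 = -(f 1 * θ + f 2 * θ ^ 2 + f 3 * θ ^ 3 + f 4 * θ ^ 4
      + f 5 * θ ^ 5 + f 6 * θ ^ 6) := by linear_combination hθ
  funext j
  fin_cases j <;>
  · simp [polar, invCoeff, invPoint, invPlane, h0]
    field_simp
    ring

theorem pole_inv (hθ0 : θ ≠ 0) (hθ : f 0 + f 1 * θ + f 2 * θ ^ 2 + f 3 * θ ^ 3 + f 4 * θ ^ 4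
      + f 5 * θ ^ 5 + f 6 * θ ^ 6 = 0) (s : K) (η : Fin 4 → K) :
    invPoint s (pole f θ (invPlane s η)) = (-(θ ^ 2 * s)) • pole (invCoeff f s) (s / θ) η := by
  have h0 : f 0 = -(f 1 * θ + f 2 * θ ^ 2 + f 3 * θ ^ 3 + f 4 * θ ^ 4
      + f 5 * θ ^ 5 + f 6 * θ ^ 6) := by linear_combination hθ
  funext j
  fin_cases j <;>
  · simp [pole, invCoeff, invPoint, invPlane, h0]
    field_simp
    ring

theorem invPoint_smul (s t : K) (ξ : Fin 4 → K) : invPoint s (t • ξ) = t • invPoint s ξ := by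
  funext j
  fin_cases j <;> simp [invPoint] <;> ring

theorem invPlane_smul (s t : K) (ξ : Fin 4 → K) : invPlane s (t • ξ) = t • invPlane s ξ := by
  funext j
  fin_cases j <;> simp [invPlane] <;> ring

theorem PolarIsTangent.of_inv (hθ0 : θ ≠ 0) (hθ : f 0 + f 1 * θ + f 2 * θ ^ 2 + f 3 * θ ^ 3
      + f 4 * θ ^ 4 + f 5 * θ ^ 5 + f 6 * θ ^ 6 = 0) {s : K} (hs : s ≠ 0) {ξ : Fin 4 → K}
    (H : PolarIsTangent (invCoeff f s) (s / θ) (invPoint s ξ)) : PolarIsTangent f θ ξ := by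
  obtain ⟨h0, h, hh⟩ := H
  set τ' := pole (invCoeff f s) (s / θ) (quarticGrad (invCoeff f s) (invPoint s ξ)) with hτ'
  set τ := pole f θ (quarticGrad f ξ) with hτ
  have e1 : invPoint s τ = (-(θ ^ 2 * s) / s ^ 10) • τ' := by
    have := pole_inv hθ0 hθ s (quarticGrad (invCoeff f s) (invPoint s ξ))
    rw [quarticGrad_inv, pole_smul, invPoint_smul] at this
    rw [div_eq_inv_mul, mul_smul, ← this, smul_smul, inv_mul_cancel₀ (pow_ne_zero _ hs), one_smul]
  have e2 := quartic_inv f s τ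
  rw [e1, quartic_smul, h0, mul_zero, eq_comm, mul_eq_zero] at e2
  refine ⟨e2.resolve_left (pow_ne_zero _ hs), ?_⟩
  have e3 := quarticGrad_inv f s τ
  rw [e1, quarticGrad_smul, hh, smul_smul, invPlane_smul, polar_inv hθ0 hθ, smul_smul] at e3
  refine ⟨(s ^ 10)⁻¹ * ((-(θ ^ 2 * s) / s ^ 10) ^ 3 * h * (s ^ 6 / θ ^ 2)), ?_⟩
  rw [mul_smul, e3, smul_smul, inv_mul_cancel₀ (pow_ne_zero _ hs), one_smul]

end Inversion

/-- The tangency of the polar plane in the normal form in which the root is `1`, and the points of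
the divisor lie over `0` and `∞`. -/
theorem polarIsTangent_normalForm {R : Type*} [CommRing R] {f : ℕ → R} {v y : R}
    (h0 : f 0 = v ^ 2) (h6 : f 6 = y ^ 2)
    (hθ : f 0 + f 1 + f 2 + f 3 + f 4 + f 5 + f 6 = 0) :
    PolarIsTangent f 1 ![0, 1, 0, -2 * y * v] := by
  have h2 : f 2 = -(v ^ 2 + f 1 + f 3 + f 4 + f 5 + y ^ 2) := by
    linear_combination hθ - h0 - h6
  have e1 : quarticGrad f ![0, 1, 0, -2 * y * v]
      = (-4 : R) • ![f 5 * v ^ 2, 2 * v ^ 2 * y ^ 2, f 1 * y ^ 2, v * y] := by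
    funext j
    fin_cases j <;>
    · simp [quarticGrad, formK2, formF0, h0, h6]
      ring
  have e2 : pole f 1 ![f 5 * v ^ 2, 2 * v ^ 2 * y ^ 2, f 1 * y ^ 2, v * y]
      = ![f 1 * y ^ 2 + f 5 * v * y + 2 * v * y ^ 3 + 2 * v ^ 2 * y ^ 2,
        f 1 * y ^ 2 - f 3 * v * y - 2 * f 4 * v * y - 2 * f 5 * v * y - f 5 * v ^ 2
          - 2 * v * y ^ 3,
        -f 1 * v * y - f 5 * v ^ 2 - 2 * v ^ 2 * y ^ 2 - 2 * v ^ 3 * y,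
        2 * f 1 * v ^ 2 * y ^ 2 + f 1 ^ 2 * y ^ 2 + 2 * f 3 * v ^ 2 * y ^ 2
          + 4 * f 4 * v ^ 2 * y ^ 2 + 2 * f 5 * v ^ 2 * y ^ 2 - f 5 ^ 2 * v ^ 2
          + 4 * v ^ 2 * y ^ 4] := by
    funext j
    fin_cases j <;>
    · simp [pole, h2, h6]
      ring
  rw [PolarIsTangent, e1, pole_smul, quartic_smul, quarticGrad_smul, e2]
  constructor
  · simp [quartic, formK2, formF0, formK0, h0, h2, h6]
    ring
  · set τ := ![f 1 * y ^ 2 + f 5 * v * y + 2 * v * y ^ 3 + 2 * v ^ 2 * y ^ 2,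
        f 1 * y ^ 2 - f 3 * v * y - 2 * f 4 * v * y - 2 * f 5 * v * y - f 5 * v ^ 2
          - 2 * v * y ^ 3,
        -f 1 * v * y - f 5 * v ^ 2 - 2 * v ^ 2 * y ^ 2 - 2 * v ^ 3 * y,
        2 * f 1 * v ^ 2 * y ^ 2 + f 1 ^ 2 * y ^ 2 + 2 * f 3 * v ^ 2 * y ^ 2
          + 4 * f 4 * v ^ 2 * y ^ 2 + 2 * f 5 * v ^ 2 * y ^ 2 - f 5 ^ 2 * v ^ 2
          + 4 * v ^ 2 * y ^ 4] with hτ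
    refine ⟨(-4) ^ 3 * quarticGrad f τ 3, ?_⟩
    rw [mul_smul]
    congr 1
    funext j
    fin_cases j <;>
    · simp [quarticGrad, polar, formK2, formF0, h0, h2, h6, hτ] <;> ring

/-- The polar plane is tangent for the class of two points over distinct values of `X`, both
different from the root. -/
theorem polarIsTangent_of_ne {K : Type*} [Field K] [IsAlgClosed K] {f : ℕ → K}
    {θ x u d : K} (hθ : f 0 + f 1 * θ + f 2 * θ ^ 2 + f 3 * θ ^ 3 + f 4 * θ ^ 4
      + f 5 * θ ^ 5 + f 6 * θ ^ 6 = 0) (hxu : x ≠ u) (hxθ : x ≠ θ) (huθ : u ≠ θ)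
    (hQ : quartic f ![1, x + u, x * u, d] = 0) :
    PolarIsTangent f θ ![1, x + u, x * u, d] := by
  have hp : x - u ≠ 0 := sub_ne_zero.2 hxu
  have hq : θ - u ≠ 0 := sub_ne_zero.2 huθ.symm
  have hr : x - θ ≠ 0 := sub_ne_zero.2 hxθ
  -- this parameter of the inversion sends the root to `1` after the two translations
  set s : K := (x - u) * (θ - u) / (x - θ) with hs
  have hs0 : s ≠ 0 := div_ne_zero (mul_ne_zero hp hq) hr
  apply PolarIsTangent.of_shift u
  have hθ1 : shiftCoeff f u 0 + shiftCoeff f u 1 * (θ - u) + shiftCoeff f u 2 * (θ - u) ^ 2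
      + shiftCoeff f u 3 * (θ - u) ^ 3 + shiftCoeff f u 4 * (θ - u) ^ 4
      + shiftCoeff f u 5 * (θ - u) ^ 5 + shiftCoeff f u 6 * (θ - u) ^ 6 = 0 := by
    rw [← hθ]
    simp only [shiftCoeff]
    ring
  apply PolarIsTangent.of_inv hq hθ1 hs0
  have hQ1 := quartic_inv (shiftCoeff f u) s (shiftPoint f u ![1, x + u, x * u, d])
  rw [quartic_shift, hQ, mul_zero] at hQ1
  set g := invCoeff (shiftCoeff f u) s with hg
  have hθ2 : g 0 + g 1 * (s / (θ - u)) + g 2 * (s / (θ - u)) ^ 2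
      + g 3 * (s / (θ - u)) ^ 3 + g 4 * (s / (θ - u)) ^ 4
      + g 5 * (s / (θ - u)) ^ 5 + g 6 * (s / (θ - u)) ^ 6 = 0 := by
    have : g 0 + g 1 * (s / (θ - u)) + g 2 * (s / (θ - u)) ^ 2
      + g 3 * (s / (θ - u)) ^ 3 + g 4 * (s / (θ - u)) ^ 4
      + g 5 * (s / (θ - u)) ^ 5 + g 6 * (s / (θ - u)) ^ 6
      = (s / (θ - u)) ^ 6 * (shiftCoeff f u 0 + shiftCoeff f u 1 * (θ - u)
      + shiftCoeff f u 2 * (θ - u) ^ 2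
      + shiftCoeff f u 3 * (θ - u) ^ 3 + shiftCoeff f u 4 * (θ - u) ^ 4
      + shiftCoeff f u 5 * (θ - u) ^ 5 + shiftCoeff f u 6 * (θ - u) ^ 6) := by
      simp only [hg, invCoeff]
      field_simp
      norm_num
      ring
    rw [this, hθ1, mul_zero]
  apply PolarIsTangent.of_shift (s / (x - u))
  rw [← quartic_shift g (s / (x - u))] at hQ1
  have e1 : s / (θ - u) - s / (x - u) = 1 := by
    rw [hs]
    field_simp
    ring
  rw [e1]
  set g' := shiftCoeff g (s / (x - u)) with hg'
  have hθ3 : g' 0 + g' 1 + g' 2 + g' 3 + g' 4 + g' 5 + g' 6 = 0 := by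
    rw [← hθ2, show s / (θ - u) = 1 + s / (x - u) by rw [← e1]; ring]
    simp only [hg', shiftCoeff]
    ring
  set ζ := shiftPoint g (s / (x - u)) (invPoint s (shiftPoint f u ![1, x + u, x * u, d])) with hζ
  have z0 : ζ 0 = 0 := by
    simp [hζ, shiftPoint, invPoint]
    ring
  have z1 : ζ 1 = s * (x - u) := by
    simp [hζ, shiftPoint, invPoint]
    field_simp
    ring
  have z2 : ζ 2 = 0 := by
    simp [hζ, shiftPoint, invPoint]
    field_simp
    ring
  have hb : s * (x - u) ≠ 0 := mul_ne_zero hs0 hp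
  have hζ' : ζ = (s * (x - u)) • ![0, 1, 0, ζ 3 / (s * (x - u))] := by
    funext j
    fin_cases j
    · simp [z0]
    · simp [z1]
    · simp [z2]
    · simp
      field_simp
  rw [hζ', quartic_smul, mul_eq_zero] at hQ1
  replace hQ1 := hQ1.resolve_left (pow_ne_zero _ hb)
  set ε := ζ 3 / (s * (x - u)) with hε
  rw [hζ']
  apply PolarIsTangent.smul
  have hε2 : ε ^ 2 = 4 * g' 0 * g' 6 := by
    simp [quartic, formK2, formF0, formK0] at hQ1
    linear_combination hQ1
  obtain ⟨y, hy⟩ := IsAlgClosed.exists_pow_nat_eq (g' 6) (n := 2) two_pos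
  obtain ⟨v, hv⟩ := IsAlgClosed.exists_pow_nat_eq (g' 0) (n := 2) two_pos
  have : (ε - -2 * y * v) * (ε - -2 * y * -v) = 0 := by
    linear_combination hε2 - 4 * g' 0 * hy - 4 * y ^ 2 * hv
  rcases mul_eq_zero.1 this with h | h
  · rw [sub_eq_zero.1 h]
    exact polarIsTangent_normalForm hv.symm hy.symm hθ3
  · rw [sub_eq_zero.1 h]
    exact polarIsTangent_normalForm (by rw [neg_sq, hv]) hy.symm hθ3

/-- At the pole of the trope of `θ`-translates of a point over `x`, the gradient is a multiple of
the equation of the trope, by a scalar which is nonzero when `F(x) ≠ 0`. -/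
theorem quarticGrad_pole_trope {R : Type*} [CommRing R] (f : ℕ → R) {θ : R} (x : R)
    (hθ : f 0 + f 1 * θ + f 2 * θ ^ 2 + f 3 * θ ^ 3 + f 4 * θ ^ 4
      + f 5 * θ ^ 5 + f 6 * θ ^ 6 = 0) :
    quarticGrad f (pole f θ ![x ^ 2, -x, 1, 0]) 2
      = 4 * (f 1 + 2 * f 2 * θ + 3 * f 3 * θ ^ 2 + 4 * f 4 * θ ^ 3
      + 5 * f 5 * θ ^ 4 + 6 * f 6 * θ ^ 5) * (f 0 + f 1 * x + f 2 * x ^ 2 + f 3 * x ^ 3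
      + f 4 * x ^ 4 + f 5 * x ^ 5 + f 6 * x ^ 6) := by
  have h0 : f 0 = -(f 1 * θ + f 2 * θ ^ 2 + f 3 * θ ^ 3 + f 4 * θ ^ 4
      + f 5 * θ ^ 5 + f 6 * θ ^ 6) := by linear_combination hθ
  simp [quarticGrad, pole, h0]
  ring

/-! ### Kummer coordinates of a divisor interpolated by a cubic -/

/-- The coefficients of `M² + (a X² - b X + c) H`, for `M` of degree `3` and `H` of degree `4` with
coefficients `m` and `h`. -/
def interpCoeff {R : Type*} [CommRing R] (m h : ℕ → R) (a b c : R) : ℕ → R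
  | 0 => m 0 ^ 2 + c * h 0
  | 1 => 2 * m 0 * m 1 + c * h 1 - b * h 0
  | 2 => 2 * m 0 * m 2 + m 1 ^ 2 + c * h 2 - b * h 1 + a * h 0
  | 3 => 2 * m 0 * m 3 + 2 * m 1 * m 2 + c * h 3 - b * h 2 + a * h 1
  | 4 => 2 * m 1 * m 3 + m 2 ^ 2 + c * h 4 - b * h 3 + a * h 2
  | 5 => 2 * m 2 * m 3 - b * h 4 + a * h 3
  | 6 => m 3 ^ 2 + a * h 4
  | _ => 0

/-- The fourth Kummer coordinate of the divisor cut out by `a X² - b X + c = 0` on `Y = M(X)`, for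
the curve `Y² = M² + (a X² - b X + c) H`. -/
def interpCoord {R : Type*} [CommRing R] (m h : ℕ → R) (a b c : R) : R :=
  -2 * (m 0 * m 2 * a + m 0 * m 3 * b + m 1 * m 3 * c)
    - (h 0 * a ^ 2 + h 2 * a * c + h 4 * c ^ 2)

theorem formF0_congr {R : Type*} [CommRing R] {f g : ℕ → R} (h : ∀ j < 7, f j = g j) (a b c : R) :
    formF0 f a b c = formF0 g a b c := by
  simp [formF0, h 0, h 1, h 2, h 3, h 4, h 5, h 6]

theorem formK0_congr {R : Type*} [CommRing R] {f g : ℕ → R} (h : ∀ j < 7, f j = g j) (a b c : R) :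
    formK0 f a b c = formK0 g a b c := by
  simp [formK0, h 0, h 1, h 2, h 3, h 4, h 5, h 6]

theorem polar_congr {R : Type*} [CommRing R] {f g : ℕ → R} (h : ∀ j < 7, f j = g j) (θ : R)
    (ξ : Fin 4 → R) : polar f θ ξ = polar g θ ξ := by
  simp [polar, h 1, h 2, h 3, h 4, h 5, h 6]

/-- `F(x, z)` for the binary sextic `F` with coefficients `f`. -/
def sextic {R : Type*} [CommRing R] (f : ℕ → R) (x z : R) : R :=
  f 0 * z ^ 6 + f 1 * x * z ^ 5 + f 2 * x ^ 2 * z ^ 4 + f 3 * x ^ 3 * z ^ 3 + f 4 * x ^ 4 * z ^ 2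
    + f 5 * x ^ 5 * z + f 6 * x ^ 6

/-- `M(x, z)` for the binary cubic `M` with coefficients `m`. -/
def cubic {R : Type*} [CommRing R] (m : ℕ → R) (x z : R) : R :=
  m 0 * z ^ 3 + m 1 * x * z ^ 2 + m 2 * x ^ 2 * z + m 3 * x ^ 3

/-- The relation between the forms of the Kummer quartic and the sextic, which says that
`K₂ ξ₄ - F₀ = ∓ 2 y v` on the Kummer surface. -/
theorem formF0_sq_sub {R : Type*} [CommRing R] (f : ℕ → R) (x z u w : R) :
    formF0 f (z * w) (x * w + u * z) (x * u) ^ 2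
      - (x * w - u * z) ^ 2 * formK0 f (z * w) (x * w + u * z) (x * u)
      = 4 * sextic f x z * sextic f u w := by
  simp only [formF0, formK0, sextic]
  ring

theorem interp_formF0 {R : Type*} [CommRing R] (m h : ℕ → R) (x z u w : R) :
    formF0 (interpCoeff m h (z * w) (x * w + u * z) (x * u)) (z * w) (x * w + u * z) (x * u)
      - 2 * cubic m x z * cubic m u w
      = (x * w - u * z) ^ 2 * interpCoord m h (z * w) (x * w + u * z) (x * u) := by
  simp only [formF0, interpCoeff, interpCoord, cubic]
  ring

theorem interp_formK0 {R : Type*} [CommRing R] (m h : ℕ → R) (a b c : R) :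
    formK0 (interpCoeff m h a b c) a b c
      = 2 * formF0 (interpCoeff m h a b c) a b c * interpCoord m h a b c
        - formK2 a b c * interpCoord m h a b c ^ 2 := by
  simp only [formF0, formK0, formK2, interpCoeff, interpCoord]
  ring

/-- The coefficients of `(a X² - b X + c) (l₀ + l₁ X + l₂ X²)`. -/
def quadMulCoeff {R : Type*} [CommRing R] (l : ℕ → R) (a b c : R) : ℕ → R
  | 0 => c * l 0
  | 1 => c * l 1 - b * l 0
  | 2 => c * l 2 - b * l 1 + a * l 0
  | 3 => a * l 1 - b * l 2
  | 4 => a * l 2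
  | _ => 0

/-- The coefficients of `(X - θ) (n₀ + n₁ X + n₂ X²)`. -/
def rootMulCoeff {R : Type*} [CommRing R] (θ : R) (n : ℕ → R) : ℕ → R
  | 0 => -θ * n 0
  | 1 => n 0 - θ * n 1
  | 2 => n 1 - θ * n 2
  | 3 => n 2
  | _ => 0

/-- The orthogonality relation: two quadratic factors of `F - M²`, where `M(θ) = 0`, give Kummer
points which are conjugate in the null polarity of `θ`. -/
theorem interp_orthogonal {R : Type*} [CommRing R] (n r : ℕ → R) (hr : r 2 = 0)
    (θ a b c a' b' c' : R) :
    ![a, b, c, interpCoord (rootMulCoeff θ n)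
        (quadMulCoeff (rootMulCoeff θ r) a' b' c') a b c] ⬝ᵥ
      polar (interpCoeff (rootMulCoeff θ n)
        (quadMulCoeff (rootMulCoeff θ r) a' b' c') a b c) θ
      ![a', b', c', interpCoord (rootMulCoeff θ n)
        (quadMulCoeff (rootMulCoeff θ r) a b c) a' b' c'] = 0 := by
  simp [polar, dotProduct, Fin.sum_univ_four, interpCoeff, interpCoord, quadMulCoeff,
    rootMulCoeff, hr]
  ring

/-! ### Points of the curve -/

section Curve

variable {K : Type*} [Field K] {F : K[X]}

/-- The linear form vanishing at the `X`-coordinate of a point, in the chart `Z = 1`. -/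
noncomputable def CurvePoint.line (p : CurvePoint F) : K[X] := C p.zCoord * X - C p.xCoord

/-- The image of a point under the hyperelliptic involution. -/
def CurvePoint.conj : CurvePoint F → CurvePoint F
  | .affine x y h => .affine x (-y) (by rw [neg_sq, h])
  | .infinity s h => .infinity (-s) (by rw [neg_sq, h])

@[simp] theorem CurvePoint.conj_conj (p : CurvePoint F) : p.conj.conj = p := by
  cases p <;> simp [CurvePoint.conj]

@[simp] theorem CurvePoint.xCoord_conj (p : CurvePoint F) : p.conj.xCoord = p.xCoord := by
  cases p <;> rfl

@[simp] theorem CurvePoint.zCoord_conj (p : CurvePoint F) : p.conj.zCoord = p.zCoord := by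
  cases p <;> rfl

@[simp] theorem CurvePoint.yCoord_conj (p : CurvePoint F) : p.conj.yCoord = -p.yCoord := by
  cases p <;> rfl

@[simp] theorem CurvePoint.line_conj (p : CurvePoint F) : p.conj.line = p.line := by
  simp [CurvePoint.line]

theorem CurvePoint.ext' {p q : CurvePoint F} (hx : p.xCoord = q.xCoord)
    (hz : p.zCoord = q.zCoord) (hy : p.yCoord = q.yCoord) : p = q := by
  cases p <;> cases q
  · obtain rfl : _ = _ := hx
    obtain rfl : _ = _ := hy
    rfl
  · exact absurd hz one_ne_zero
  · exact absurd hz zero_ne_one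
  · obtain rfl : _ = _ := hy
    rfl

/-- Points with proportional `X`-coordinates have the same `X`-coordinates. -/
theorem CurvePoint.coord_eq {p q : CurvePoint F}
    (h : p.xCoord * q.zCoord - q.xCoord * p.zCoord = 0) :
    p.xCoord = q.xCoord ∧ p.zCoord = q.zCoord := by
  cases p <;> cases q <;> simp_all [CurvePoint.xCoord, CurvePoint.zCoord, sub_eq_zero]

theorem CurvePoint.coord_ne_zero (p : CurvePoint F) : p.xCoord ≠ 0 ∨ p.zCoord ≠ 0 := by
  cases p <;> simp [CurvePoint.xCoord, CurvePoint.zCoord]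

theorem CurvePoint.sextic_eq (hF : F.natDegree ≤ 6) (p : CurvePoint F) :
    p.yCoord ^ 2 = sextic F.coeff p.xCoord p.zCoord := by
  cases p with
  | affine x y h =>
    rw [eval_eq_sum_range' (Nat.lt_succ_of_le hF)] at h
    simp only [CurvePoint.xCoord, CurvePoint.yCoord, CurvePoint.zCoord, h, sextic,
      Finset.sum_range_succ, Finset.sum_range_zero]
    ring
  | infinity s h => simp [CurvePoint.xCoord, CurvePoint.yCoord, CurvePoint.zCoord, h, sextic]

theorem kummerVec_of_ne {p q : CurvePoint F}
    (h : p.xCoord * q.zCoord - q.xCoord * p.zCoord ≠ 0) :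
    kummerVec p q = ![p.zCoord * q.zCoord, p.xCoord * q.zCoord + q.xCoord * p.zCoord,
      p.xCoord * q.xCoord, (formF0 F.coeff (p.zCoord * q.zCoord)
        (p.xCoord * q.zCoord + q.xCoord * p.zCoord) (p.xCoord * q.xCoord)
        - 2 * p.yCoord * q.yCoord) / (p.xCoord * q.zCoord - q.xCoord * p.zCoord) ^ 2] := by
  simp [kummerVec, h]

theorem kummerVec_of_canonical {p q : CurvePoint F}
    (h : p.xCoord * q.zCoord - q.xCoord * p.zCoord = 0) (hy : p.yCoord = -q.yCoord) :
    kummerVec p q = ![0, 0, 0, 1] := by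
  simp [kummerVec, h, hy]

theorem kummerVec_of_double {p q : CurvePoint F}
    (h : p.xCoord * q.zCoord - q.xCoord * p.zCoord = 0) (hy : p.yCoord ≠ -q.yCoord) :
    kummerVec p q = ![p.zCoord * q.zCoord, p.xCoord * q.zCoord + q.xCoord * p.zCoord,
      p.xCoord * q.xCoord, formK0 F.coeff (p.zCoord * q.zCoord)
        (p.xCoord * q.zCoord + q.xCoord * p.zCoord) (p.xCoord * q.xCoord) /
        (2 * formF0 F.coeff (p.zCoord * q.zCoord)
        (p.xCoord * q.zCoord + q.xCoord * p.zCoord) (p.xCoord * q.xCoord))] := by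
  simp [kummerVec, h, hy]

theorem kummerVec_conj_right_self (p : CurvePoint F) : kummerVec p p.conj = ![0, 0, 0, 1] :=
  kummerVec_of_canonical (by simp) (by simp)

theorem kummerVec_comm (p q : CurvePoint F) : kummerVec p q = kummerVec q p := by
  have e1 : q.xCoord * p.zCoord - p.xCoord * q.zCoord
      = -(p.xCoord * q.zCoord - q.xCoord * p.zCoord) := by ring
  by_cases h1 : p.xCoord * q.zCoord - q.xCoord * p.zCoord = 0
  · by_cases h2 : p.yCoord = -q.yCoord
    · rw [kummerVec_of_canonical h1 h2, kummerVec_of_canonical (by rw [e1, h1, neg_zero])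
        (by rw [h2, neg_neg])]
    · rw [kummerVec_of_double h1 h2, kummerVec_of_double (by rw [e1, h1, neg_zero])
        (fun h => h2 (by rw [h, neg_neg]))]
      rw [mul_comm q.zCoord p.zCoord, mul_comm q.xCoord p.xCoord,
        add_comm (q.xCoord * p.zCoord)]
  · rw [kummerVec_of_ne h1, kummerVec_of_ne (by rw [e1]; exact neg_ne_zero.2 h1), e1, neg_sq,
      mul_comm q.zCoord p.zCoord, mul_comm q.xCoord p.xCoord, add_comm (q.xCoord * p.zCoord),
      mul_right_comm 2 q.yCoord]

theorem kummerVec_conj (p q : CurvePoint F) : kummerVec p.conj q.conj = kummerVec p q := by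
  by_cases h1 : p.xCoord * q.zCoord - q.xCoord * p.zCoord = 0
  · by_cases h2 : p.yCoord = -q.yCoord
    · rw [kummerVec_of_canonical h1 h2, kummerVec_of_canonical (by simpa using h1) (by simp [h2])]
    · rw [kummerVec_of_double h1 h2, kummerVec_of_double (by simpa using h1)
        (by simpa [neg_eq_iff_eq_neg] using h2)]
      simp
  · rw [kummerVec_of_ne h1, kummerVec_of_ne (by simpa using h1)]
    simp

/-- The double of a point with nonzero `Y`-coordinate, in terms of the form `F₀`. -/
theorem formF0_self {R : Type*} [CommRing R] (f : ℕ → R) (x z : R) :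
    formF0 f (z * z) (x * z + x * z) (x * x) = 2 * sextic f x z := by
  simp only [formF0, sextic]
  ring

theorem kummerVec_zero_ne {p q : CurvePoint F} (h : kummerVec p q ≠ ![0, 0, 0, 1]) :
    kummerVec p q 0 = p.zCoord * q.zCoord ∧
      kummerVec p q 1 = p.xCoord * q.zCoord + q.xCoord * p.zCoord ∧
      kummerVec p q 2 = p.xCoord * q.xCoord := by
  by_cases h1 : p.xCoord * q.zCoord - q.xCoord * p.zCoord = 0
  · by_cases h2 : p.yCoord = -q.yCoord
    · exact absurd (kummerVec_of_canonical h1 h2) h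
    · simp [kummerVec_of_double h1 h2]
  · simp [kummerVec_of_ne h1]

end Curve

section Interpolation

variable {K : Type*} [Field K] {F : K[X]}

theorem eq_sum_of_natDegree_le {R : Type*} [CommRing R] {P : R[X]} {n : ℕ}
    (h : P.natDegree ≤ n) : P = ∑ j ∈ Finset.range (n + 1), C (P.coeff j) * X ^ j :=
  P.as_sum_range_C_mul_X_pow' (Nat.lt_succ_of_le h)

theorem coeff_of_eq_sum {R : Type*} [CommRing R] {P : R[X]} {g : ℕ → R} {n : ℕ}
    (h : P = ∑ j ∈ Finset.range n, C (g j) * X ^ j) {j : ℕ} (hj : j < n) : P.coeff j = g j := by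
  rw [h]
  simp [coeff_X_pow, hj]

theorem coeff_interp {R : Type*} [CommRing R] {P M H : R[X]} {a b c : R} (hM : M.natDegree ≤ 3)
    (hH : H.natDegree ≤ 4) (h : P = M ^ 2 + (C a * X ^ 2 - C b * X + C c) * H) :
    ∀ j < 7, P.coeff j = interpCoeff M.coeff H.coeff a b c j := by
  intro j hj
  refine coeff_of_eq_sum (g := interpCoeff M.coeff H.coeff a b c) ?_ hj
  conv_lhs => rw [h, eq_sum_of_natDegree_le hM, eq_sum_of_natDegree_le hH]
  simp only [Finset.sum_range_succ, Finset.sum_range_zero, interpCoeff, map_add, map_sub, map_mul,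
    map_pow, map_ofNat]
  ring

theorem coeff_quadMul {R : Type*} [CommRing R] {L : R[X]} (a b c : R) (hL : L.natDegree ≤ 2) :
    ∀ j < 5, ((C a * X ^ 2 - C b * X + C c) * L).coeff j = quadMulCoeff L.coeff a b c j := by
  intro j hj
  refine coeff_of_eq_sum (g := quadMulCoeff L.coeff a b c) ?_ hj
  conv_lhs => rw [eq_sum_of_natDegree_le hL]
  simp only [Finset.sum_range_succ, Finset.sum_range_zero, quadMulCoeff, map_add, map_sub, map_mul]
  ring

theorem coeff_rootMul {R : Type*} [CommRing R] {N : R[X]} (θ : R) (hN : N.natDegree ≤ 2) :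
    ∀ j < 4, ((X - C θ) * N).coeff j = rootMulCoeff θ N.coeff j := by
  intro j hj
  refine coeff_of_eq_sum (g := rootMulCoeff θ N.coeff) ?_ hj
  conv_lhs => rw [eq_sum_of_natDegree_le hN]
  simp only [Finset.sum_range_succ, Finset.sum_range_zero, rootMulCoeff, map_sub, map_mul, map_neg]
  ring

theorem interpCoord_congr {R : Type*} [CommRing R] {m m' h h' : ℕ → R}
    (hm : ∀ j < 4, m j = m' j) (hh : ∀ j < 5, h j = h' j) (a b c : R) :
    interpCoord m h a b c = interpCoord m' h' a b c := by
  simp [interpCoord, hm 0, hm 1, hm 2, hm 3, hh 0, hh 2, hh 4]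

theorem CurvePoint.line_mul_line (p q : CurvePoint F) :
    p.line * q.line = C (p.zCoord * q.zCoord) * X ^ 2
      - C (p.xCoord * q.zCoord + q.xCoord * p.zCoord) * X + C (p.xCoord * q.xCoord) := by
  simp only [CurvePoint.line, map_add, map_mul]
  ring

theorem CurvePoint.natDegree_line_le (p : CurvePoint F) : p.line.natDegree ≤ 1 := by
  rw [CurvePoint.line]
  compute_degree

/-- The smooth model of `Y² = F(X)`, with `F` of degree six and separable. -/
structure IsSmoothSextic (F : K[X]) : Prop where
  two_ne_zero : (2 : K) ≠ 0
  natDegree_le : F.natDegree ≤ 6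
  coeff_six : F.coeff 6 ≠ 0
  separable : F.Separable

theorem IsSmoothSextic.ne_zero (hF : IsSmoothSextic F) : F ≠ 0 := fun h =>
  hF.coeff_six (by simp [h])

theorem IsSmoothSextic.derivative_ne_zero (hF : IsSmoothSextic F) {x : K} (hx : F.eval x = 0) :
    (derivative F).eval x ≠ 0 := by
  intro h
  obtain ⟨a, b, hab⟩ := hF.separable
  have := congrArg (eval x) hab
  simp [hx, h] at this

theorem eval_eq_cubic {M : K[X]} (hM : M.natDegree ≤ 3) (x : K) :
    M.eval x = cubic M.coeff x 1 := by
  rw [eval_eq_sum_range' (Nat.lt_succ_of_le hM)]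
  simp [Finset.sum_range_succ, cubic]

theorem IsSmoothSextic.yCoord_infinity_ne_zero (hF : IsSmoothSextic F) {s : K}
    (hs : s ^ 2 = F.coeff 6) : s ≠ 0 := by
  rintro rfl
  exact hF.coeff_six (by rw [← hs]; simp)

/-- The Kummer coordinates of a divisor `p + q` on `Y = M(X)`, in terms of the residual factor of
`F - M²`.  A canonical divisor cannot occur, since `F` has no multiple roots. -/
theorem kummerVec_of_interp (hF : IsSmoothSextic F) {M H : K[X]} (hM : M.natDegree ≤ 3)
    (hH : H.natDegree ≤ 4) {p q : CurvePoint F} (h : F = M ^ 2 + p.line * q.line * H)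
    (hp : p.yCoord = cubic M.coeff p.xCoord p.zCoord)
    (hq : q.yCoord = cubic M.coeff q.xCoord q.zCoord) :
    kummerVec p q = ![p.zCoord * q.zCoord, p.xCoord * q.zCoord + q.xCoord * p.zCoord,
      p.xCoord * q.xCoord, interpCoord M.coeff H.coeff (p.zCoord * q.zCoord)
        (p.xCoord * q.zCoord + q.xCoord * p.zCoord) (p.xCoord * q.xCoord)] := by
  have h2 := hF.two_ne_zero
  have hc := coeff_interp (P := F) hM hH (by rw [h, p.line_mul_line q])
  by_cases hd : p.xCoord * q.zCoord - q.xCoord * p.zCoord = 0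
  · obtain ⟨hx, hz⟩ := CurvePoint.coord_eq hd
    have hpq : p = q := CurvePoint.ext' hx hz (by rw [hp, hq, hx, hz])
    subst hpq
    have hy : p.yCoord ≠ 0 := by
      cases p with
      | affine x y hxy =>
        intro hy
        change y = 0 at hy
        subst hy
        have hMx : M.eval x = 0 := by rw [eval_eq_cubic hM]; exact hp.symm
        refine hF.derivative_ne_zero (x := x) (by rw [← hxy]; ring) ?_
        rw [h]
        simp [CurvePoint.line, CurvePoint.xCoord, CurvePoint.zCoord, hMx, derivative_pow]
      | infinity s hs => exact hF.yCoord_infinity_ne_zero hs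
    rw [kummerVec_of_double hd (fun e => hy (by
      have : 2 * p.yCoord = 0 := by linear_combination e
      exact (mul_eq_zero.1 this).resolve_left h2))]
    have hF0 : formF0 F.coeff (p.zCoord * p.zCoord) (p.xCoord * p.zCoord + p.xCoord * p.zCoord)
        (p.xCoord * p.xCoord) ≠ 0 := by
      rw [formF0_self, ← p.sextic_eq hF.natDegree_le]
      exact mul_ne_zero h2 (pow_ne_zero _ hy)
    have hK2 : formK2 (p.zCoord * p.zCoord) (p.xCoord * p.zCoord + p.xCoord * p.zCoord)
        (p.xCoord * p.xCoord) = 0 := by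
      simp only [formK2]; ring
    have hK0 := interp_formK0 M.coeff H.coeff (p.zCoord * p.zCoord)
      (p.xCoord * p.zCoord + p.xCoord * p.zCoord) (p.xCoord * p.xCoord)
    rw [← formF0_congr hc, ← formK0_congr hc, hK2, zero_mul, sub_zero] at hK0
    rw [hK0, mul_div_cancel_left₀ _ (mul_ne_zero h2 hF0)]
  · rw [kummerVec_of_ne hd]
    have := interp_formF0 M.coeff H.coeff p.xCoord p.zCoord q.xCoord q.zCoord
    rw [← formF0_congr hc, ← hp, ← hq] at this
    rw [this, mul_div_cancel_left₀ _ (pow_ne_zero _ hd)]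

/-- If the six zeros of `F - M²` are those of `p + q + s + t + r` and the root `θ`, then the Kummer
points of `p + q` and of `s + t` are conjugate in the null polarity of `θ`. -/
theorem orthogonal_of_interp (hF : IsSmoothSextic F) {M : K[X]} (hM : M.natDegree ≤ 3) {θ κ : K}
    (hMθ : M.eval θ = 0) {p q s t r : CurvePoint F}
    (h : F = M ^ 2 + C κ * (p.line * q.line * s.line * t.line * r.line * (X - C θ)))
    (hp : p.yCoord = cubic M.coeff p.xCoord p.zCoord)
    (hq : q.yCoord = cubic M.coeff q.xCoord q.zCoord)
    (hs : s.yCoord = cubic M.coeff s.xCoord s.zCoord)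
    (ht : t.yCoord = cubic M.coeff t.xCoord t.zCoord) :
    kummerVec s t ⬝ᵥ polar F.coeff θ (kummerVec p q) = 0 := by
  obtain ⟨N, rfl⟩ := dvd_iff_isRoot.2 hMθ
  have hN : N.natDegree ≤ 2 := by
    rcases eq_or_ne N 0 with rfl | hN0
    · simp
    · rw [natDegree_mul (X_sub_C_ne_zero θ) hN0, natDegree_X_sub_C] at hM
      omega
  set L' : K[X] := C κ * r.line with hL'
  have hL'1 : L'.natDegree ≤ 1 :=
    (natDegree_mul_le.trans (add_le_add (natDegree_C _).le r.natDegree_line_le)).trans (by simp)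
  have hL2 : ((X - C θ) * L').natDegree ≤ 2 :=
    natDegree_mul_le.trans (add_le_add (natDegree_X_sub_C_le θ) hL'1)
  have hdeg : ∀ a b : CurvePoint F, (a.line * b.line * ((X - C θ) * L')).natDegree ≤ 4 :=
    fun a b => natDegree_mul_le.trans (add_le_add (natDegree_mul_le.trans
      (add_le_add a.natDegree_line_le b.natDegree_line_le)) hL2)
  have e1 : F = ((X - C θ) * N) ^ 2 + s.line * t.line * (p.line * q.line * ((X - C θ) * L')) := by
    refine h.trans ?_; rw [hL']; ring
  have e2 : F = ((X - C θ) * N) ^ 2 + p.line * q.line * (s.line * t.line * ((X - C θ) * L')) := by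
    refine h.trans ?_; rw [hL']; ring
  have hm := coeff_rootMul θ hN
  have hl : ∀ j < 4, ((X - C θ) * L').coeff j = rootMulCoeff θ L'.coeff j :=
    coeff_rootMul θ (hL'1.trans one_le_two)
  have hh : ∀ (a b : CurvePoint F), ∀ j < 5, (a.line * b.line * ((X - C θ) * L')).coeff j
      = quadMulCoeff (rootMulCoeff θ L'.coeff) (a.zCoord * b.zCoord)
        (a.xCoord * b.zCoord + b.xCoord * a.zCoord) (a.xCoord * b.xCoord) j := by
    intro a b j hj
    rw [a.line_mul_line b, coeff_quadMul _ _ _ hL2 j hj]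
    interval_cases j <;> simp [quadMulCoeff, hl 0, hl 1, hl 2]
  have hFc : ∀ j < 7, F.coeff j = interpCoeff (rootMulCoeff θ N.coeff)
      (quadMulCoeff (rootMulCoeff θ L'.coeff) (p.zCoord * q.zCoord)
        (p.xCoord * q.zCoord + q.xCoord * p.zCoord) (p.xCoord * q.xCoord))
      (s.zCoord * t.zCoord) (s.xCoord * t.zCoord + t.xCoord * s.zCoord)
      (s.xCoord * t.xCoord) j := by
    intro j hj
    rw [coeff_interp hM (hdeg p q) (e1.trans (by rw [s.line_mul_line t])) j hj]
    interval_cases j <;> simp [interpCoeff, hm 0, hm 1, hm 2, hm 3, hh p q 0, hh p q 1, hh p q 2,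
      hh p q 3, hh p q 4]
  rw [kummerVec_of_interp hF hM (hdeg p q) e1 hs ht, kummerVec_of_interp hF hM (hdeg s t) e2 hp hq,
    polar_congr hFc, interpCoord_congr hm (hh p q), interpCoord_congr hm (hh s t)]
  exact interp_orthogonal _ _ (coeff_eq_zero_of_natDegree_lt (by omega)) _ _ _ _ _ _ _

/-! ### Divisors containing the Weierstrass point -/

@[simp] theorem xCoord_weierstrassPoint (θ : K) (hθ : F.eval θ = 0) :
    (weierstrassPoint F θ hθ).xCoord = θ := rfl

@[simp] theorem zCoord_weierstrassPoint (θ : K) (hθ : F.eval θ = 0) :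
    (weierstrassPoint F θ hθ).zCoord = 1 := rfl

@[simp] theorem yCoord_weierstrassPoint (θ : K) (hθ : F.eval θ = 0) :
    (weierstrassPoint F θ hθ).yCoord = 0 := rfl

theorem conj_weierstrassPoint (θ : K) (hθ : F.eval θ = 0) :
    (weierstrassPoint F θ hθ).conj = weierstrassPoint F θ hθ :=
  CurvePoint.ext' (by simp) (by simp) (by simp)

theorem eq_weierstrassPoint (hF : F.natDegree ≤ 6) {θ : K} (hθ : F.eval θ = 0) {p : CurvePoint F}
    (hd : θ * p.zCoord - p.xCoord = 0) : p = weierstrassPoint F θ hθ := by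
  obtain ⟨hx, hz⟩ := CurvePoint.coord_eq (p := weierstrassPoint F θ hθ) (q := p) (by simpa using hd)
  refine (CurvePoint.ext' hx hz ?_).symm
  have := p.sextic_eq hF
  rw [← hx, ← hz, ← CurvePoint.sextic_eq hF] at this
  have h0 : p.yCoord ^ 2 = 0 := by rw [this]; simp
  rw [yCoord_weierstrassPoint, (pow_eq_zero_iff two_ne_zero).1 h0]

/-- The Kummer points of `a + q` for the Weierstrass point `a` lie on the trope which is the polar
plane of `(0 : 0 : 0 : 1)`. -/
theorem kummerVec_dotProduct_polar_canonical (θ : K) (hθ : F.eval θ = 0) (q : CurvePoint F) :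
    kummerVec (weierstrassPoint F θ hθ) q ⬝ᵥ polar F.coeff θ ![0, 0, 0, 1] = 0 := by
  by_cases h : kummerVec (weierstrassPoint F θ hθ) q = ![0, 0, 0, 1]
  · rw [h, dotProduct_polar_self]
  · obtain ⟨h0, h1, h2⟩ := kummerVec_zero_ne h
    simp [dotProduct, Fin.sum_univ_four, polar, h0, h1, h2]
    ring

/-- The Kummer points of `a + p` and of `p + q` are conjugate in the null polarity of the
Weierstrass point `a`. -/
theorem kummerVec_dotProduct_polar (hF : IsSmoothSextic F) (θ : K) (hθ : F.eval θ = 0)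
    (p q : CurvePoint F) :
    kummerVec (weierstrassPoint F θ hθ) p ⬝ᵥ polar F.coeff θ (kummerVec p q) = 0 := by
  by_cases hc : kummerVec p q = ![0, 0, 0, 1]
  · rw [hc, kummerVec_dotProduct_polar_canonical]
  obtain ⟨k0, k1, k2⟩ := kummerVec_zero_ne hc
  have hθ' : F.coeff 0 = -(F.coeff 1 * θ + F.coeff 2 * θ ^ 2 + F.coeff 3 * θ ^ 3
      + F.coeff 4 * θ ^ 4 + F.coeff 5 * θ ^ 5 + F.coeff 6 * θ ^ 6) := by
    rw [eval_eq_sum_range' (Nat.lt_succ_of_le hF.natDegree_le)] at hθ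
    simp [Finset.sum_range_succ] at hθ
    linear_combination hθ
  by_cases hd : θ * p.zCoord - p.xCoord = 0
  · rw [eq_weierstrassPoint hF.natDegree_le hθ hd,
      kummerVec_of_canonical (p := weierstrassPoint F θ hθ) (q := weierstrassPoint F θ hθ)
        (by simp) (by simp), dotProduct_polar_comm, kummerVec_dotProduct_polar_canonical, neg_zero]
  · rw [kummerVec_of_ne (by simpa using hd)]
    simp only [dotProduct, Fin.sum_univ_four, polar, k0, k1, k2]
    generalize kummerVec p q 3 = d
    simp only [xCoord_weierstrassPoint, zCoord_weierstrassPoint, yCoord_weierstrassPoint, one_mul,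
      mul_one, mul_zero, zero_mul, sub_zero, Matrix.cons_val]
    generalize hT : formF0 F.coeff p.zCoord (θ * p.zCoord + p.xCoord) (θ * p.xCoord)
      / (θ * p.zCoord - p.xCoord) ^ 2 = T
    rw [div_eq_iff (pow_ne_zero _ hd)] at hT
    refine (mul_eq_zero.1 (?_ : (θ * p.zCoord - p.xCoord) * _ = 0)).resolve_left hd
    simp only [formF0, hθ'] at hT
    linear_combination (θ * q.zCoord - q.xCoord) * hT

end Interpolation

/-! ### The coordinate ring and the ideal of a point -/

section LocalOrder

variable {K : Type*} [Field K] {F : K[X]}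

/-- The function `A(X) + B(X) Y` on the curve. -/
noncomputable def elt (F A B : K[X]) : AffineRing F :=
  AdjoinRoot.of _ A + AdjoinRoot.of _ B * AdjoinRoot.root _

theorem root_sq (F : K[X]) :
    (AdjoinRoot.root ((X : K[X][X]) ^ 2 - C F)) ^ 2 = AdjoinRoot.of _ F := by
  have h := AdjoinRoot.mk_self (f := (X : K[X][X]) ^ 2 - C F)
  rw [map_sub, map_pow, AdjoinRoot.mk_X, AdjoinRoot.mk_C, sub_eq_zero] at h
  exact h

theorem elt_mul (A B A' B' : K[X]) :
    elt F A B * elt F A' B' = elt F (A * A' + F * B * B') (A * B' + A' * B) := by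
  simp only [elt, map_add, map_mul, ← root_sq]
  ring

theorem elt_zero_right (A : K[X]) : elt F A 0 = AdjoinRoot.of _ A := by simp [elt]

theorem elt_eq_zero_iff {A B : K[X]} : elt F A B = 0 ↔ A = 0 ∧ B = 0 := by
  constructor
  · intro h
    have hmk : elt F A B = AdjoinRoot.mk _ (C A + C B * X) := by
      simp [elt, AdjoinRoot.mk_C, AdjoinRoot.mk_X]
    rw [hmk, AdjoinRoot.mk_eq_zero] at h
    have hz : (C A + C B * X : K[X][X]) = 0 := by
      by_contra hne
      refine Monic.not_dvd_of_natDegree_lt (monic_X_pow_sub_C F two_ne_zero) hne ?_ h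
      rw [natDegree_X_pow_sub_C]
      have : (C A + C B * X : K[X][X]).natDegree ≤ 1 := by compute_degree
      omega
    constructor
    · simpa using congrArg (fun P => P.coeff 0) hz
    · simpa using congrArg (fun P => P.coeff 1) hz
  · rintro ⟨rfl, rfl⟩
    simp [elt]

theorem exists_eq_elt (z : AffineRing F) : ∃ A B : K[X], z = elt F A B := by
  obtain ⟨P, rfl⟩ := AdjoinRoot.mk_surjective z
  have hm : ((X : K[X][X]) ^ 2 - C F).Monic := monic_X_pow_sub_C F two_ne_zero
  have hd : (P %ₘ ((X : K[X][X]) ^ 2 - C F)).natDegree ≤ 1 := by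
    have := natDegree_modByMonic_lt P hm (by
      intro h
      simpa [natDegree_X_pow_sub_C] using congrArg natDegree h)
    rw [natDegree_X_pow_sub_C] at this
    omega
  obtain ⟨B, A, h⟩ := exists_eq_X_add_C_of_natDegree_le_one hd
  refine ⟨A, B, ?_⟩
  rw [← AdjoinRoot.mk_leftInverse hm (AdjoinRoot.mk _ P), AdjoinRoot.modByMonicHom_mk, h]
  simp [elt, AdjoinRoot.mk_C, AdjoinRoot.mk_X, add_comm]

/-- The value of a function at a point of the affine curve. -/
noncomputable def evalAt {x y : K} (h : y ^ 2 = F.eval x) : AffineRing F →+* K :=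
  AdjoinRoot.lift (evalRingHom x) y (by simp [h])

theorem evalAt_of {x y : K} (h : y ^ 2 = F.eval x) (A : K[X]) :
    evalAt h (AdjoinRoot.of _ A) = A.eval x := by
  simp [evalAt]

theorem evalAt_root {x y : K} (h : y ^ 2 = F.eval x) :
    evalAt h (AdjoinRoot.root _) = y := by
  simp [evalAt]

theorem evalAt_elt {x y : K} (h : y ^ 2 = F.eval x) (A B : K[X]) :
    evalAt h (elt F A B) = A.eval x + B.eval x * y := by
  rw [elt, map_add, map_mul, evalAt_of, evalAt_of, evalAt_root]

theorem of_X_sub_C_mem (x y : K) : AdjoinRoot.of _ (X - C x) ∈ pointIdeal F x y :=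
  Ideal.subset_span (by simp)

theorem root_sub_mem (x y : K) :
    AdjoinRoot.root _ - AdjoinRoot.of _ (C y) ∈ pointIdeal F x y :=
  Ideal.subset_span (by simp)

theorem mem_pointIdeal {x y : K} (h : y ^ 2 = F.eval x) {z : AffineRing F} :
    z ∈ pointIdeal F x y ↔ evalAt h z = 0 := by
  constructor
  · intro hz
    have hle : pointIdeal F x y ≤ RingHom.ker (evalAt h) := by
      rw [pointIdeal, Ideal.span_le]
      rintro w (rfl | rfl)
      · simp [RingHom.mem_ker, evalAt_of]
      · simp [RingHom.mem_ker, evalAt_of, evalAt_root]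
    exact hle hz
  · intro hz
    obtain ⟨A, B, rfl⟩ := exists_eq_elt z
    rw [evalAt_elt] at hz
    obtain ⟨b, hb⟩ : ∃ b, b = B.eval x := ⟨_, rfl⟩
    obtain ⟨A', hA⟩ := X_sub_C_dvd_sub_C_eval (a := x) (p := A)
    obtain ⟨B', hB⟩ := X_sub_C_dvd_sub_C_eval (a := x) (p := B)
    rw [← hb] at hB hz
    have key : elt F A B = AdjoinRoot.of _ (X - C x) * (elt F A' B')
        + AdjoinRoot.of _ (C b) * (AdjoinRoot.root _ - AdjoinRoot.of _ (C y)) := by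
      have e1 : A = (X - C x) * A' + C (A.eval x) := by rw [← hA]; ring
      have e2 : B = (X - C x) * B' + C b := by rw [← hB]; ring
      have e3 : A.eval x = -(b * y) := by linear_combination hz
      rw [e3] at e1
      conv_lhs => rw [e1, e2]
      simp only [elt, map_add, map_mul, map_neg]
      ring
    rw [key]
    exact Ideal.add_mem _ (Ideal.mul_mem_right _ _ (of_X_sub_C_mem x y))
      (Ideal.mul_mem_left _ _ (root_sub_mem x y))

theorem notMem_mul {x y : K} (h : y ^ 2 = F.eval x) {s t : AffineRing F}
    (hs : s ∉ pointIdeal F x y) (ht : t ∉ pointIdeal F x y) : s * t ∉ pointIdeal F x y := by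
  rw [mem_pointIdeal h] at *
  rw [map_mul]
  exact mul_ne_zero hs ht

/-- The powers of the ideal of a point are primary. -/
theorem mem_pow_of_mul_mem {x y : K} (h : y ^ 2 = F.eval x) {s f : AffineRing F} {n : ℕ}
    (hs : s ∉ pointIdeal F x y) (hf : s * f ∈ pointIdeal F x y ^ n) :
    f ∈ pointIdeal F x y ^ n := by
  rw [mem_pointIdeal h] at hs
  set i := 1 - AdjoinRoot.of _ (C (evalAt h s)⁻¹) * s with hi
  have hiI : i ∈ pointIdeal F x y := by
    rw [mem_pointIdeal h, hi, map_sub, map_mul, evalAt_of, eval_C, inv_mul_cancel₀ hs, map_one,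
      sub_self]
  have hc : IsCoprime s i := ⟨AdjoinRoot.of _ (C (evalAt h s)⁻¹), 1, by rw [hi]; ring⟩
  obtain ⟨a, b, hab⟩ := hc.pow_right (n := n)
  have : f = a * (s * f) + b * f * i ^ n := by linear_combination (-f) * hab
  rw [this]
  exact Ideal.add_mem _ (Ideal.mul_mem_left _ _ hf)
    (Ideal.mul_mem_left _ _ (Ideal.pow_mem_pow hiI n))

/-- The order of `f` at the point `(x, y)` is exactly `n`. -/
def HasOrd (x y : K) (f : AffineRing F) (n : ℕ) : Prop :=
  f ∈ pointIdeal F x y ^ n ∧ f ∉ pointIdeal F x y ^ (n + 1)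

theorem HasOrd.mem_pow_iff {x y : K} {f : AffineRing F} {n : ℕ} (h : HasOrd x y f n) (k : ℕ) :
    f ∈ pointIdeal F x y ^ k ↔ k ≤ n := by
  constructor
  · intro hk
    by_contra hlt
    exact h.2 (Ideal.pow_le_pow_right (by omega) hk)
  · intro hk
    exact Ideal.pow_le_pow_right hk h.1

theorem HasOrd.affineOrd_eq {x y : K} {A B : K[X]} {n : ℕ} (h : HasOrd x y (elt F A B) n) :
    affineOrd F x y A B = n := by
  have : {k : ℕ | elt F A B ∈ pointIdeal F x y ^ k} = Set.Iic n := by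
    ext k
    exact h.mem_pow_iff k
  change sSup {k : ℕ | elt F A B ∈ pointIdeal F x y ^ k} = n
  rw [this, csSup_Iic]

theorem hasOrd_zero {x y : K} {f : AffineRing F} (hf : f ∉ pointIdeal F x y) : HasOrd x y f 0 := by
  refine ⟨by simp, by simpa using hf⟩

/-- A point `(x, y)` at which the curve `Y² = F(X)` is smooth, where `F` is not a square times a
constant, so that the curve is integral. -/
structure IsSmoothPoint (F : K[X]) (x y : K) : Prop where
  two_ne_zero : (2 : K) ≠ 0
  eq : y ^ 2 = F.eval x
  smooth : y = 0 → (derivative F).eval x ≠ 0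
  not_sq : ∀ A B : K[X], A ^ 2 = F * B ^ 2 → B = 0

theorem IsSmoothPoint.ne_zero {x y : K} (h : IsSmoothPoint F x y) : F ≠ 0 := by
  rintro rfl
  exact one_ne_zero (h.not_sq 0 1 (by simp))

theorem IsSmoothPoint.norm_ne_zero {x y : K} (h : IsSmoothPoint F x y) {A B : K[X]}
    (hAB : A ≠ 0 ∨ B ≠ 0) : A ^ 2 - F * B ^ 2 ≠ 0 := by
  intro h0
  have hB : B = 0 := h.not_sq A B (sub_eq_zero.1 h0)
  subst hB
  simp at h0
  simp [h0] at hAB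

theorem of_mul_eq_zero {P : K[X]} (hP : P ≠ 0) {z : AffineRing F}
    (h : AdjoinRoot.of _ P * z = 0) : z = 0 := by
  obtain ⟨A, B, rfl⟩ := exists_eq_elt z
  rw [← elt_zero_right, elt_mul, elt_eq_zero_iff] at h
  rw [elt_eq_zero_iff]
  simpa [hP] using h

/-- At a smooth point the ideal of the point becomes principal after localisation. -/
structure IsUniformizer (F : K[X]) (x y : K) (π s : AffineRing F) : Prop where
  mem : π ∈ pointIdeal F x y
  notMem : s ∉ pointIdeal F x y
  mul_mem : ∀ f ∈ pointIdeal F x y, s * f ∈ Ideal.span {π}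
  regular : ∀ z, π * z = 0 → z = 0

theorem isUniformizer_of_ne_zero {x y : K} (h : IsSmoothPoint F x y) (hy : y ≠ 0) :
    IsUniformizer F x y (AdjoinRoot.of _ (X - C x))
      (AdjoinRoot.root _ + AdjoinRoot.of _ (C y)) where
  mem := of_X_sub_C_mem x y
  notMem := by
    rw [mem_pointIdeal h.eq, map_add, evalAt_root, evalAt_of, eval_C, ← two_mul]
    exact mul_ne_zero h.two_ne_zero hy
  mul_mem := by
    intro f hf
    have hle : pointIdeal F x y ≤ Submodule.comap
        (LinearMap.mulLeft (AffineRing F) (AdjoinRoot.root _ + AdjoinRoot.of _ (C y)))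
        (Ideal.span {AdjoinRoot.of _ (X - C x)}) := by
      rw [pointIdeal, Ideal.span_le]
      rintro w (rfl | rfl)
      · exact Ideal.mul_mem_left _ _ (Ideal.mem_span_singleton_self _)
      · obtain ⟨P, hP⟩ := X_sub_C_dvd_sub_C_eval (a := x) (p := F)
        refine Ideal.mem_span_singleton.2 ⟨AdjoinRoot.of _ P, ?_⟩
        have e : (AdjoinRoot.root ((X : K[X][X]) ^ 2 - C F)
            + AdjoinRoot.of _ (C y)) * (AdjoinRoot.root _ - AdjoinRoot.of _ (C y))
            = AdjoinRoot.of _ (F - C (F.eval x)) := by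
          rw [map_sub, ← root_sq, ← h.eq, map_pow, map_pow]
          ring
        rw [← map_mul, ← hP, ← e]
        rfl
    exact hle hf
  regular := fun _ => of_mul_eq_zero (X_sub_C_ne_zero x)

theorem exists_isUniformizer_of_eq_zero {x : K} (h : IsSmoothPoint F x 0) :
    ∃ P : K[X], P.eval x ≠ 0 ∧ F = (X - C x) * P ∧
      IsUniformizer F x 0 (AdjoinRoot.root _) (AdjoinRoot.of _ P) := by
  have hx : F.eval x = 0 := by rw [← h.eq]; ring
  obtain ⟨P, hP⟩ := dvd_iff_isRoot.2 hx
  have hPx : P.eval x ≠ 0 := by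
    have := h.smooth rfl
    rw [hP] at this
    simpa using this
  refine ⟨P, hPx, hP, ?_⟩
  constructor
  · rw [mem_pointIdeal h.eq, evalAt_root]
  · rwa [mem_pointIdeal h.eq, evalAt_of]
  · intro f hf
    have hle : pointIdeal F x 0 ≤ Submodule.comap
        (LinearMap.mulLeft (AffineRing F) (AdjoinRoot.of _ P))
        (Ideal.span {AdjoinRoot.root _}) := by
      rw [pointIdeal, Ideal.span_le]
      rintro w (rfl | rfl)
      · refine Ideal.mem_span_singleton.2 ⟨AdjoinRoot.root _, ?_⟩
        have e : AdjoinRoot.of ((X : K[X][X]) ^ 2 - C F) F = AdjoinRoot.of _ (P * (X - C x)) :=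
          congrArg _ (hP.trans (mul_comm _ _))
        rw [← sq, root_sq, e, map_mul]
        rfl
      · refine Ideal.mem_span_singleton.2 ⟨AdjoinRoot.of _ P, ?_⟩
        simp [LinearMap.mulLeft_apply, mul_comm]
    exact hle hf
  · intro z hz
    refine of_mul_eq_zero h.ne_zero (?_ : AdjoinRoot.of _ F * z = 0)
    rw [← root_sq, sq (AdjoinRoot.root _), mul_assoc, hz, mul_zero]

theorem IsSmoothPoint.exists_isUniformizer {x y : K} (h : IsSmoothPoint F x y) :
    ∃ π s, IsUniformizer F x y π s := by
  by_cases hy : y = 0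
  · subst hy
    obtain ⟨P, -, -, hP⟩ := exists_isUniformizer_of_eq_zero h
    exact ⟨_, _, hP⟩
  · exact ⟨_, _, isUniformizer_of_ne_zero h hy⟩

theorem IsUniformizer.pow_regular {x y : K} {π s : AffineRing F} (hu : IsUniformizer F x y π s)
    (n : ℕ) {z : AffineRing F} (hz : π ^ n * z = 0) : z = 0 := by
  induction n with
  | zero => simpa using hz
  | succ n ih =>
    rw [pow_succ' π, mul_assoc] at hz
    exact ih (hu.regular _ hz)

theorem IsUniformizer.pow_notMem {x y : K} (h : y ^ 2 = F.eval x) {π s : AffineRing F}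
    (hu : IsUniformizer F x y π s) (n : ℕ) : s ^ n ∉ pointIdeal F x y := by
  have := hu.notMem
  rw [mem_pointIdeal h] at *
  rw [map_pow]
  exact pow_ne_zero _ this

theorem IsUniformizer.exists_mul_eq {x y : K} {π s : AffineRing F} (hu : IsUniformizer F x y π s)
    {f : AffineRing F} {n : ℕ} (hf : f ∈ pointIdeal F x y ^ n) : ∃ g, s ^ n * f = π ^ n * g := by
  have h1 : Ideal.span {s} * pointIdeal F x y ≤ Ideal.span {π} := by
    rw [Ideal.mul_le]
    intro r hr f hf
    obtain ⟨c, rfl⟩ := Ideal.mem_span_singleton.1 hr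
    rw [mul_right_comm]
    exact Ideal.mul_mem_right _ _ (hu.mul_mem f hf)
  have h2 : (Ideal.span {s} * pointIdeal F x y) ^ n ≤ Ideal.span {π} ^ n :=
    Ideal.pow_right_mono h1 n
  rw [mul_pow, Ideal.span_singleton_pow, Ideal.span_singleton_pow] at h2
  exact Ideal.mem_span_singleton.1 (h2 (Ideal.mul_mem_mul (Ideal.mem_span_singleton_self _) hf))

theorem HasOrd.exists_unit {x y : K} (h : y ^ 2 = F.eval x) {π s : AffineRing F}
    (hu : IsUniformizer F x y π s) {f : AffineRing F} {n : ℕ} (hf : HasOrd x y f n) :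
    ∃ g, g ∉ pointIdeal F x y ∧ s ^ n * f = π ^ n * g := by
  obtain ⟨g, hg⟩ := hu.exists_mul_eq hf.1
  refine ⟨g, fun hgI => hf.2 (mem_pow_of_mul_mem h (hu.pow_notMem h n) ?_), hg⟩
  rw [hg, pow_succ (pointIdeal F x y)]
  exact Ideal.mul_mem_mul (Ideal.pow_mem_pow hu.mem n) hgI

theorem HasOrd.mul {x y : K} (h : IsSmoothPoint F x y) {f g : AffineRing F} {m n : ℕ}
    (hf : HasOrd x y f m) (hg : HasOrd x y g n) : HasOrd x y (f * g) (m + n) := by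
  obtain ⟨π, s, hu⟩ := h.exists_isUniformizer
  obtain ⟨f', hf', ef⟩ := hf.exists_unit h.eq hu
  obtain ⟨g', hg', eg⟩ := hg.exists_unit h.eq hu
  refine ⟨by rw [pow_add]; exact Ideal.mul_mem_mul hf.1 hg.1, fun hmem => ?_⟩
  obtain ⟨w, hw⟩ := hu.exists_mul_eq hmem
  have : π ^ (m + n) * (s * (f' * g') - π * w) = 0 := by
    rw [mul_sub, sub_eq_zero]
    calc π ^ (m + n) * (s * (f' * g')) = s * ((π ^ m * f') * (π ^ n * g')) := by ring
      _ = s ^ (m + n + 1) * (f * g) := by rw [← ef, ← eg]; ring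
      _ = π ^ (m + n) * (π * w) := by rw [hw]; ring
  have h0 := sub_eq_zero.1 (hu.pow_regular _ this)
  exact notMem_mul h.eq hu.notMem (notMem_mul h.eq hf' hg')
    (h0 ▸ Ideal.mul_mem_right _ _ hu.mem)

theorem HasOrd.pow {x y : K} (h : IsSmoothPoint F x y) {f : AffineRing F} {m : ℕ}
    (hf : HasOrd x y f m) (k : ℕ) : HasOrd x y (f ^ k) (m * k) := by
  induction k with
  | zero =>
    refine hasOrd_zero ?_
    rw [pow_zero, mem_pointIdeal h.eq, map_one]
    exact one_ne_zero
  | succ k ih =>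
    rw [pow_succ f, Nat.mul_succ]
    exact ih.mul h hf

/-- The ramification index of the function `X` at the point `(x, y)`. -/
noncomputable def ramification (y : K) : ℕ := by
  classical exact if y = 0 then 2 else 1

theorem hasOrd_root {x : K} (h : IsSmoothPoint F x 0) :
    HasOrd (F := F) x 0 (AdjoinRoot.root _) 1 := by
  obtain ⟨P, -, -, hu⟩ := exists_isUniformizer_of_eq_zero h
  refine ⟨by simpa using hu.mem, fun hmem => ?_⟩
  obtain ⟨w, hw⟩ := hu.exists_mul_eq hmem
  set π : AffineRing F := AdjoinRoot.root _ with hπ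
  have : π ^ 1 * (AdjoinRoot.of _ P ^ 2 - π * w) = 0 := by
    linear_combination hw
  have h0 := sub_eq_zero.1 (hu.pow_regular _ this)
  exact hu.pow_notMem h.eq 2 (h0 ▸ Ideal.mul_mem_right _ _ hu.mem)

theorem hasOrd_X_sub_C {x y : K} (h : IsSmoothPoint F x y) :
    HasOrd x y (AdjoinRoot.of ((X : K[X][X]) ^ 2 - C F) (X - C x)) (ramification y) := by
  by_cases hy : y = 0
  · subst hy
    obtain ⟨P, hP, hFP, hu⟩ := exists_isUniformizer_of_eq_zero h
    have e : AdjoinRoot.of ((X : K[X][X]) ^ 2 - C F) F = AdjoinRoot.of _ (P * (X - C x)) :=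
      congrArg _ (hFP.trans (mul_comm _ _))
    have h2 : HasOrd x 0 (AdjoinRoot.of ((X : K[X][X]) ^ 2 - C F) (P * (X - C x))) 2 := by
      have := (hasOrd_root h).pow h 2
      rwa [root_sq, one_mul, e] at this
    rw [ramification, if_pos rfl]
    rw [map_mul] at h2
    refine ⟨mem_pow_of_mul_mem h.eq hu.notMem h2.1, fun hmem => h2.2 ?_⟩
    exact Ideal.mul_mem_left _ _ hmem
  · rw [ramification, if_neg hy]
    have hu := isUniformizer_of_ne_zero h hy
    refine ⟨by simpa using hu.mem, fun hmem => ?_⟩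
    obtain ⟨w, hw⟩ := hu.exists_mul_eq hmem
    set π : AffineRing F := AdjoinRoot.of _ (X - C x) with hπ
    set s : AffineRing F := AdjoinRoot.root _ + AdjoinRoot.of _ (C y) with hs
    have : π ^ 1 * (s ^ 2 - π * w) = 0 := by
      linear_combination hw
    have h0 := sub_eq_zero.1 (hu.pow_regular _ this)
    exact hu.pow_notMem h.eq 2 (h0 ▸ Ideal.mul_mem_right _ _ hu.mem)

theorem hasOrd_of {x y : K} (h : IsSmoothPoint F x y) {P : K[X]} (hP : P ≠ 0) :
    HasOrd x y (AdjoinRoot.of ((X : K[X][X]) ^ 2 - C F) P)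
      (ramification y * P.rootMultiplicity x) := by
  obtain ⟨Q, hQ, hndvd⟩ := exists_eq_pow_rootMultiplicity_mul_and_not_dvd P hP x
  conv => arg 3; rw [hQ]
  rw [map_mul, map_pow]
  refine ((hasOrd_X_sub_C h).pow h _).mul h (n := 0) (hasOrd_zero ?_)
  rw [mem_pointIdeal h.eq, evalAt_of]
  exact fun h0 => hndvd (dvd_iff_isRoot.2 h0)

theorem of_mem_pow_iff {x y : K} (h : IsSmoothPoint F x y) {P : K[X]} (k : ℕ) :
    AdjoinRoot.of _ P ∈ pointIdeal F x y ^ (ramification y * k) ↔ (X - C x) ^ k ∣ P := by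
  rcases eq_or_ne P 0 with rfl | hP
  · simp
  · rw [(hasOrd_of h hP).mem_pow_iff, ← le_rootMultiplicity_iff hP]
    have : 0 < ramification y := by
      rw [ramification]; split_ifs <;> simp
    exact Nat.mul_le_mul_left_iff this

theorem exists_hasOrd {x y : K} (h : IsSmoothPoint F x y) {A B : K[X]} (hAB : A ≠ 0 ∨ B ≠ 0) :
    ∃ n, HasOrd x y (elt F A B) n := by
  have hN := hasOrd_of h (h.norm_ne_zero hAB)
  set k := ramification y * (A ^ 2 - F * B ^ 2).rootMultiplicity x
  have hex : ∃ n, elt F A B ∉ pointIdeal F x y ^ n := by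
    refine ⟨k + 1, fun hmem => hN.2 ?_⟩
    have e : AdjoinRoot.of _ (A ^ 2 - F * B ^ 2) = elt F A B * elt F A (-B) := by
      rw [elt_mul, ← elt_zero_right]
      congr 1 <;> ring
    rw [e]
    exact Ideal.mul_mem_right _ _ hmem
  classical
  have h0 : Nat.find hex ≠ 0 := by
    intro h0
    have := Nat.find_spec hex
    rw [h0] at this
    simp at this
  obtain ⟨n, hn⟩ := Nat.exists_eq_succ_of_ne_zero h0
  refine ⟨n, ?_, ?_⟩
  · by_contra hmem
    exact Nat.find_min hex (m := n) (by omega) hmem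
  · have := Nat.find_spec hex
    rwa [hn] at this

/-- The hyperelliptic involution of the coordinate ring. -/
noncomputable def conjHom (F : K[X]) : AffineRing F →+* AffineRing F :=
  AdjoinRoot.lift (AdjoinRoot.of _) (-AdjoinRoot.root _) (by simp [root_sq])

theorem conjHom_elt (A B : K[X]) : conjHom F (elt F A B) = elt F A (-B) := by
  simp [conjHom, elt]

theorem conj_mem_pow {x y : K} {A B : K[X]} {n : ℕ} (h : elt F A B ∈ pointIdeal F x y ^ n) :
    elt F A (-B) ∈ pointIdeal F x (-y) ^ n := by
  have hle : (pointIdeal F x y).map (conjHom F) ≤ pointIdeal F x (-y) := by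
    rw [pointIdeal, Ideal.map_span, Ideal.span_le]
    rintro _ ⟨w, rfl | rfl, rfl⟩
    · rw [conjHom, AdjoinRoot.lift_of]
      exact of_X_sub_C_mem x (-y)
    · rw [conjHom, map_sub, AdjoinRoot.lift_of, AdjoinRoot.lift_root]
      have := (pointIdeal F x (-y)).neg_mem (root_sub_mem x (-y))
      rwa [C_neg, map_neg, sub_neg_eq_add, neg_add'] at this
  rw [← conjHom_elt]
  have := Ideal.mem_map_of_mem (conjHom F) h
  rw [Ideal.map_pow] at this
  exact Ideal.pow_right_mono hle n this

theorem HasOrd.conj {x y : K} {A B : K[X]} {n : ℕ} (h : HasOrd x y (elt F A B) n) :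
    HasOrd x (-y) (elt F A (-B)) n := by
  refine ⟨conj_mem_pow h.1, fun hmem => h.2 ?_⟩
  simpa using conj_mem_pow hmem

/-- A function which vanishes to high order at both points over `x` is divisible by a power of
`X - x`. -/
theorem dvd_of_mem_pow {x y : K} (h : IsSmoothPoint F x y) {A B : K[X]} {k : ℕ}
    (h1 : elt F A B ∈ pointIdeal F x y ^ (ramification y * k))
    (h2 : elt F A B ∈ pointIdeal F x (-y) ^ (ramification y * k)) :
    (X - C x) ^ k ∣ A ∧ (X - C x) ^ k ∣ B := by
  have h3 := conj_mem_pow h2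
  rw [neg_neg] at h3
  have hC : AdjoinRoot.of ((X : K[X][X]) ^ 2 - C F) (C 2) = 2 := by rw [map_ofNat C 2, map_ofNat]
  have hu : IsUnit (C (2 : K)) := isUnit_C.2 (isUnit_iff_ne_zero.2 h.two_ne_zero)
  constructor
  · have := Ideal.add_mem _ h1 h3
    rw [show elt F A B + elt F A (-B) = AdjoinRoot.of _ (C 2 * A) by
      rw [map_mul, hC, elt, elt, map_neg]; ring, of_mem_pow_iff h] at this
    exact (hu.dvd_mul_left).1 this
  · have := Ideal.sub_mem _ h1 h3
    rw [show elt F A B - elt F A (-B) = AdjoinRoot.root _ * AdjoinRoot.of _ (C 2 * B) by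
      rw [map_mul, hC, elt, elt, map_neg]; ring] at this
    by_cases hy : y = 0
    · subst hy
      rcases eq_or_ne B 0 with rfl | hB
      · simp
      have hB2 : C 2 * B ≠ 0 := mul_ne_zero hu.ne_zero hB
      have hord := (hasOrd_root h).mul h (hasOrd_of h hB2)
      rw [hord.mem_pow_iff, ramification, if_pos rfl] at this
      refine (hu.dvd_mul_left).1 ((le_rootMultiplicity_iff hB2).1 ?_)
      omega
    · have h4 := mem_pow_of_mul_mem h.eq
        (by rwa [mem_pointIdeal h.eq, evalAt_root]) this
      rw [of_mem_pow_iff h] at h4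
      exact (hu.dvd_mul_left).1 h4

end LocalOrder

/-! ### Orders of forms -/

section Forms

variable {K : Type*} [Field K] {F : K[X]}

/-- A binary form of degree `n`, given in the chart `Z = 1`, in the chart used at the point `p`. -/
noncomputable def CurvePoint.chart (p : CurvePoint F) (n : ℕ) (P : K[X]) : K[X] :=
  match p with
  | .affine _ _ _ => P
  | .infinity _ _ => P.reflect n

/-- The value at the point `p` of the coordinate of the chart used at `p`. -/
def CurvePoint.chartCoord : CurvePoint F → K
  | .affine x _ _ => x
  | .infinity _ _ => 0

theorem CurvePoint.chart_mul (p : CurvePoint F) {m n : ℕ} {P Q : K[X]} (hP : P.natDegree ≤ m)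
    (hQ : Q.natDegree ≤ n) : p.chart (m + n) (P * Q) = p.chart m P * p.chart n Q := by
  cases p
  · rfl
  · exact reflect_mul P Q hP hQ

theorem CurvePoint.chart_add (p : CurvePoint F) (n : ℕ) (P Q : K[X]) :
    p.chart n (P + Q) = p.chart n P + p.chart n Q := by
  cases p
  · rfl
  · exact reflect_add P Q n

theorem CurvePoint.chart_neg (p : CurvePoint F) (n : ℕ) (P : K[X]) :
    p.chart n (-P) = -p.chart n P := by
  cases p
  · rfl
  · exact reflect_neg P n

theorem CurvePoint.chart_zero (p : CurvePoint F) (n : ℕ) : p.chart n 0 = 0 := by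
  cases p
  · rfl
  · exact reflect_zero

theorem CurvePoint.chart_eq_zero_iff (p : CurvePoint F) {n : ℕ} {P : K[X]} :
    p.chart n P = 0 ↔ P = 0 := by
  cases p
  · rfl
  · exact reflect_eq_zero_iff

theorem IsSmoothSextic.not_sq [IsAlgClosed K] (hF : IsSmoothSextic F) (A B : K[X])
    (h : A ^ 2 = F * B ^ 2) : B = 0 := by
  by_contra hB
  have hdeg : F.degree ≠ 0 := by
    intro h0
    have : F.natDegree = 0 := natDegree_eq_of_degree_eq_some h0
    have h6 := le_natDegree_of_ne_zero hF.coeff_six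
    omega
  obtain ⟨θ, hθ⟩ := IsAlgClosed.exists_root F hdeg
  have hm : F.rootMultiplicity θ = 1 := by
    have h1 : 0 < F.rootMultiplicity θ := (rootMultiplicity_pos hF.ne_zero).2 hθ
    have h2 : ¬ 1 < F.rootMultiplicity θ := fun h2 =>
      hF.derivative_ne_zero hθ ((one_lt_rootMultiplicity_iff_isRoot hF.ne_zero).1 h2).2
    omega
  have hFB : F * B ^ 2 ≠ 0 := mul_ne_zero hF.ne_zero (pow_ne_zero _ hB)
  have h3 := congrArg (rootMultiplicity θ) h
  have hA : A ^ 2 ≠ 0 := h ▸ hFB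
  rw [rootMultiplicity_mul hFB, hm, sq, sq, rootMultiplicity_mul (by rwa [← sq]),
    rootMultiplicity_mul (mul_ne_zero hB hB)] at h3
  omega

theorem IsSmoothSextic.not_sq_reflect [IsAlgClosed K] (hF : IsSmoothSextic F) (A B : K[X])
    (h : A ^ 2 = F.reflect 6 * B ^ 2) : B = 0 := by
  set N := A.natDegree + B.natDegree with hN
  have hA : A.natDegree ≤ N + 3 := by omega
  have hB : B.natDegree ≤ N := by omega
  have hR : (F.reflect 6).natDegree ≤ 6 := by
    refine natDegree_reflect_le.trans ?_
    simpa using hF.natDegree_le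
  have e := congrArg (reflect ((N + 3) + (N + 3))) h
  rw [sq A, reflect_mul A A hA hA, show N + 3 + (N + 3) = 6 + (N + N) by ring,
    reflect_mul _ _ hR (by rw [sq]; exact natDegree_mul_le.trans (add_le_add hB hB)), sq B,
    reflect_mul B B hB hB, reflect_reflect, ← sq, ← sq] at e
  exact reflect_eq_zero_iff.1 (hF.not_sq _ _ e)

theorem CurvePoint.isSmoothPoint [IsAlgClosed K] (hF : IsSmoothSextic F) (p : CurvePoint F) :
    IsSmoothPoint (p.chart 6 F) p.chartCoord p.yCoord := by
  cases p with
  | affine x y h =>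
    refine ⟨hF.two_ne_zero, h, ?_, hF.not_sq⟩
    rintro (rfl : y = 0)
    exact hF.derivative_ne_zero (x := x) (by rw [← h]; ring)
  | infinity s h =>
    refine ⟨hF.two_ne_zero, ?_, fun h0 => absurd h0 (hF.yCoord_infinity_ne_zero h),
      hF.not_sq_reflect⟩
    change s ^ 2 = (F.reflect 6).eval 0
    rw [h, ← coeff_zero_eq_eval_zero, coeff_reflect]
    simp [revAt_le]

/-- A form as a function in the chart used at the point `p`. -/
noncomputable def CurveForm.toElt {d : ℕ} (g : CurveForm K d) (p : CurvePoint F) :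
    AffineRing (p.chart 6 F) :=
  elt _ (p.chart (d + 3) g.A) (p.chart d g.B)

theorem CurveForm.hasOrd_ord [IsAlgClosed K] (hF : IsSmoothSextic F) {d : ℕ} {g : CurveForm K d}
    (hg : g.IsNonzero) (p : CurvePoint F) :
    HasOrd p.chartCoord p.yCoord (g.toElt p) (g.ord p) := by
  obtain ⟨n, hn⟩ := exists_hasOrd (p.isSmoothPoint hF) (A := p.chart (d + 3) g.A)
    (B := p.chart d g.B) (by simpa [CurvePoint.chart_eq_zero_iff, CurveForm.IsNonzero] using hg)
  have : g.ord p = n := by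
    rw [← hn.affineOrd_eq]
    cases p <;> rfl
  rw [this]
  exact hn

theorem HasOrd.unique {x y : K} {f : AffineRing F} {m n : ℕ} (hm : HasOrd x y f m)
    (hn : HasOrd x y f n) : m = n :=
  le_antisymm ((hn.mem_pow_iff m).1 hm.1) ((hm.mem_pow_iff n).1 hn.1)

/-- The product of two forms. -/
noncomputable def CurveForm.mul (hF : F.natDegree ≤ 6) {d e : ℕ} (g : CurveForm K d)
    (h : CurveForm K e) : CurveForm K (d + e + 3) where
  A := g.A * h.A + F * (g.B * h.B)
  B := g.A * h.B + h.A * g.B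
  natDegree_A_le := by
    have h1 := natDegree_mul_le.trans (add_le_add g.natDegree_A_le h.natDegree_A_le)
    have h2 := natDegree_mul_le.trans (add_le_add hF
      (natDegree_mul_le.trans (add_le_add g.natDegree_B_le h.natDegree_B_le)))
    exact natDegree_add_le_of_degree_le (h1.trans (by omega)) (h2.trans (by omega))
  natDegree_B_le := by
    have h1 := natDegree_mul_le.trans (add_le_add g.natDegree_A_le h.natDegree_B_le)
    have h2 := natDegree_mul_le.trans (add_le_add h.natDegree_A_le g.natDegree_B_le)
    exact natDegree_add_le_of_degree_le (h1.trans (by omega)) (h2.trans (by omega))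

theorem CurveForm.toElt_mul (hF : F.natDegree ≤ 6) {d e : ℕ} (g : CurveForm K d)
    (h : CurveForm K e) (p : CurvePoint F) :
    (g.mul hF h).toElt p = g.toElt p * h.toElt p := by
  rw [CurveForm.toElt, CurveForm.toElt, CurveForm.toElt, elt_mul]
  congr 1
  · change p.chart (d + e + 3 + 3) (g.A * h.A + F * (g.B * h.B)) = _
    have hBB := natDegree_mul_le.trans (add_le_add g.natDegree_B_le h.natDegree_B_le)
    rw [CurvePoint.chart_add, show d + e + 3 + 3 = (d + 3) + (e + 3) by ring,
      p.chart_mul g.natDegree_A_le h.natDegree_A_le,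
      show (d + 3) + (e + 3) = 6 + (d + e) by ring, p.chart_mul hF hBB,
      p.chart_mul g.natDegree_B_le h.natDegree_B_le]
    ring
  · change p.chart (d + e + 3) (g.A * h.B + h.A * g.B) = _
    rw [CurvePoint.chart_add, show d + e + 3 = (d + 3) + e by ring,
      p.chart_mul g.natDegree_A_le h.natDegree_B_le,
      show (d + 3) + e = (e + 3) + d by ring, p.chart_mul h.natDegree_A_le g.natDegree_B_le]

/-- The image of a form under the hyperelliptic involution. -/
noncomputable def CurveForm.conj {d : ℕ} (g : CurveForm K d) : CurveForm K d where
  A := g.A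
  B := -g.B
  natDegree_A_le := g.natDegree_A_le
  natDegree_B_le := by simpa using g.natDegree_B_le

theorem CurveForm.IsNonzero.conj {d : ℕ} {g : CurveForm K d} (hg : g.IsNonzero) :
    g.conj.IsNonzero := by
  simpa [CurveForm.IsNonzero, CurveForm.conj] using hg

theorem CurveForm.IsNonzero.mul [IsAlgClosed K] (hF : IsSmoothSextic F) {d e : ℕ}
    {g : CurveForm K d} {h : CurveForm K e} (hg : g.IsNonzero) (hh : h.IsNonzero) :
    (g.mul hF.natDegree_le h).IsNonzero := by
  by_contra h0
  simp only [CurveForm.IsNonzero, not_or, not_not] at h0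
  have hN : ∀ {A B : K[X]}, A ^ 2 - F * B ^ 2 = 0 → A = 0 ∧ B = 0 := by
    intro A B hAB
    have hB := hF.not_sq A B (sub_eq_zero.1 hAB)
    subst hB
    exact ⟨by simpa using hAB, rfl⟩
  have key : (g.A ^ 2 - F * g.B ^ 2) * (h.A ^ 2 - F * h.B ^ 2) = 0 := by
    have e1 : g.A * h.A + F * (g.B * h.B) = 0 := h0.1
    have e2 : g.A * h.B + h.A * g.B = 0 := h0.2
    linear_combination (g.A * h.A + F * (g.B * h.B)) * e1 - F * (g.A * h.B + h.A * g.B) * e2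
  rcases mul_eq_zero.1 key with h1 | h1
  · have := hN h1
    simp [CurveForm.IsNonzero, this] at hg
  · have := hN h1
    simp [CurveForm.IsNonzero, this] at hh

theorem CurveForm.ord_mul [IsAlgClosed K] (hF : IsSmoothSextic F) {d e : ℕ}
    {g : CurveForm K d} {h : CurveForm K e} (hg : g.IsNonzero) (hh : h.IsNonzero)
    (p : CurvePoint F) : (g.mul hF.natDegree_le h).ord p = g.ord p + h.ord p := by
  refine (CurveForm.hasOrd_ord hF (hg.mul hF hh) p).unique ?_
  rw [CurveForm.toElt_mul]
  exact (CurveForm.hasOrd_ord hF hg p).mul (p.isSmoothPoint hF) (CurveForm.hasOrd_ord hF hh p)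

theorem CurveForm.ord_conj [IsAlgClosed K] (hF : IsSmoothSextic F) {d : ℕ} {g : CurveForm K d}
    (hg : g.IsNonzero) (p : CurvePoint F) : g.conj.ord p.conj = g.ord p := by
  have h1 := CurveForm.hasOrd_ord hF hg p
  refine (CurveForm.hasOrd_ord hF hg.conj p.conj).unique ?_
  generalize g.ord p = n at h1
  cases p with
  | affine x y h => exact HasOrd.conj h1
  | infinity s h =>
    have := HasOrd.conj h1
    rw [← CurvePoint.chart_neg] at this
    exact this

/-- A binary form of degree `d + 3` in `X` and `Z`, as a form on the curve. -/
noncomputable def CurveForm.ofPoly {d : ℕ} (P : K[X]) (hP : P.natDegree ≤ d + 3) :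
    CurveForm K d where
  A := P
  B := 0
  natDegree_A_le := hP
  natDegree_B_le := by simp

theorem CurveForm.isNonzero_ofPoly {d : ℕ} {P : K[X]} (hP : P.natDegree ≤ d + 3) (h0 : P ≠ 0) :
    (CurveForm.ofPoly P hP).IsNonzero := Or.inl h0

theorem CurveForm.ord_ofPoly [IsAlgClosed K] (hF : IsSmoothSextic F) {d : ℕ} {P : K[X]}
    (hP : P.natDegree ≤ d + 3) (h0 : P ≠ 0) (p : CurvePoint F) :
    (CurveForm.ofPoly P hP).ord p
      = ramification p.yCoord * (p.chart (d + 3) P).rootMultiplicity p.chartCoord := by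
  refine (CurveForm.hasOrd_ord hF (CurveForm.isNonzero_ofPoly hP h0) p).unique ?_
  have e : (CurveForm.ofPoly P hP).toElt p = AdjoinRoot.of _ (p.chart (d + 3) P) := by
    rw [← elt_zero_right, ← p.chart_zero d]
    rfl
  rw [e]
  exact hasOrd_of (p.isSmoothPoint hF) (by simpa [CurvePoint.chart_eq_zero_iff] using h0)

theorem CurveForm.ord_pos_iff [IsAlgClosed K] (hF : IsSmoothSextic F) {d : ℕ} {g : CurveForm K d}
    (hg : g.IsNonzero) (p : CurvePoint F) :
    0 < g.ord p ↔ (p.chart (d + 3) g.A).eval p.chartCoord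
      + (p.chart d g.B).eval p.chartCoord * p.yCoord = 0 := by
  have h := (CurveForm.hasOrd_ord hF hg p).mem_pow_iff 1
  rw [pow_one, mem_pointIdeal (p.isSmoothPoint hF).eq, CurveForm.toElt, evalAt_elt] at h
  exact h.symm

/-- The multiplicity of the point `q` in the divisor `p`. -/
noncomputable def CurvePoint.mult (q p : CurvePoint F) : ℕ := by
  classical exact if p = q then 1 else 0

theorem CurvePoint.div_apply (q p : CurvePoint F) : q.div p = (q.mult p : ℤ) := by
  classical
  simp [CurvePoint.div, CurvePoint.mult, Finsupp.single_apply, eq_comm]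

theorem CurvePoint.eq_or_eq_conj (hF : F.natDegree ≤ 6) {p q : CurvePoint F}
    (hx : p.xCoord = q.xCoord) (hz : p.zCoord = q.zCoord) : p = q ∨ p = q.conj := by
  have h1 := p.sextic_eq hF
  rw [hx, hz, ← q.sextic_eq hF, sq_eq_sq_iff_eq_or_eq_neg] at h1
  exact h1.imp (CurvePoint.ext' hx hz) (fun h => CurvePoint.ext' (by simpa) (by simpa) (by simpa))

/-- The divisor of the linear form vanishing at the `X`-coordinate of `q` is `q` plus its
conjugate. -/
theorem CurvePoint.ramification_mul_line (hF : IsSmoothSextic F) (q p : CurvePoint F) :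
    ramification p.yCoord * (p.chart 1 q.line).rootMultiplicity p.chartCoord
      = q.mult p + q.conj.mult p := by
  have hz : ∀ {P : K[X]} {x : K}, P.eval x ≠ 0 → P.rootMultiplicity x = 0 := fun h =>
    rootMultiplicity_eq_zero h
  by_cases hpq : p.xCoord * q.zCoord - q.xCoord * p.zCoord = 0
  · obtain ⟨hx, hz'⟩ := CurvePoint.coord_eq hpq
    have h1 : (p.chart 1 q.line).rootMultiplicity p.chartCoord = 1 := by
      cases p with
      | affine x y h =>
        change (q.line).rootMultiplicity x = 1
        rw [CurvePoint.line, ← hx, ← hz']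
        change (C 1 * X - C x).rootMultiplicity x = 1
        rw [C_1, one_mul, rootMultiplicity_X_sub_C_self]
      | infinity s h =>
        change (q.line.reflect 1).rootMultiplicity 0 = 1
        rw [CurvePoint.line, ← hx, ← hz']
        change ((C 0 * X - C 1 : K[X]).reflect 1).rootMultiplicity 0 = 1
        have : ((C 0 * X - C 1 : K[X]).reflect 1) = C (-1) * (X - C 0) := by
          simp [reflect_neg, reflect_one]
        rw [this, rootMultiplicity_mul (mul_ne_zero (by simp) (X_sub_C_ne_zero _)),
          rootMultiplicity_C, rootMultiplicity_X_sub_C_self]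
    rw [h1, mul_one]
    by_cases hy : p.yCoord = 0
    · have h2 : q = p := by
        rcases CurvePoint.eq_or_eq_conj hF.natDegree_le hx hz' with h | h
        · exact h.symm
        · refine CurvePoint.ext' hx.symm hz'.symm ?_
          rw [hy]
          rw [h] at hy
          simpa using hy
      have h3 : p.conj = p := CurvePoint.ext' (by simp) (by simp) (by simp [hy])
      simp [ramification, hy, CurvePoint.mult, h2, h3]
    · have h3 : q.conj ≠ q := by
        intro h
        have h4 := congrArg CurvePoint.yCoord h
        rw [CurvePoint.yCoord_conj] at h4
        have h5 : q.yCoord = 0 := by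
          have : 2 * q.yCoord = 0 := by linear_combination -h4
          exact (mul_eq_zero.1 this).resolve_left hF.two_ne_zero
        rcases CurvePoint.eq_or_eq_conj hF.natDegree_le hx hz' with h6 | h6
        · exact hy (h6 ▸ h5)
        · exact hy (by rw [h6]; simp [h5])
      rcases CurvePoint.eq_or_eq_conj hF.natDegree_le hx hz' with rfl | rfl
      · simp [ramification, hy, CurvePoint.mult, h3.symm]
      · simp [ramification, CurvePoint.mult, h3] at hy ⊢
        exact hy
  · have h0 : (p.chart 1 q.line).rootMultiplicity p.chartCoord = 0 := by
      refine hz ?_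
      cases p with
      | affine x y h =>
        change (C q.zCoord * X - C q.xCoord).eval x ≠ 0
        intro h0
        apply hpq
        simp [CurvePoint.xCoord, CurvePoint.zCoord] at h0 ⊢
        linear_combination h0
      | infinity s h =>
        change ((C q.zCoord * X - C q.xCoord).reflect 1).eval 0 ≠ 0
        intro h0
        apply hpq
        rw [← coeff_zero_eq_eval_zero, coeff_reflect] at h0
        simpa [CurvePoint.xCoord, CurvePoint.zCoord, revAt_le] using h0
    have h1 : p ≠ q := by rintro rfl; exact hpq (by ring)
    have h2 : p ≠ q.conj := by rintro rfl; exact hpq (by simp)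
    simp [h0, CurvePoint.mult, h1, h2]

theorem CurvePoint.line_ne_zero (q : CurvePoint F) : q.line ≠ 0 := by
  intro h
  have h0 : q.xCoord = 0 := by simpa [CurvePoint.line] using congrArg (coeff · 0) h
  have h1 : q.zCoord = 0 := by simpa [CurvePoint.line] using congrArg (coeff · 1) h
  exact q.coord_ne_zero.elim (· h0) (· h1)

end Forms

/-! ### Divisibility of forms, and divisors of degree three -/

section Divisibility

variable {K : Type*} [Field K] {F : K[X]}

theorem sub_natDegree_le_rootMultiplicity_reflect {n : ℕ} {R : K[X]} (hR0 : R ≠ 0) :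
    n - R.natDegree ≤ (R.reflect n).rootMultiplicity 0 := by
  rw [le_rootMultiplicity_iff (by simpa [reflect_eq_zero_iff] using hR0), C_0, sub_zero,
    X_pow_dvd_iff]
  intro j hj
  rw [coeff_reflect, revAt_le (by omega)]
  exact coeff_eq_zero_of_natDegree_lt (by omega)

theorem natDegree_le_of_X_pow_dvd_reflect {n k : ℕ} {A : K[X]} (hA : A.natDegree ≤ n)
    (h : X ^ k ∣ A.reflect n) (h0 : A ≠ 0) : A.natDegree + k ≤ n := by
  by_contra hlt
  rw [X_pow_dvd_iff] at h
  have := h (n - A.natDegree) (by omega)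
  rw [coeff_reflect, revAt_le (by omega), Nat.sub_sub_self hA] at this
  exact h0 (leadingCoeff_eq_zero.1 this)

/-- If a form on the curve vanishes, at every point, at least to the order of a binary form `R` in
`X` and `Z`, then it is divisible by `R`. -/
theorem CurveForm.exists_eq_mul [IsAlgClosed K] (hF : IsSmoothSextic F) {m n d : ℕ} (hm : m = n + d)
    (g : CurveForm K m) (hg : g.IsNonzero) {R : K[X]} (hR : R.natDegree ≤ n) (hR0 : R ≠ 0)
    (h : ∀ p : CurvePoint F,
      ramification p.yCoord * (p.chart n R).rootMultiplicity p.chartCoord ≤ g.ord p) :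
    ∃ g' : CurveForm K d, g.A = R * g'.A ∧ g.B = R * g'.B := by
  have hmem : ∀ p : CurvePoint F, g.toElt p ∈ pointIdeal (p.chart 6 F) p.chartCoord p.yCoord ^
      (ramification p.yCoord * (p.chart n R).rootMultiplicity p.chartCoord) := fun p =>
    ((CurveForm.hasOrd_ord hF hg p).mem_pow_iff _).2 (h p)
  have hram : ∀ y : K, ramification (-y) = ramification y := fun y => by
    by_cases hy : y = 0 <;> simp [ramification, hy]
  have haff : ∀ x : K, (X - C x) ^ R.rootMultiplicity x ∣ g.A ∧
      (X - C x) ^ R.rootMultiplicity x ∣ g.B := by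
    intro x
    obtain ⟨y, hy⟩ := IsAlgClosed.exists_pow_nat_eq (F.eval x) (n := 2) two_pos
    have h1 := hmem (.affine x y hy)
    have h2 := hmem (CurvePoint.affine x y hy).conj
    refine dvd_of_mem_pow (F := F) ((CurvePoint.affine x y hy).isSmoothPoint hF) h1 ?_
    have h3 : ramification (CurvePoint.affine x y hy).conj.yCoord
        = ramification (CurvePoint.affine x y hy).yCoord := hram y
    rw [h3] at h2
    exact h2
  have hinf : X ^ (n - R.natDegree) ∣ g.A.reflect (m + 3) ∧
      X ^ (n - R.natDegree) ∣ g.B.reflect m := by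
    obtain ⟨s, hs⟩ := IsAlgClosed.exists_pow_nat_eq (F.coeff 6) (n := 2) two_pos
    have h1 := hmem (.infinity s hs)
    have h2 := hmem (CurvePoint.infinity s hs).conj
    have h3 : ramification (CurvePoint.infinity s hs).conj.yCoord
        = ramification (CurvePoint.infinity s hs).yCoord := hram s
    rw [h3] at h2
    have h4 := dvd_of_mem_pow (F := F.reflect 6) ((CurvePoint.infinity s hs).isSmoothPoint hF)
      h1 h2
    have h5 : (X : K[X]) ^ (n - R.natDegree) ∣
        (X - C 0) ^ ((CurvePoint.infinity s hs).chart n R).rootMultiplicity 0 := by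
      rw [C_0, sub_zero]
      exact pow_dvd_pow _ (sub_natDegree_le_rootMultiplicity_reflect hR0)
    exact ⟨h5.trans h4.1, h5.trans h4.2⟩
  have hdvd : ∀ {A : K[X]}, (∀ x, (X - C x) ^ R.rootMultiplicity x ∣ A) → R ∣ A := by
    intro A hA
    rcases eq_or_ne A 0 with rfl | hA0
    · exact dvd_zero _
    · classical
      rw [IsAlgClosed.dvd_iff_roots_le_roots hR0 hA0, Multiset.le_iff_count]
      intro x
      rw [count_roots, count_roots, le_rootMultiplicity_iff hA0]
      exact hA x
  have hdeg : ∀ {A A' : K[X]} {N : ℕ}, A = R * A' → A.natDegree ≤ N →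
      X ^ (n - R.natDegree) ∣ A.reflect N → A'.natDegree ≤ N - n := by
    intro A A' N hA hN hX
    rcases eq_or_ne A' 0 with rfl | hA'
    · simp
    · have h0 : A ≠ 0 := hA ▸ mul_ne_zero hR0 hA'
      have h1 := natDegree_le_of_X_pow_dvd_reflect hN hX h0
      rw [hA, natDegree_mul hR0 hA'] at h1
      omega
  obtain ⟨A', hA'⟩ := hdvd fun x => (haff x).1
  obtain ⟨B', hB'⟩ := hdvd fun x => (haff x).2
  refine ⟨⟨A', B', ?_, ?_⟩, hA', hB'⟩
  · have := hdeg hA' g.natDegree_A_le hinf.1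
    omega
  · have := hdeg hB' g.natDegree_B_le hinf.2
    omega

/-- The product of the linear forms of a list of points. -/
noncomputable def lines (l : List (CurvePoint F)) : K[X] := (l.map CurvePoint.line).prod

theorem lines_ne_zero (l : List (CurvePoint F)) : lines l ≠ 0 := by
  rw [lines, Ne, List.prod_eq_zero_iff]
  intro h
  obtain ⟨q, -, hq⟩ := List.mem_map.1 h
  exact q.line_ne_zero hq

theorem natDegree_lines_le (l : List (CurvePoint F)) : (lines l).natDegree ≤ l.length := by
  induction l with
  | nil => simp [lines]
  | cons q l ih =>
    rw [lines, List.map_cons, List.prod_cons, List.length_cons, add_comm]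
    exact natDegree_mul_le.trans (add_le_add q.natDegree_line_le ih)

theorem ramification_mul_lines (hF : IsSmoothSextic F) (l : List (CurvePoint F))
    (p : CurvePoint F) :
    ramification p.yCoord * (p.chart l.length (lines l)).rootMultiplicity p.chartCoord
      = (l.map fun q => q.mult p + q.conj.mult p).sum := by
  induction l with
  | nil =>
    have : p.chart 0 (1 : K[X]) = 1 := by
      cases p
      · rfl
      · exact (reflect_one 0).trans (pow_zero _)
    have h1 : (1 : K[X]).rootMultiplicity p.chartCoord = 0 := by
      rw [← C_1, rootMultiplicity_C]
    simp [lines, this, h1]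
  | cons q l ih =>
    have e : lines (q :: l) = q.line * lines l := by simp [lines]
    have h1 : p.chart 1 q.line * p.chart l.length (lines l) ≠ 0 :=
      mul_ne_zero (p.chart_eq_zero_iff.not.2 q.line_ne_zero)
        (p.chart_eq_zero_iff.not.2 (lines_ne_zero l))
    rw [List.length_cons, add_comm l.length, e,
      p.chart_mul q.natDegree_line_le (natDegree_lines_le l), rootMultiplicity_mul h1, mul_add,
      CurvePoint.ramification_mul_line hF, ih, List.map_cons, List.sum_cons]

/-- Every nonzero binary form in `X` and `Z` is a product of linear forms of points. -/
theorem exists_eq_lines [IsAlgClosed K] (F : K[X]) (n : ℕ) {H : K[X]} (hH : H.natDegree ≤ n)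
    (h0 : H ≠ 0) :
    ∃ (l : List (CurvePoint F)) (κ : K), l.length = n ∧ κ ≠ 0 ∧ H = C κ * lines l := by
  induction n generalizing H with
  | zero =>
    obtain ⟨κ, rfl⟩ := natDegree_eq_zero.1 (Nat.le_zero.1 hH)
    exact ⟨[], κ, rfl, fun h => h0 (by rw [h, C_0]), by simp [lines]⟩
  | succ n ih =>
    by_cases hd : H.natDegree ≤ n
    · obtain ⟨l, κ, hl, hκ, e⟩ := ih hd h0
      obtain ⟨s, hs⟩ := IsAlgClosed.exists_pow_nat_eq (F.coeff 6) (n := 2) two_pos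
      refine ⟨.infinity s hs :: l, -κ, by simp [hl], neg_ne_zero.2 hκ, ?_⟩
      rw [e]
      simp [lines, CurvePoint.line, CurvePoint.xCoord, CurvePoint.zCoord]
    · have hdeg : H.degree ≠ 0 := by
        intro h
        have : H.natDegree = 0 := natDegree_eq_of_degree_eq_some h
        omega
      obtain ⟨x, hx⟩ := IsAlgClosed.exists_root H hdeg
      obtain ⟨H', rfl⟩ := dvd_iff_isRoot.2 hx
      have hH' : H' ≠ 0 := right_ne_zero_of_mul h0
      rw [natDegree_mul (X_sub_C_ne_zero x) hH', natDegree_X_sub_C] at hH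
      obtain ⟨l, κ, hl, hκ, e⟩ := ih (H := H') (by omega) hH'
      obtain ⟨y, hy⟩ := IsAlgClosed.exists_pow_nat_eq (F.eval x) (n := 2) two_pos
      refine ⟨.affine x y hy :: l, κ, by simp [hl], hκ, ?_⟩
      rw [e]
      simp [lines, CurvePoint.line, CurvePoint.xCoord, CurvePoint.zCoord]
      ring

/-- A form times its conjugate is a binary form in `X` and `Z`. -/
theorem CurveForm.mul_conj_eq (hF : F.natDegree ≤ 6) {d : ℕ} (h : CurveForm K d) :
    h.mul hF h.conj = CurveForm.ofPoly (h.A ^ 2 - F * h.B ^ 2)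
      (by
        have := (h.mul hF h.conj).natDegree_A_le
        have e : (h.mul hF h.conj).A = h.A ^ 2 - F * h.B ^ 2 := by
          simp only [CurveForm.mul, CurveForm.conj]; ring
        rwa [e] at this) := by
  refine (CurveForm.mk.injEq _ _ _ _ _ _ _ _).mpr ⟨?_, ?_⟩ <;>
  · simp only [CurveForm.conj]
    ring

theorem CurveForm.natDegree_norm_le (hF : F.natDegree ≤ 6) {d : ℕ} (h : CurveForm K d) :
    (h.A ^ 2 - F * h.B ^ 2).natDegree ≤ d + d + 3 + 3 := by
  have := (h.mul hF h.conj).natDegree_A_le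
  have e : (h.mul hF h.conj).A = h.A ^ 2 - F * h.B ^ 2 := by
    simp only [CurveForm.mul, CurveForm.conj]; ring
  rwa [e] at this

theorem CurveForm.norm_ne_zero [IsAlgClosed K] (hF : IsSmoothSextic F) {d : ℕ} {h : CurveForm K d}
    (hh : h.IsNonzero) : h.A ^ 2 - F * h.B ^ 2 ≠ 0 := by
  intro h0
  have hB : h.B = 0 := hF.not_sq h.A h.B (sub_eq_zero.1 h0)
  rw [hB] at h0
  simp at h0
  simp [CurveForm.IsNonzero, hB, h0] at hh

theorem CurveForm.ramification_mul_norm [IsAlgClosed K] (hF : IsSmoothSextic F) {d : ℕ}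
    {h : CurveForm K d}
    (hh : h.IsNonzero) (p : CurvePoint F) :
    ramification p.yCoord * (p.chart (d + d + 3 + 3)
      (h.A ^ 2 - F * h.B ^ 2)).rootMultiplicity p.chartCoord = h.ord p + h.conj.ord p := by
  rw [← CurveForm.ord_mul hF hh hh.conj, CurveForm.mul_conj_eq,
    CurveForm.ord_ofPoly hF _ (CurveForm.norm_ne_zero hF hh)]

/-- An effective divisor `s + t + r` equivalent to `p + q + a` is residual to the conjugate of
`p + q + a` in the divisor of a form `A + B Y`, with `A` a cubic and `B` a constant. -/
theorem LinEquiv.exists_form [IsAlgClosed K] (hF : IsSmoothSextic F) {p q r s t a : CurvePoint F}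
    (h : LinEquiv (s.div + t.div) (p.div + q.div + a.div - r.div)) :
    ∃ w : CurveForm K 0, w.IsNonzero ∧ ∀ P : CurvePoint F, w.ord P = s.mult P + t.mult P
      + r.mult P + p.conj.mult P + q.conj.mult P + a.conj.mult P := by
  obtain ⟨d, g, h, hg, hh, hD⟩ := h
  have hc0 := lines_ne_zero [p, q, a]
  set cub : CurveForm K 0 := CurveForm.ofPoly (lines [p, q, a]) (natDegree_lines_le _) with hcub
  have hcubn : cub.IsNonzero := CurveForm.isNonzero_ofPoly _ hc0
  have hcubo : ∀ P : CurvePoint F, cub.ord P = p.mult P + p.conj.mult P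
      + (q.mult P + q.conj.mult P) + (a.mult P + a.conj.mult P) := by
    intro P
    rw [hcub, CurveForm.ord_ofPoly hF _ hc0]
    have := ramification_mul_lines hF [p, q, a] P
    simp only [List.map_cons, List.map_nil, List.sum_cons, List.sum_nil] at this
    exact this.trans (by ring)
  have hgc := hg.mul hF hcubn
  have hG := hgc.mul hF hh.conj
  have hGo : ∀ P : CurvePoint F, ((g.mul hF.natDegree_le cub).mul hF.natDegree_le h.conj).ord P
      = (h.ord P + h.conj.ord P) + (s.mult P + t.mult P
      + r.mult P + p.conj.mult P + q.conj.mult P + a.conj.mult P) := by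
    intro P
    rw [CurveForm.ord_mul hF hgc hh.conj, CurveForm.ord_mul hF hg hcubn, hcubo]
    have := hD P
    simp only [Finsupp.coe_sub, Finsupp.coe_add, Pi.sub_apply, Pi.add_apply,
      CurvePoint.div_apply] at this
    omega
  obtain ⟨w, hwA, hwB⟩ := CurveForm.exists_eq_mul hF (n := d + d + 3 + 3) (d := 0) (by ring) _ hG
    (h.natDegree_norm_le hF.natDegree_le) (CurveForm.norm_ne_zero hF hh) (fun P => by
      rw [CurveForm.ramification_mul_norm hF hh, hGo]
      exact Nat.le_add_right _ _)
  have hw : w.IsNonzero := by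
    by_contra h0
    simp only [CurveForm.IsNonzero, not_or, not_not] at h0
    rw [h0.1, mul_zero] at hwA
    rw [h0.2, mul_zero] at hwB
    exact hG.elim (fun h => h hwA) (fun h => h hwB)
  refine ⟨w, hw, fun P => ?_⟩
  have h1 := (CurveForm.hasOrd_ord hF hG P).unique (m := _)
    (n := (h.ord P + h.conj.ord P) + w.ord P) (by
      have e : ((g.mul hF.natDegree_le cub).mul hF.natDegree_le h.conj).toElt P
          = (h.toElt P * h.conj.toElt P) * w.toElt P := by
        rw [← CurveForm.toElt_mul hF.natDegree_le, ← CurveForm.toElt_mul hF.natDegree_le,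
          CurveForm.mul_conj_eq]
        rw [CurveForm.toElt, CurveForm.toElt, hwA, hwB]
        simp only [CurveForm.mul, CurveForm.ofPoly, zero_mul, mul_zero, add_zero]
        rw [show d + 0 + 3 + d + 3 = d + d + 3 + 3 by ring]
      rw [e]
      exact ((CurveForm.hasOrd_ord hF hh P).mul (P.isSmoothPoint hF)
        (CurveForm.hasOrd_ord hF hh.conj P)).mul (P.isSmoothPoint hF)
        (CurveForm.hasOrd_ord hF hw P))
  rw [hGo] at h1
  omega

end Divisibility

/-! ### The polar plane contains the translates -/

section Induced

variable {K : Type*} [Field K] {F : K[X]}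

theorem CurvePoint.mult_conj (q p : CurvePoint F) : q.mult p.conj = q.conj.mult p := by
  have : p.conj = q ↔ p = q.conj :=
    ⟨fun h => by rw [← h, CurvePoint.conj_conj], fun h => by rw [h, CurvePoint.conj_conj]⟩
  by_cases hp : p = q.conj <;> simp [CurvePoint.mult, this, hp]

theorem CurvePoint.mult_self (q : CurvePoint F) : q.mult q = 1 := by
  simp [CurvePoint.mult]

theorem ramification_pos (y : K) : 0 < ramification y := by
  rw [ramification]
  split_ifs <;> simp

/-- A form of weight three vanishes at a point if its value there, in homogeneous coordinates, is
zero. -/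
theorem CurveForm.ord_pos_iff_cubic [IsAlgClosed K] (hF : IsSmoothSextic F) {w : CurveForm K 0}
    (hw : w.IsNonzero) (p : CurvePoint F) :
    0 < w.ord p ↔ cubic w.A.coeff p.xCoord p.zCoord + w.B.coeff 0 * p.yCoord = 0 := by
  rw [CurveForm.ord_pos_iff hF hw]
  have hB : w.B = C (w.B.coeff 0) := eq_C_of_natDegree_le_zero w.natDegree_B_le
  cases p with
  | affine x y h =>
    change w.A.eval x + w.B.eval x * y = 0 ↔ cubic w.A.coeff x 1 + _ * y = 0
    rw [eval_eq_cubic w.natDegree_A_le, hB, eval_C, coeff_C_zero]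
  | infinity s h =>
    change (w.A.reflect 3).eval 0 + (w.B.reflect 0).eval 0 * s = 0
      ↔ cubic w.A.coeff 1 0 + _ * s = 0
    rw [← coeff_zero_eq_eval_zero, ← coeff_zero_eq_eval_zero, coeff_reflect, coeff_reflect]
    simp [cubic, revAt_le]

theorem CurvePoint.rootMultiplicity_eq_of_ord [IsAlgClosed K] {n : ℕ} {P Q : K[X]}
    (h : ∀ p : CurvePoint F,
      ramification p.yCoord * (p.chart n P).rootMultiplicity p.chartCoord
        = ramification p.yCoord * (p.chart n Q).rootMultiplicity p.chartCoord) (x : K) :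
    P.rootMultiplicity x = Q.rootMultiplicity x := by
  obtain ⟨y, hy⟩ := IsAlgClosed.exists_pow_nat_eq (F.eval x) (n := 2) two_pos
  exact Nat.eq_of_mul_eq_mul_left (ramification_pos y) (h (.affine x y hy))

theorem exists_eq_C_mul [IsAlgClosed K] {P Q : K[X]} (hP : P ≠ 0) (hQ : Q ≠ 0)
    (h : ∀ x, P.rootMultiplicity x = Q.rootMultiplicity x) : ∃ κ, P = C κ * Q := by
  classical
  have hr : Q.roots = P.roots := Multiset.ext.2 fun x => by rw [count_roots, count_roots, h]
  obtain ⟨u, hu⟩ := (IsAlgClosed.associated_iff_roots_eq_roots hQ hP).2 hr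
  obtain ⟨κ, -, hκ⟩ := Polynomial.isUnit_iff.1 u.isUnit
  exact ⟨κ, by rw [hκ, mul_comm, hu]⟩

/-- The norm of a form of weight three is determined by its divisor. -/
theorem CurveForm.exists_norm_eq [IsAlgClosed K] (hF : IsSmoothSextic F) {w : CurveForm K 0}
    (hw : w.IsNonzero) {l : List (CurvePoint F)} (hl : l.length = 6)
    (hord : ∀ P, w.ord P = (l.map fun q => q.mult P).sum) :
    ∃ κ, w.A ^ 2 - F * w.B ^ 2 = C κ * lines l := by
  refine exists_eq_C_mul (CurveForm.norm_ne_zero hF hw) (lines_ne_zero l)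
    (CurvePoint.rootMultiplicity_eq_of_ord (F := F) (n := 6) fun P => ?_)
  have h1 := CurveForm.ramification_mul_norm hF hw P
  have h2 := ramification_mul_lines hF l P
  rw [hl] at h2
  rw [h2]
  refine h1.trans ?_
  have h3 := CurveForm.ord_conj hF hw P.conj
  rw [CurvePoint.conj_conj] at h3
  rw [h3, hord, hord, List.sum_map_add]
  simp only [CurvePoint.mult_conj]

/-- A multiset of points which is a sum of pairs of conjugate points. -/
inductive ConjPaired : Multiset (CurvePoint F) → Prop
  | nil : ConjPaired 0
  | cons (q : CurvePoint F) (S : Multiset (CurvePoint F)) (h : ConjPaired S) :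
      ConjPaired (q ::ₘ q.conj ::ₘ S)

theorem ConjPaired.exists_conj {T : Multiset (CurvePoint F)} (hT : ConjPaired T) :
    ∀ {x : CurvePoint F} {S : Multiset (CurvePoint F)}, T = x ::ₘ S →
      ∃ S', S = x.conj ::ₘ S' ∧ ConjPaired S' := by
  induction hT with
  | nil => intro x S h; exact absurd h.symm (Multiset.cons_ne_zero)
  | cons q R hR ih =>
    intro x S h
    have hx : x ∈ q ::ₘ q.conj ::ₘ R := h ▸ Multiset.mem_cons_self x S
    rcases Multiset.mem_cons.1 hx with rfl | hx
    · exact ⟨R, ((Multiset.cons_inj_right x).1 h).symm, hR⟩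
    rcases Multiset.mem_cons.1 hx with rfl | hx
    · rw [Multiset.cons_swap] at h
      exact ⟨R, by rw [CurvePoint.conj_conj, (Multiset.cons_inj_right _).1 h], hR⟩
    · obtain ⟨R', rfl⟩ := Multiset.exists_cons_of_mem hx
      obtain ⟨R'', rfl, hR''⟩ := ih rfl
      refine ⟨q ::ₘ q.conj ::ₘ R'', ?_, .cons q R'' hR''⟩
      rw [Multiset.cons_swap q.conj, Multiset.cons_swap q] at h
      rw [← (Multiset.cons_inj_right _).1 h, Multiset.cons_swap q.conj, Multiset.cons_swap q]

theorem ConjPaired.eq_conj {x y : CurvePoint F} (h : ConjPaired {x, y}) : y = x.conj := by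
  obtain ⟨S, hS, -⟩ := h.exists_conj (x := x) (S := {y}) rfl
  exact ((Multiset.singleton_eq_cons_iff _).1 hS).1

theorem ConjPaired.conj_cases {x y z w : CurvePoint F} (h : ConjPaired {x, y, z, w}) :
    (y = x.conj ∧ w = z.conj) ∨ (z = x.conj ∧ w = y.conj) ∨ (w = x.conj ∧ z = y.conj) := by
  obtain ⟨S, hS, hp⟩ := h.exists_conj (x := x) (S := {y, z, w}) rfl
  have hx : x.conj ∈ ({y, z, w} : Multiset (CurvePoint F)) := hS ▸ Multiset.mem_cons_self _ _
  simp only [Multiset.insert_eq_cons, Multiset.mem_cons, Multiset.mem_singleton] at hx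
  rcases hx with hx | hx | hx
  · refine .inl ⟨hx.symm, ConjPaired.eq_conj ?_⟩
    rw [hx] at hS
    rwa [← (Multiset.cons_inj_right _).1 hS] at hp
  · refine .inr (.inl ⟨hx.symm, ConjPaired.eq_conj ?_⟩)
    rw [hx, Multiset.insert_eq_cons, Multiset.insert_eq_cons, Multiset.cons_swap] at hS
    rwa [← (Multiset.cons_inj_right _).1 hS] at hp
  · refine .inr (.inr ⟨hx.symm, ConjPaired.eq_conj ?_⟩)
    rw [hx, show ({y, z, w} : Multiset (CurvePoint F)) = w ::ₘ {y, z} by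
      rw [← Multiset.cons_zero w]
      simp only [Multiset.insert_eq_cons, ← Multiset.cons_zero]
      rw [Multiset.cons_swap z, Multiset.cons_swap y]] at hS
    rwa [← (Multiset.cons_inj_right _).1 hS] at hp

/-- If `s + t + r` is obtained from `p + q + a` by removing conjugate pairs and inserting others,
for a Weierstrass point `a`, then the polar plane of the point of `p + q` contains that of
`s + t`. -/
theorem orthogonal_of_conjPaired (hF : IsSmoothSextic F) (θ : K) (hθ : F.eval θ = 0)
    {p q s t r : CurvePoint F}
    (h : ConjPaired {weierstrassPoint F θ hθ, s, t, r, p.conj, q.conj}) :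
    kummerVec s t ⬝ᵥ polar F.coeff θ (kummerVec p q) = 0 := by
  set a := weierstrassPoint F θ hθ with ha
  have hac : a.conj = a := conj_weierstrassPoint θ hθ
  obtain ⟨S, hS, hp⟩ := h.exists_conj (x := a) (S := {s, t, r, p.conj, q.conj}) rfl
  rw [hac] at hS
  have hx : a ∈ ({s, t, r, p.conj, q.conj} : Multiset (CurvePoint F)) :=
    hS ▸ Multiset.mem_cons_self _ _
  have hinj : ∀ {x y : CurvePoint F}, x.conj = y.conj → x = y := fun {x y} h => by
    rw [← x.conj_conj, h, y.conj_conj]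
  have hswap : ∀ x y : CurvePoint F, kummerVec x y ⬝ᵥ polar F.coeff θ (kummerVec a x) = 0 := by
    intro x y
    rw [dotProduct_polar_comm, kummerVec_dotProduct_polar hF, neg_zero]
  have hcan' : ∀ x y : CurvePoint F,
      kummerVec x x.conj ⬝ᵥ polar F.coeff θ (kummerVec a y) = 0 := by
    intro x y
    rw [kummerVec_conj_right_self, ← kummerVec_conj_right_self y]
    exact hswap y y.conj
  simp only [Multiset.insert_eq_cons, Multiset.mem_cons, Multiset.mem_singleton] at hx
  rcases hx with hx | hx | hx | hx | hx
  · -- the Weierstrass point is `s`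
    rw [← hx]
    rw [← hx, Multiset.insert_eq_cons] at hS
    rw [← (Multiset.cons_inj_right _).1 hS] at hp
    rcases hp.conj_cases with ⟨-, h2⟩ | ⟨h1, -⟩ | ⟨h1, -⟩
    · rw [hinj h2, kummerVec_conj_right_self, kummerVec_dotProduct_polar_canonical]
    · rw [← hinj h1]
      exact kummerVec_dotProduct_polar hF θ hθ p q
    · rw [← hinj h1, kummerVec_comm p]
      exact kummerVec_dotProduct_polar hF θ hθ q p
  · -- the Weierstrass point is `t`
    rw [← hx, kummerVec_comm]
    rw [← hx, Multiset.insert_eq_cons, Multiset.insert_eq_cons, Multiset.cons_swap] at hS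
    rw [← (Multiset.cons_inj_right _).1 hS] at hp
    rcases hp.conj_cases with ⟨-, h2⟩ | ⟨h1, -⟩ | ⟨h1, -⟩
    · rw [hinj h2, kummerVec_conj_right_self, kummerVec_dotProduct_polar_canonical]
    · rw [← hinj h1]
      exact kummerVec_dotProduct_polar hF θ hθ p q
    · rw [← hinj h1, kummerVec_comm p]
      exact kummerVec_dotProduct_polar hF θ hθ q p
  · -- the Weierstrass point is `r`
    rw [← hx, show ({s, t, a, p.conj, q.conj} : Multiset (CurvePoint F))
      = a ::ₘ {s, t, p.conj, q.conj} by
        simp only [Multiset.insert_eq_cons]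
        rw [Multiset.cons_swap t, Multiset.cons_swap s]] at hS
    rw [← (Multiset.cons_inj_right _).1 hS] at hp
    rcases hp.conj_cases with ⟨h1, h2⟩ | ⟨h1, h2⟩ | ⟨h1, h2⟩
    · rw [h1, hinj h2, kummerVec_conj_right_self, kummerVec_conj_right_self,
        dotProduct_polar_self]
    · rw [hinj h1, hinj h2, dotProduct_polar_self]
    · rw [hinj h1, hinj h2, kummerVec_comm t, dotProduct_polar_self]
  · -- the Weierstrass point is `p`
    have hpa : p = a := by rw [← p.conj_conj, ← hx, hac]
    rw [← hx, show ({s, t, r, a, q.conj} : Multiset (CurvePoint F))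
      = a ::ₘ {s, t, r, q.conj} by
        simp only [Multiset.insert_eq_cons]
        rw [Multiset.cons_swap r, Multiset.cons_swap t, Multiset.cons_swap s]] at hS
    rw [← (Multiset.cons_inj_right _).1 hS] at hp
    rw [hpa]
    rcases hp.conj_cases with ⟨h1, -⟩ | ⟨-, h2⟩ | ⟨h1, -⟩
    · rw [h1, hcan']
    · rw [hinj h2, kummerVec_comm s, hswap]
    · rw [hinj h1, hswap]
  · -- the Weierstrass point is `q`
    have hqa : q = a := by rw [← q.conj_conj, ← hx, hac]
    rw [← hx, show ({s, t, r, p.conj, a} : Multiset (CurvePoint F))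
      = a ::ₘ {s, t, r, p.conj} by
        simp only [Multiset.insert_eq_cons, ← Multiset.cons_zero]
        rw [Multiset.cons_swap p.conj, Multiset.cons_swap r, Multiset.cons_swap t,
          Multiset.cons_swap s]] at hS
    rw [← (Multiset.cons_inj_right _).1 hS] at hp
    rw [hqa, kummerVec_comm p]
    rcases hp.conj_cases with ⟨h1, -⟩ | ⟨-, h2⟩ | ⟨h1, -⟩
    · rw [h1, hcan']
    · rw [hinj h2, kummerVec_comm s, hswap]
    · rw [hinj h1, hswap]

/-- The polar plane of the point of `[p + q]` contains all the points of `[p + q + a - r]`. -/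
theorem LinEquiv.dotProduct_polar_eq_zero [IsAlgClosed K] (hF : IsSmoothSextic F) {θ : K}
    (hθ : F.eval θ = 0) {p q r s t : CurvePoint F}
    (h : LinEquiv (s.div + t.div)
      (p.div + q.div + (weierstrassPoint F θ hθ).div - r.div)) :
    kummerVec s t ⬝ᵥ polar F.coeff θ (kummerVec p q) = 0 := by
  obtain ⟨w, hw, hord⟩ := h.exists_form hF
  rw [conj_weierstrassPoint] at hord
  set a := weierstrassPoint F θ hθ with ha
  have hwB : w.B = C (w.B.coeff 0) := eq_C_of_natDegree_le_zero w.natDegree_B_le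
  by_cases hβ : w.B.coeff 0 = 0
  · -- the form is a cubic in `X` and `Z`, whose divisor consists of conjugate pairs
    rw [hβ, C_0] at hwB
    have hwA : w.A ≠ 0 := hw.resolve_right (fun h => h hwB)
    obtain ⟨l, κ, hl, hκ, hA⟩ := exists_eq_lines F 3 w.natDegree_A_le hwA
    obtain ⟨q₁, q₂, q₃, rfl⟩ := List.length_eq_three.1 hl
    have hord' : ∀ P : CurvePoint F, w.ord P = q₁.mult P + q₁.conj.mult P
        + (q₂.mult P + q₂.conj.mult P) + (q₃.mult P + q₃.conj.mult P) := by
      intro P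
      have e : w = CurveForm.ofPoly w.A w.natDegree_A_le := by
        cases w
        simp only at hwB
        subst hwB
        rfl
      rw [e, CurveForm.ord_ofPoly hF _ hwA]
      have h1 : P.chart 3 w.A = C κ * P.chart 3 (lines [q₁, q₂, q₃]) := by
        rw [hA]
        cases P
        · rfl
        · exact reflect_C_mul _ _ _
      change ramification _ * (P.chart 3 w.A).rootMultiplicity _ = _
      rw [h1, rootMultiplicity_mul (mul_ne_zero (C_ne_zero.2 hκ)
        (P.chart_eq_zero_iff.not.2 (lines_ne_zero _))), rootMultiplicity_C, zero_add]
      have h2 := ramification_mul_lines hF [q₁, q₂, q₃] P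
      simp only [List.map_cons, List.map_nil, List.sum_cons, List.sum_nil] at h2
      exact h2.trans (by ring)
    have hms : ({a, s, t, r, p.conj, q.conj} : Multiset (CurvePoint F))
        = q₁ ::ₘ q₁.conj ::ₘ q₂ ::ₘ q₂.conj ::ₘ q₃ ::ₘ q₃.conj ::ₘ 0 := by
      classical
      refine Multiset.ext.2 fun P => ?_
      have h1 := (hord P).symm.trans (hord' P)
      simp only [CurvePoint.mult] at h1
      simp only [Multiset.insert_eq_cons, Multiset.count_cons, Multiset.count_singleton,
        Multiset.count_zero]
      convert h1 using 1 <;> ring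
    refine orthogonal_of_conjPaired hF θ hθ (r := r) ?_
    rw [← ha, hms]
    exact .cons _ _ (.cons _ _ (.cons _ _ .nil))
  · -- the form is `Y = M(X)`, up to a scalar
    obtain ⟨κ, hκ⟩ := CurveForm.exists_norm_eq hF hw
      (l := [p.conj, q.conj, s, t, r, a]) rfl (fun P => by
        rw [hord]
        simp only [List.map_cons, List.map_nil, List.sum_cons, List.sum_nil]
        ring)
    set β := w.B.coeff 0 with hβdef
    set M : K[X] := C (-β⁻¹) * w.A with hM
    have hM3 : M.natDegree ≤ 3 := (natDegree_C_mul_le _ _).trans w.natDegree_A_le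
    have hcub : ∀ x z : K, cubic M.coeff x z = -β⁻¹ * cubic w.A.coeff x z := by
      intro x z
      simp only [cubic, hM, coeff_C_mul]
      ring
    have hon : ∀ P : CurvePoint F, 0 < w.ord P → P.yCoord = cubic M.coeff P.xCoord P.zCoord := by
      intro P hP
      rw [CurveForm.ord_pos_iff_cubic hF hw, ← hβdef] at hP
      rw [hcub, show cubic w.A.coeff P.xCoord P.zCoord = -(β * P.yCoord) by
        linear_combination hP]
      field_simp
    have hMθ : M.eval θ = 0 := by
      rw [eval_eq_cubic hM3]
      exact (hon a (by rw [hord, a.mult_self]; omega)).symm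
    have hFM : F = M ^ 2 + C (-(β⁻¹ ^ 2 * κ)) * (p.conj.line * q.conj.line * s.line * t.line
        * r.line * (X - C θ)) := by
      have hl : lines [p.conj, q.conj, s, t, r, a]
          = p.conj.line * q.conj.line * s.line * t.line * r.line * (X - C θ) := by
        have : a.line = X - C θ := by simp [ha, CurvePoint.line]
        simp only [lines, List.map_cons, List.map_nil, List.prod_cons, List.prod_nil, this]
        ring
      rw [← hl]
      have h1 : C (β⁻¹ ^ 2 * κ) * lines [p.conj, q.conj, s, t, r, a]
          = C (β⁻¹) ^ 2 * (w.A ^ 2 - F * w.B ^ 2) := by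
        rw [hκ]
        simp only [map_mul, map_pow]
        ring
      have h2 : C β⁻¹ * C β = 1 := by rw [← C_mul, inv_mul_cancel₀ hβ, C_1]
      have h3 : w.B = C β := hwB
      rw [C_neg, neg_mul, h1, hM, h3, C_neg]
      linear_combination (-F * (C β⁻¹ * C β + 1)) * h2
    rw [← kummerVec_conj p q]
    exact orthogonal_of_interp hF hM3 hMθ hFM
      (hon _ (by rw [hord, p.conj.mult_self]; omega))
      (hon _ (by rw [hord, q.conj.mult_self]; omega))
      (hon _ (by rw [hord, s.mult_self]; omega)) (hon _ (by rw [hord, t.mult_self]; omega))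

end Induced

/-! ### The translates span the plane -/

section Uniqueness

variable {K : Type*} [Field K] {F : K[X]}

/-- Two nonzero vectors of `K⁴` that are orthogonal to three independent vectors are
proportional. -/
theorem exists_smul_eq_of_orthogonal {v : Fin 3 → Fin 4 → K} (hv : LinearIndependent K v)
    {η ζ : Fin 4 → K} (hη : η ≠ 0) (h1 : ∀ i, v i ⬝ᵥ η = 0) (h2 : ∀ i, v i ⬝ᵥ ζ = 0) :
    ∃ c : K, c • η = ζ := by
  set A : Matrix (Fin 3) (Fin 4) K := Matrix.of v with hA
  have hr : A.rank = 3 := by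
    have := LinearIndependent.rank_matrix (M := A) hv
    simpa using this
  have hk : Module.finrank K (LinearMap.ker A.mulVecLin) = 1 := by
    have h := LinearMap.finrank_range_add_finrank_ker A.mulVecLin
    rw [← Matrix.rank, hr, Module.finrank_fin_fun] at h
    omega
  have m1 : η ∈ LinearMap.ker A.mulVecLin := by
    rw [LinearMap.mem_ker]; ext i; exact h1 i
  have m2 : ζ ∈ LinearMap.ker A.mulVecLin := by
    rw [LinearMap.mem_ker]; ext i; exact h2 i
  obtain ⟨c, hc⟩ := (finrank_eq_one_iff_of_nonzero' (⟨η, m1⟩ : LinearMap.ker A.mulVecLin)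
    (fun h => hη (congrArg Subtype.val h))).1 hk ⟨ζ, m2⟩
  exact ⟨c, congrArg Subtype.val hc⟩

/-- The value of the binary quadratic form `ξ₁ X² - ξ₂ X Z + ξ₃ Z²` at a point of the curve. -/
def quadValue (v : Fin 4 → K) (P : CurvePoint F) : K :=
  v 0 * P.xCoord ^ 2 - v 1 * P.xCoord * P.zCoord + v 2 * P.zCoord ^ 2

/-- The difference of the `X`-coordinates of two points of the curve. -/
def CurvePoint.delta (p q : CurvePoint F) : K := p.xCoord * q.zCoord - q.xCoord * p.zCoord

theorem CurvePoint.delta_self (p : CurvePoint F) : p.delta p = 0 := sub_self _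

theorem CurvePoint.delta_ne_zero_comm {p q : CurvePoint F} (h : p.delta q ≠ 0) :
    q.delta p ≠ 0 := fun h' => h (by rw [delta] at *; linear_combination -h')

theorem kummerVec_ne_of_delta {p q : CurvePoint F} (h : p.delta q ≠ 0) :
    kummerVec p q ≠ ![0, 0, 0, 1] := by
  rw [kummerVec_of_ne h]
  intro h'
  have h0 : p.zCoord * q.zCoord = 0 := congrFun h' 0
  have h1 : p.xCoord * q.zCoord + q.xCoord * p.zCoord = 0 := congrFun h' 1
  rw [CurvePoint.delta] at h
  rcases mul_eq_zero.1 h0 with h | h <;> simp_all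

theorem quadValue_kummerVec {s t : CurvePoint F} (h : kummerVec s t ≠ ![0, 0, 0, 1])
    (P : CurvePoint F) : quadValue (kummerVec s t) P = P.delta s * P.delta t := by
  obtain ⟨h0, h1, h2⟩ := kummerVec_zero_ne h
  rw [quadValue, h0, h1, h2, CurvePoint.delta, CurvePoint.delta]
  ring

theorem quadValue_comb {a b c : K} {u v w : Fin 4 → K} (h : a • u + b • v + c • w = 0)
    (P : CurvePoint F) : a * quadValue u P + b * quadValue v P + c * quadValue w P = 0 := by
  have h0 := congrFun h 0
  have h1 := congrFun h 1
  have h2 := congrFun h 2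
  simp only [Pi.add_apply, Pi.smul_apply, smul_eq_mul, Pi.zero_apply] at h0 h1 h2
  simp only [quadValue]
  linear_combination P.xCoord ^ 2 * h0 - P.xCoord * P.zCoord * h1 + P.zCoord ^ 2 * h2

theorem linearIndependent_three {u v w : Fin 4 → K}
    (h : ∀ a b c : K, a • u + b • v + c • w = 0 → a = 0 ∧ b = 0 ∧ c = 0) :
    LinearIndependent K ![u, v, w] := by
  rw [Fintype.linearIndependent_iff]
  intro g hg
  rw [Fin.sum_univ_three] at hg
  obtain ⟨h0, h1, h2⟩ := h _ _ _ hg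
  intro i
  fin_cases i
  exacts [h0, h1, h2]

/-- Three vectors are independent if their quadratic forms are in triangular position with respect
to three points. -/
theorem linearIndependent_of_quadValue {u v w : Fin 4 → K} {P Q R : CurvePoint F}
    (hu : quadValue u P ≠ 0) (hv : quadValue v P = 0) (hv' : quadValue v Q ≠ 0)
    (hw : quadValue w P = 0) (hw' : quadValue w Q = 0) (hw'' : quadValue w R ≠ 0) :
    LinearIndependent K ![u, v, w] := by
  refine linearIndependent_three fun a b c h => ?_
  have h1 := quadValue_comb h P
  rw [hv, hw, mul_zero, mul_zero, add_zero, add_zero] at h1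
  have ha := (mul_eq_zero.1 h1).resolve_right hu
  have h2 := quadValue_comb h Q
  rw [ha, hw', mul_zero, zero_mul, zero_add, add_zero] at h2
  have hb := (mul_eq_zero.1 h2).resolve_right hv'
  have h3 := quadValue_comb h R
  rw [ha, hb, zero_mul, zero_mul, zero_add, zero_add] at h3
  exact ⟨ha, hb, (mul_eq_zero.1 h3).resolve_right hw''⟩

theorem linearIndependent_of_quadValue_canonical {u v : Fin 4 → K} {P Q : CurvePoint F}
    (hu : quadValue u P ≠ 0) (hv : quadValue v P = 0) (hv' : quadValue v Q ≠ 0) :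
    LinearIndependent K ![u, v, ![0, 0, 0, 1]] := by
  refine linearIndependent_three fun a b c h => ?_
  have h0 : ∀ P : CurvePoint F, quadValue (![0, 0, 0, 1] : Fin 4 → K) P = 0 := fun P => by
    simp [quadValue]
  have h1 := quadValue_comb h P
  rw [hv, h0, mul_zero, mul_zero, add_zero, add_zero] at h1
  have ha := (mul_eq_zero.1 h1).resolve_right hu
  have h2 := quadValue_comb h Q
  rw [ha, h0, mul_zero, zero_mul, zero_add, add_zero] at h2
  have hb := (mul_eq_zero.1 h2).resolve_right hv'
  have h3 := congrFun h 3
  exact ⟨ha, hb, by simpa [ha, hb] using h3⟩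

theorem isPrincipal_zero : IsPrincipal (0 : CurvePoint F →₀ ℤ) :=
  ⟨0, .ofPoly 1 (by simp), .ofPoly 1 (by simp), CurveForm.isNonzero_ofPoly _ one_ne_zero,
    CurveForm.isNonzero_ofPoly _ one_ne_zero, by simp⟩

theorem LinEquiv.of_eq {D E : CurvePoint F →₀ ℤ} (h : D = E) : LinEquiv D E := by
  rw [LinEquiv, h, sub_self]
  exact isPrincipal_zero

theorem CurveForm.ord_ofPoly_lines [IsAlgClosed K] (hF : IsSmoothSextic F)
    (q₁ q₂ q₃ P : CurvePoint F) :
    (CurveForm.ofPoly (d := 0) (lines [q₁, q₂, q₃]) (natDegree_lines_le _)).ord P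
      = (q₁.mult P + q₁.conj.mult P) + (q₂.mult P + q₂.conj.mult P)
        + (q₃.mult P + q₃.conj.mult P) := by
  rw [CurveForm.ord_ofPoly hF _ (lines_ne_zero _)]
  have h := ramification_mul_lines hF [q₁, q₂, q₃] P
  simp only [List.map_cons, List.map_nil, List.sum_cons, List.sum_nil] at h
  exact h.trans (by ring)

/-- Twice a Weierstrass point is canonical. -/
theorem linEquiv_weierstrass [IsAlgClosed K] (hF : IsSmoothSextic F) {α β : CurvePoint F}
    (hα : α.conj = α) (hβ : β.conj = β) (q : CurvePoint F) :
    LinEquiv (q.div + α.div) (β.div + q.div + β.div - α.div) := by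
  refine ⟨0, .ofPoly (lines [α, α, β]) (natDegree_lines_le _),
    .ofPoly (lines [α, β, β]) (natDegree_lines_le _), CurveForm.isNonzero_ofPoly _
    (lines_ne_zero _), CurveForm.isNonzero_ofPoly _ (lines_ne_zero _), fun P => ?_⟩
  rw [CurveForm.ord_ofPoly_lines hF, CurveForm.ord_ofPoly_lines hF, hα, hβ]
  simp only [Finsupp.sub_apply, Finsupp.add_apply, CurvePoint.div_apply]
  push_cast
  ring

/-- If the six points `l` lie on `Y = M(X)` and their lines divide the norm of `Y - M(X)`, they are
the divisor of `Y - M(X)`. -/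
theorem CurveForm.ord_eq_of_norm [IsAlgClosed K] (hF : IsSmoothSextic F) {w : CurveForm K 0}
    (hw : w.B = 1) {l : List (CurvePoint F)} (hl : l.length = 6) {κ : K} (hκ : κ ≠ 0)
    (hn : w.A ^ 2 - F * w.B ^ 2 = C κ * lines l) (hon : ∀ q ∈ l, 0 < w.ord q)
    (P : CurvePoint F) : w.ord P = (l.map fun q => q.mult P).sum := by
  have hw0 : w.IsNonzero := .inr (by rw [hw]; exact one_ne_zero)
  have h1 : w.ord P + w.conj.ord P
      = (l.map fun q => q.mult P).sum + (l.map fun q => q.conj.mult P).sum := by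
    rw [← CurveForm.ramification_mul_norm hF hw0, ← List.sum_map_add,
      ← ramification_mul_lines hF, hl, hn]
    have h1 : P.chart 6 (C κ * lines l) = C κ * P.chart 6 (lines l) := by
      cases P
      · rfl
      · exact reflect_C_mul _ _ _
    change ramification _ * (P.chart 6 (C κ * lines l)).rootMultiplicity _ = _
    rw [h1, rootMultiplicity_mul (mul_ne_zero (C_ne_zero.2 hκ)
      (P.chart_eq_zero_iff.not.2 (lines_ne_zero _))), rootMultiplicity_C, zero_add]
  have h3 := CurveForm.ord_conj hF hw0 P.conj
  rw [CurvePoint.conj_conj] at h3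
  rw [h3] at h1
  by_cases hy : P.yCoord = 0
  · -- at a Weierstrass point both sides are symmetric
    have hP : P.conj = P := CurvePoint.ext' (by simp) (by simp) (by simp [hy])
    have h4 : (l.map fun q => q.conj.mult P) = l.map fun q => q.mult P :=
      List.map_congr_left fun q _ => by rw [← CurvePoint.mult_conj, hP]
    rw [h4, hP] at h1
    omega
  · have hx : 0 < w.ord P → w.ord P.conj = 0 := by
      intro h4
      by_contra h5
      rw [CurveForm.ord_pos_iff_cubic hF hw0] at h4
      have h6 := (CurveForm.ord_pos_iff_cubic hF hw0 _).1 (Nat.pos_of_ne_zero h5)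
      rw [CurvePoint.xCoord_conj, CurvePoint.zCoord_conj, CurvePoint.yCoord_conj] at h6
      rw [hw, coeff_one_zero, one_mul] at h4 h6
      have : 2 * P.yCoord = 0 := by linear_combination h4 - h6
      exact hy ((mul_eq_zero.1 this).resolve_left hF.two_ne_zero)
    have hzero : ∀ Q : CurvePoint F, w.ord Q = 0 → (l.map fun q => q.mult Q).sum = 0 := by
      intro Q hQ
      refine List.sum_eq_zero fun n hn => ?_
      obtain ⟨q, hq, rfl⟩ := List.mem_map.1 hn
      have : Q ≠ q := by
        rintro rfl
        exact (hon _ hq).ne' hQ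
      simp [CurvePoint.mult, this]
    by_cases h4 : w.ord P = 0
    · rw [h4, hzero P h4]
    · have h5 := hx (Nat.pos_of_ne_zero h4)
      have h6 : (l.map fun q => q.conj.mult P).sum = 0 := by
        rw [← hzero _ h5]
        simp only [CurvePoint.mult_conj]
      omega

theorem CurvePoint.yCoord_sq_of_eq {M G : K[X]} (hM : M.natDegree ≤ 3)
    (hG : G.natDegree ≤ 5) {q : CurvePoint F} (h : F = M ^ 2 + q.line * G) :
    q.yCoord ^ 2 = cubic M.coeff q.xCoord q.zCoord ^ 2 := by
  cases q with
  | affine x y hy =>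
    have h1 := congrArg (eval x) h
    rw [← hy, eval_add, eval_pow, eval_eq_cubic hM, eval_mul] at h1
    refine h1.trans ?_
    simp [CurvePoint.line, CurvePoint.xCoord, CurvePoint.zCoord]
  | infinity s hs =>
    have h1 := congrArg (coeff · 6) h
    have h2 : (M ^ 2).coeff 6 = M.coeff 3 ^ 2 := coeff_pow_of_natDegree_le (m := 2) hM
    simp only [coeff_add] at h1
    have h3 : (CurvePoint.infinity s hs : CurvePoint F).line = C (-1) := by
      simp [CurvePoint.line, CurvePoint.xCoord, CurvePoint.zCoord]
    rw [← hs, h2, h3, coeff_C_mul, coeff_eq_zero_of_natDegree_lt (p := G) (by omega), mul_zero,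
      add_zero] at h1
    refine h1.trans ?_
    simp [cubic, CurvePoint.xCoord, CurvePoint.zCoord]

theorem CurvePoint.exists_eq_cubic {M G : K[X]} (hM : M.natDegree ≤ 3)
    (hG : G.natDegree ≤ 5) (q : CurvePoint F) (h : F = M ^ 2 + q.line * G) :
    ∃ q' : CurvePoint F, q'.line = q.line ∧ q'.yCoord = cubic M.coeff q'.xCoord q'.zCoord := by
  rcases sq_eq_sq_iff_eq_or_eq_neg.1 (CurvePoint.yCoord_sq_of_eq hM hG h) with h1 | h1
  · exact ⟨q, rfl, h1⟩
  · exact ⟨q.conj, q.line_conj, by simp [h1]⟩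

theorem exists_factor_of_double_root {P : K[X]} {x θ : K} (hxθ : x ≠ θ) (hP : P.natDegree ≤ 6)
    (h1 : P.eval x = 0) (h2 : (derivative P).eval x = 0) (h3 : P.eval θ = 0) :
    ∃ H : K[X], H.natDegree ≤ 3 ∧ P = (X - C x) * (X - C x) * (X - C θ) * H := by
  obtain ⟨Q, hQ⟩ := dvd_iff_isRoot.2 h1
  have hQx : Q.eval x = 0 := by
    rw [hQ, derivative_mul] at h2
    simpa using h2
  obtain ⟨R, hR⟩ := dvd_iff_isRoot.2 hQx
  have hRθ : R.eval θ = 0 := by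
    rw [hQ, hR] at h3
    simpa [sub_ne_zero.2 hxθ.symm] using h3
  obtain ⟨H, hH⟩ := dvd_iff_isRoot.2 hRθ
  have e : P = (X - C x) * (X - C x) * (X - C θ) * H := by rw [hQ, hR, hH]; ring
  refine ⟨H, ?_, e⟩
  by_cases h0 : H = 0
  · simp [h0]
  · have hm : ((X - C x) * (X - C x) * (X - C θ)).Monic :=
      ((monic_X_sub_C x).mul (monic_X_sub_C x)).mul (monic_X_sub_C θ)
    have hd : ((X - C x) * (X - C x) * (X - C θ)).natDegree = 3 := by
      rw [((monic_X_sub_C x).mul (monic_X_sub_C x)).natDegree_mul (monic_X_sub_C θ),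
        (monic_X_sub_C x).natDegree_mul (monic_X_sub_C x)]
      simp
    rw [e, hm.natDegree_mul' h0, hd] at hP
    omega

/-- A cubic through the Weierstrass point which touches the curve at the conjugate of a given
point. -/
theorem exists_tangent_cubic (hF : IsSmoothSextic F) {θ : K} (hθ : F.eval θ = 0)
    {p : CurvePoint F} (hy : p.yCoord ≠ 0) (hp : p.delta (weierstrassPoint F θ hθ) ≠ 0) :
    ∃ M H : K[X], M.natDegree ≤ 3 ∧ H.natDegree ≤ 3 ∧ M.eval θ = 0 ∧
      F = M ^ 2 + p.line * p.line * (X - C θ) * H ∧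
      cubic M.coeff p.xCoord p.zCoord = -p.yCoord := by
  have h2 := hF.two_ne_zero
  cases p with
  | affine x y h =>
    change y ≠ 0 at hy
    have hxθ : x - θ ≠ 0 := by
      simpa [CurvePoint.delta, CurvePoint.xCoord, CurvePoint.zCoord, weierstrassPoint] using hp
    -- `M(x) = -y`, and `M'(x)` is the slope of the curve at `(x, -y)`
    set n : K := (-(derivative F).eval x / (2 * y) + y / (x - θ)) / (x - θ) with hn
    set M : K[X] := (X - C θ) * (C (-y / (x - θ)) + C n * (X - C x)) with hM
    have hM3 : M.natDegree ≤ 3 := by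
      have : M.natDegree ≤ 2 := by rw [hM]; compute_degree
      omega
    have hMx : M.eval x = -y := by
      rw [hM]; simp; field_simp
    have hM' : (derivative M).eval x = -(derivative F).eval x / (2 * y) := by
      rw [hM, derivative_mul]
      simp
      rw [hn]
      field_simp
      ring
    obtain ⟨H, hH3, hH⟩ := exists_factor_of_double_root (P := F - M ^ 2) (sub_ne_zero.1 hxθ)
      ((natDegree_sub_le _ _).trans (max_le hF.natDegree_le (natDegree_pow_le_of_le 2 hM3)))
      (by simp [hMx, h])
      (by
        rw [derivative_sub, derivative_pow]
        simp [hMx, hM']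
        field_simp
        ring) (by simp [hθ, hM])
    refine ⟨M, H, hM3, hH3, by simp [hM], ?_, ?_⟩
    · have : (CurvePoint.affine x y h : CurvePoint F).line = X - C x := by
        simp [CurvePoint.line, CurvePoint.xCoord, CurvePoint.zCoord]
      rw [this, ← hH]
      ring
    · exact (eval_eq_cubic hM3 x).symm.trans hMx
  | infinity s hs =>
    change s ≠ 0 at hy
    -- the two highest coefficients of `M²` agree with those of `F`
    set n : K := -s * θ - F.coeff 5 / (2 * s) with hn
    set M : K[X] := (X - C θ) * (C n * X + C (-s) * X ^ 2) with hM
    have hM3 : M.natDegree ≤ 3 := by rw [hM]; compute_degree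
    have hMe : M = C (-s) * X ^ 3 + C (n + s * θ) * X ^ 2 + C (-θ * n) * X := by
      rw [hM]
      simp only [map_add, map_mul, map_neg]
      ring
    have c3 : M.coeff 3 = -s := by
      rw [hMe]
      simp only [coeff_add, coeff_C_mul, coeff_X_pow, coeff_X]
      norm_num
    have hd : (F - M ^ 2).natDegree ≤ 4 := by
      have e : M ^ 2 = C (s ^ 2) * X ^ 6 + C (-2 * s * (n + s * θ)) * X ^ 5
          + C ((n + s * θ) ^ 2 + 2 * s * θ * n) * X ^ 4
          + C (-2 * (n + s * θ) * θ * n) * X ^ 3 + C (θ ^ 2 * n ^ 2) * X ^ 2 := by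
        rw [hMe]
        simp only [map_add, map_mul, map_neg, map_pow, map_ofNat]
        ring
      rw [natDegree_le_iff_coeff_eq_zero]
      intro N hN
      rw [e]
      rcases (by omega : N = 5 ∨ N = 6 ∨ 6 < N) with rfl | rfl | h6
      · simp only [coeff_sub, coeff_add, coeff_C_mul, coeff_X_pow]
        norm_num
        rw [hn]
        field_simp
        ring
      · simp only [coeff_sub, coeff_add, coeff_C_mul, coeff_X_pow]
        norm_num
        rw [hs, sub_self]
      · rw [coeff_sub, coeff_eq_zero_of_natDegree_lt (hF.natDegree_le.trans_lt h6)]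
        simp only [coeff_add, coeff_C_mul, coeff_X_pow, show N ≠ 6 by omega, show N ≠ 5 by omega,
          show N ≠ 4 by omega, show N ≠ 3 by omega, show N ≠ 2 by omega]
        norm_num
    obtain ⟨H, hH⟩ := dvd_iff_isRoot.2 (show (F - M ^ 2).eval θ = 0 by simp [hθ, hM])
    refine ⟨M, H, hM3, ?_, by simp [hM], ?_, ?_⟩
    · by_cases h0 : H = 0
      · simp [h0]
      · rw [hH, (monic_X_sub_C θ).natDegree_mul' h0, natDegree_X_sub_C] at hd
        omega
    · have : (CurvePoint.infinity s hs : CurvePoint F).line = -1 := by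
        simp [CurvePoint.line, CurvePoint.xCoord, CurvePoint.zCoord]
      rw [this, neg_mul_neg, one_mul, one_mul, ← hH]
      ring
    · simp [cubic, CurvePoint.xCoord, CurvePoint.zCoord, CurvePoint.yCoord, c3]

theorem cubic_line_mul {R : K[X]} (q : CurvePoint F) (hR : R.natDegree ≤ 2) (P : CurvePoint F) :
    cubic (q.line * R).coeff P.xCoord P.zCoord
      = P.delta q * (R.coeff 0 * P.zCoord ^ 2 + R.coeff 1 * P.xCoord * P.zCoord
        + R.coeff 2 * P.xCoord ^ 2) := by
  have h3 : R.coeff 3 = 0 := coeff_eq_zero_of_natDegree_lt (by omega)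
  have e : q.line * R = C q.zCoord * (X * R) - C q.xCoord * R := by
    rw [CurvePoint.line]; ring
  simp only [e, cubic, coeff_sub, coeff_C_mul, coeff_X_mul, coeff_X_mul_zero, CurvePoint.delta, h3]
  ring

/-- The cubic can be chosen not to touch the curve to higher order: the pencil of tangent cubics
moves the residual points. -/
theorem exists_simple_tangent_cubic (hF : IsSmoothSextic F) {θ : K} (hθ : F.eval θ = 0)
    {p : CurvePoint F} (hy : p.yCoord ≠ 0) (hp : p.delta (weierstrassPoint F θ hθ) ≠ 0) :
    ∃ M H : K[X], M.natDegree ≤ 3 ∧ H.natDegree ≤ 3 ∧ M.eval θ = 0 ∧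
      F = M ^ 2 + p.line * p.line * (X - C θ) * H ∧
      cubic M.coeff p.xCoord p.zCoord = -p.yCoord ∧ cubic H.coeff p.xCoord p.zCoord ≠ 0 := by
  obtain ⟨M, H, hM, hH, hMθ, hFM, hMp⟩ := exists_tangent_cubic hF hθ hy hp
  by_cases h0 : cubic H.coeff p.xCoord p.zCoord = 0
  · -- adding `line² (X - θ)` to `M` changes the value of `H` at `p` by `-2 M = 2 y`
    set R := p.line * (X - C θ) with hR
    have hR2 : R.natDegree ≤ 2 := by
      refine natDegree_mul_le.trans ?_
      have := p.natDegree_line_le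
      rw [natDegree_X_sub_C]
      omega
    have hN3 : (p.line * R).natDegree ≤ 3 :=
      natDegree_mul_le.trans (add_le_add p.natDegree_line_le hR2)
    have hN : cubic (p.line * R).coeff p.xCoord p.zCoord = 0 := by
      rw [cubic_line_mul p hR2, p.delta_self, zero_mul]
    refine ⟨M + p.line * R, H - C 2 * M - p.line * R, (natDegree_add_le _ _).trans (max_le hM hN3),
      (natDegree_sub_le _ _).trans (max_le ((natDegree_sub_le _ _).trans
        (max_le hH ((natDegree_C_mul_le _ _).trans hM))) hN3), ?_, ?_, ?_, ?_⟩
    · simp [hMθ, hR]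
    · rw [hR, map_ofNat]
      linear_combination hFM
    · rw [← hMp, ← sub_eq_zero, ← hN]
      simp only [cubic, coeff_add]
      ring
    · have : cubic (H - C 2 * M - p.line * R).coeff p.xCoord p.zCoord
          = cubic H.coeff p.xCoord p.zCoord - 2 * cubic M.coeff p.xCoord p.zCoord
            - cubic (p.line * R).coeff p.xCoord p.zCoord := by
        simp only [cubic, coeff_sub, coeff_C_mul]
        ring
      rw [this, h0, hN, hMp]
      simpa using ⟨hF.two_ne_zero, hy⟩
  · exact ⟨M, H, hM, hH, hMθ, hFM, hMp, h0⟩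

/-- The class of `2 p + a` contains an effective divisor which avoids `p` and its conjugate. -/
theorem exists_linEquiv_double [IsAlgClosed K] (hF : IsSmoothSextic F) {θ : K}
    (hθ : F.eval θ = 0) {p : CurvePoint F} (hy : p.yCoord ≠ 0)
    (hp : p.delta (weierstrassPoint F θ hθ) ≠ 0) :
    ∃ r s t : CurvePoint F, p.delta s ≠ 0 ∧ p.delta t ≠ 0 ∧
      LinEquiv (s.div + t.div) (p.div + p.div + (weierstrassPoint F θ hθ).div - r.div) := by
  obtain ⟨M, H, hM, hH, hMθ, hFM, hMp, hHp⟩ := exists_simple_tangent_cubic hF hθ hy hp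
  have hH0 : H ≠ 0 := by
    rintro rfl
    exact hHp (by simp [cubic])
  obtain ⟨l, κ, hl, hκ, rfl⟩ := exists_eq_lines F 3 hH hH0
  obtain ⟨s', t', r', rfl⟩ := List.length_eq_three.1 hl
  have hlin : lines [s', t', r'] = s'.line * t'.line * r'.line := by simp [lines, mul_assoc]
  set a := weierstrassPoint F θ hθ with ha
  have hal : a.line = X - C θ := by simp [ha, CurvePoint.line]
  have hch : ∀ G : K[X], G.natDegree ≤ 2 → ∀ q : CurvePoint F, lines [s', t', r'] = q.line * G →
      p.delta q ≠ 0 ∧ ∃ q' : CurvePoint F, q'.line = q.line ∧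
        q'.yCoord = cubic M.coeff q'.xCoord q'.zCoord := by
    intro G hG q hq
    constructor
    · intro h0
      apply hHp
      rw [hq, show C κ * (q.line * G) = q.line * (C κ * G) by ring,
        cubic_line_mul q ((natDegree_C_mul_le _ _).trans hG), h0, zero_mul]
    · refine CurvePoint.exists_eq_cubic hM (G := p.line * p.line * (X - C θ)
        * (C κ * G)) ?_ q (by rw [hq] at hFM; exact hFM.trans (by ring))
      refine natDegree_mul_le.trans ?_
      have h1 := natDegree_lines_le [p, p, a]
      rw [lines, List.map_cons, List.map_cons, List.map_cons, List.map_nil, List.prod_cons,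
        List.prod_cons, List.prod_cons, List.prod_nil, mul_one, ← mul_assoc, hal] at h1
      exact add_le_add h1 ((natDegree_C_mul_le _ _).trans hG)
  have hdeg : ∀ q₁ q₂ : CurvePoint F, (q₁.line * q₂.line).natDegree ≤ 2 := fun q₁ q₂ =>
    natDegree_mul_le.trans (add_le_add q₁.natDegree_line_le q₂.natDegree_line_le)
  obtain ⟨hs1, s, hs2, hs3⟩ := hch _ (hdeg t' r') s' (by rw [hlin]; ring)
  obtain ⟨ht1, t, ht2, ht3⟩ := hch _ (hdeg s' r') t' (by rw [hlin]; ring)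
  obtain ⟨-, r, hr2, hr3⟩ := hch _ (hdeg s' t') r' (by rw [hlin]; ring)
  have hdelta : ∀ {q q' : CurvePoint F}, q'.line = q.line → p.delta q' = p.delta q := by
    intro q q' h
    have h0 := congrArg (coeff · 0) h
    have h1 := congrArg (coeff · 1) h
    simp [CurvePoint.line] at h0 h1
    rw [CurvePoint.delta, CurvePoint.delta, h0, h1]
  refine ⟨r, s, t, by rwa [hdelta hs2], by rwa [hdelta ht2], ?_⟩
  set w : CurveForm K 0 := ⟨-M, 1, by rwa [natDegree_neg], by simp⟩ with hw
  have hw0 : w.IsNonzero := .inr one_ne_zero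
  have hon : ∀ q : CurvePoint F, q.yCoord = cubic M.coeff q.xCoord q.zCoord → 0 < w.ord q := by
    intro q hq
    rw [CurveForm.ord_pos_iff_cubic hF hw0, hq, hw]
    simp only [cubic, coeff_neg, coeff_one_zero]
    ring
  have hord := CurveForm.ord_eq_of_norm hF (w := w) rfl (l := [p.conj, p.conj, a, s, t, r]) rfl
    (κ := -κ) (neg_ne_zero.2 hκ) (by
      have : lines [p.conj, p.conj, a, s, t, r]
          = p.line * p.line * (X - C θ) * (s'.line * t'.line * r'.line) := by
        simp only [lines, List.map_cons, List.map_nil, List.prod_cons, List.prod_nil,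
          CurvePoint.line_conj, hal, hs2, ht2, hr2]
        ring
      rw [this, C_neg]
      change (-M) ^ 2 - F * 1 ^ 2 = _
      rw [hlin] at hFM
      linear_combination -hFM) (by
      simp only [List.mem_cons, List.not_mem_nil, or_false]
      rintro q (rfl | rfl | rfl | rfl | rfl | rfl)
      · exact hon _ (by simp [hMp])
      · exact hon _ (by simp [hMp])
      · refine hon _ ?_
        rw [ha, xCoord_weierstrassPoint, zCoord_weierstrassPoint, yCoord_weierstrassPoint,
          ← eval_eq_cubic hM, hMθ]
      · exact hon _ hs3
      · exact hon _ ht3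
      · exact hon _ hr3)
  refine ⟨0, w, .ofPoly (lines [p, p, a]) (natDegree_lines_le _), hw0,
    CurveForm.isNonzero_ofPoly _ (lines_ne_zero _), fun P => ?_⟩
  rw [CurveForm.ord_ofPoly_lines hF, hord, ha, conj_weierstrassPoint, ← ha]
  simp only [Finsupp.sub_apply, Finsupp.add_apply, CurvePoint.div_apply, List.map_cons,
    List.map_nil, List.sum_cons, List.sum_nil]
  push_cast
  ring

theorem IsSmoothSextic.exists_roots [IsAlgClosed K] (hF : IsSmoothSextic F) (θ : K) :
    ∃ α β : K, F.eval α = 0 ∧ F.eval β = 0 ∧ α ≠ θ ∧ β ≠ θ ∧ α ≠ β := by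
  classical
  have hn : F.natDegree = 6 := le_antisymm hF.natDegree_le (le_natDegree_of_ne_zero hF.coeff_six)
  have hc : F.roots.toFinset.card = 6 := by
    rw [Multiset.toFinset_card_of_nodup (nodup_roots hF.separable),
      splits_iff_card_roots.1 (IsAlgClosed.splits F), hn]
  have h1 : 1 < (F.roots.toFinset.erase θ).card := by
    have := Finset.pred_card_le_card_erase (s := F.roots.toFinset) (a := θ)
    omega
  obtain ⟨α, β, hα, hβ, hne⟩ := Finset.one_lt_card_iff.1 h1
  rw [Finset.mem_erase, Multiset.mem_toFinset, mem_roots hF.ne_zero] at hα hβ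
  exact ⟨α, β, hα.2, hβ.2, hα.1, hβ.1, hne⟩

/-- The points of the classes `[p + q + a - r]` span a plane. -/
theorem exists_linearIndependent_translates [IsAlgClosed K] (hF : IsSmoothSextic F) {θ : K}
    (hθ : F.eval θ = 0) (p q : CurvePoint F) :
    ∃ v : Fin 3 → Fin 4 → K, LinearIndependent K v ∧ ∀ i, ∃ p' q' r s t : CurvePoint F,
      kummerVec p' q' = kummerVec p q ∧ v i = kummerVec s t ∧
      LinEquiv (s.div + t.div)
        (p'.div + q'.div + (weierstrassPoint F θ hθ).div - r.div) := by
  set a := weierstrassPoint F θ hθ with ha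
  have hac : a.conj = a := conj_weierstrassPoint θ hθ
  have haa : kummerVec a a = ![0, 0, 0, 1] := by
    have := kummerVec_conj_right_self a
    rwa [hac] at this
  have hdW : ∀ {α β : K} (hα : F.eval α = 0) (hβ : F.eval β = 0), α ≠ β →
      (weierstrassPoint F α hα).delta (weierstrassPoint F β hβ) ≠ 0 := by
    intro α β hα hβ h
    simpa [CurvePoint.delta] using sub_ne_zero.2 h
  obtain ⟨α, β, hα, hβ, hαθ, hβθ, hαβ⟩ := hF.exists_roots θ
  have hq0 : ∀ {s t P : CurvePoint F}, s.delta t ≠ 0 → P.delta s ≠ 0 → P.delta t ≠ 0 →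
      quadValue (kummerVec s t) P ≠ 0 := by
    intro s t P h h1 h2
    rw [quadValue_kummerVec (kummerVec_ne_of_delta h)]
    exact mul_ne_zero h1 h2
  have hql : ∀ {s t : CurvePoint F}, s.delta t ≠ 0 → quadValue (kummerVec s t) s = 0 := by
    intro s t h
    rw [quadValue_kummerVec (kummerVec_ne_of_delta h), s.delta_self, zero_mul]
  have hqr : ∀ {s t : CurvePoint F}, s.delta t ≠ 0 → quadValue (kummerVec s t) t = 0 := by
    intro s t h
    rw [quadValue_kummerVec (kummerVec_ne_of_delta h), t.delta_self, mul_zero]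
  by_cases hc : kummerVec p q = ![0, 0, 0, 1]
  · -- the canonical class
    set A := weierstrassPoint F α hα with hA
    set B := weierstrassPoint F β hβ with hB
    have hWW : ∀ {γ : K} (hγ : F.eval γ = 0),
        kummerVec (weierstrassPoint F γ hγ) (weierstrassPoint F γ hγ) = kummerVec p q := by
      intro γ hγ
      rw [hc, ← kummerVec_conj_right_self (weierstrassPoint F γ hγ), conj_weierstrassPoint]
    have hAa := hdW hα hθ hαθ
    have hBa := hdW hβ hθ hβθ
    have hAB := hdW hα hβ hαβ
    refine ⟨![kummerVec A a, kummerVec B a, ![0, 0, 0, 1]],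
      linearIndependent_of_quadValue_canonical (P := B) (Q := A)
        (hq0 hAa (CurvePoint.delta_ne_zero_comm hAB) hBa) (hql hBa)
        (hq0 hBa hAB hAa), fun i => ?_⟩
    fin_cases i
    · exact ⟨A, A, A, A, a, hWW hα, rfl, .of_eq (by abel)⟩
    · exact ⟨B, B, B, B, a, hWW hβ, rfl, .of_eq (by abel)⟩
    · exact ⟨a, a, a, a, a, hWW hθ, haa.symm, .of_eq (by abel)⟩
  have hroot : ∀ x : CurvePoint F, ∃ γ, ∃ hγ : F.eval γ = 0, γ ≠ θ ∧
      x.delta (weierstrassPoint F γ hγ) ≠ 0 := by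
    intro x
    by_cases h : x.delta (weierstrassPoint F α hα) = 0
    · refine ⟨β, hβ, hβθ, fun h' => hαβ ?_⟩
      obtain ⟨h1, h2⟩ := CurvePoint.coord_eq h
      obtain ⟨h3, h4⟩ := CurvePoint.coord_eq h'
      simpa using h1.symm.trans h3
    · exact ⟨α, hα, hαθ, h⟩
  -- one of the two points is the given Weierstrass point
  have hone : ∀ x : CurvePoint F, x.delta a ≠ 0 →
      ∃ v : Fin 3 → Fin 4 → K, LinearIndependent K v ∧ ∀ i, ∃ r s t : CurvePoint F,
        v i = kummerVec s t ∧ LinEquiv (s.div + t.div) (a.div + x.div + a.div - r.div) := by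
    intro x hx
    obtain ⟨γ, hγ, hγθ, hxγ⟩ := hroot x
    set G := weierstrassPoint F γ hγ with hG
    have hGa := hdW hγ hθ hγθ
    refine ⟨![kummerVec x G, kummerVec a x, ![0, 0, 0, 1]],
      linearIndependent_of_quadValue_canonical (P := a) (Q := G)
        (hq0 hxγ (CurvePoint.delta_ne_zero_comm hx) (CurvePoint.delta_ne_zero_comm hGa))
        (hql (CurvePoint.delta_ne_zero_comm hx))
        (hq0 (CurvePoint.delta_ne_zero_comm hx) hGa (CurvePoint.delta_ne_zero_comm hxγ)),
      fun i => ?_⟩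
    fin_cases i
    · exact ⟨G, x, G, rfl, linEquiv_weierstrass hF (conj_weierstrassPoint γ hγ) hac x⟩
    · exact ⟨a, a, x, rfl, .of_eq (by abel)⟩
    · exact ⟨x, a, a, haa.symm, .of_eq (by abel)⟩
  have heq : ∀ {x : CurvePoint F}, x.delta a = 0 → x = a := by
    intro x hx
    refine eq_weierstrassPoint hF.natDegree_le hθ ?_
    simp only [CurvePoint.delta, ha, xCoord_weierstrassPoint, zCoord_weierstrassPoint] at hx
    linear_combination -hx
  by_cases hp : p.delta a = 0
  · obtain rfl := heq hp
    have hq : q.delta a ≠ 0 := fun h => hc (by rw [heq h, haa])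
    obtain ⟨v, hv, h⟩ := hone q hq
    refine ⟨v, hv, fun i => ?_⟩
    obtain ⟨r, s, t, h1, h2⟩ := h i
    exact ⟨a, q, r, s, t, rfl, h1, h2⟩
  by_cases hq : q.delta a = 0
  · obtain rfl := heq hq
    obtain ⟨v, hv, h⟩ := hone p hp
    refine ⟨v, hv, fun i => ?_⟩
    obtain ⟨r, s, t, h1, h2⟩ := h i
    exact ⟨a, p, r, s, t, kummerVec_comm _ _, h1, h2⟩
  by_cases hpq : p.delta q = 0
  · -- twice a point
    obtain ⟨hx, hz⟩ := CurvePoint.coord_eq hpq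
    have hqp : q = p := by
      rcases CurvePoint.eq_or_eq_conj hF.natDegree_le hx.symm hz.symm with h | h
      · exact h
      · exact absurd (by rw [h, kummerVec_conj_right_self]) hc
    subst hqp
    have hy : q.yCoord ≠ 0 := by
      intro hy
      exact hc (kummerVec_of_canonical hpq (by rw [hy, neg_zero]))
    obtain ⟨r, s, t, hs, ht, hl⟩ := exists_linEquiv_double hF hθ hy hp
    have hap := CurvePoint.delta_ne_zero_comm hp
    have h1 : LinEquiv (q.div + q.div) (q.div + q.div + a.div - a.div) := .of_eq (by abel)
    have h2 : LinEquiv (q.div + a.div) (q.div + q.div + a.div - q.div) := .of_eq (by abel)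
    have e1 : ∀ P : CurvePoint F, quadValue (kummerVec q q) P = P.delta q * P.delta q :=
      quadValue_kummerVec hc
    obtain ⟨γ, hγ, hγθ, hqγ⟩ := hroot q
    have hγa := hdW hγ hθ hγθ
    have hγq := CurvePoint.delta_ne_zero_comm hqγ
    by_cases hst : kummerVec s t = ![0, 0, 0, 1]
    · refine ⟨![kummerVec q q, kummerVec q a, ![0, 0, 0, 1]],
        linearIndependent_of_quadValue_canonical (P := a) (by rw [e1]; exact mul_ne_zero hap hap)
          (hqr hp) (hq0 hp hγq hγa), fun i => ?_⟩
      fin_cases i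
      · exact ⟨q, q, a, q, q, rfl, rfl, h1⟩
      · exact ⟨q, q, q, q, a, rfl, rfl, h2⟩
      · exact ⟨q, q, r, s, t, rfl, hst.symm, hl⟩
    · refine ⟨![kummerVec s t, kummerVec q q, kummerVec q a],
        linearIndependent_of_quadValue (P := q) (Q := a)
          (by rw [quadValue_kummerVec hst]; exact mul_ne_zero hs ht) (by rw [e1, hpq, zero_mul])
          (by rw [e1]; exact mul_ne_zero hap hap) (hql hp) (hqr hp) (hq0 hp hγq hγa),
        fun i => ?_⟩
      fin_cases i
      · exact ⟨q, q, r, s, t, rfl, rfl, hl⟩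
      · exact ⟨q, q, a, q, q, rfl, rfl, h1⟩
      · exact ⟨q, q, q, q, a, rfl, rfl, h2⟩
  · have hqp := CurvePoint.delta_ne_zero_comm hpq
    refine ⟨![kummerVec p q, kummerVec p a, kummerVec q a],
      linearIndependent_of_quadValue (P := a) (Q := q) (R := p)
        (hq0 hpq (CurvePoint.delta_ne_zero_comm hp) (CurvePoint.delta_ne_zero_comm hq))
        (hqr hp) (hq0 hp hqp hq) (hqr hq) (hql hq) (hq0 hq hpq hp), fun i => ?_⟩
    fin_cases i
    · exact ⟨p, q, a, p, q, rfl, rfl, .of_eq (by abel)⟩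
    · exact ⟨p, q, q, p, a, rfl, rfl, .of_eq (by abel)⟩
    · exact ⟨p, q, p, q, a, rfl, rfl, .of_eq (by abel)⟩

end Uniqueness

/-! ### The quartic equation of the Kummer surface -/

section Surface

variable {K : Type*} [Field K] {F : K[X]}

theorem eval_derivative_of_natDegree_le (hF : F.natDegree ≤ 6) (x : K) :
    (derivative F).eval x = F.coeff 1 + 2 * F.coeff 2 * x + 3 * F.coeff 3 * x ^ 2
      + 4 * F.coeff 4 * x ^ 3 + 5 * F.coeff 5 * x ^ 4 + 6 * F.coeff 6 * x ^ 5 := by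
  conv_lhs => rw [eq_sum_of_natDegree_le hF]
  simp [Finset.sum_range_succ]
  ring

theorem eval_of_natDegree_le (hF : F.natDegree ≤ 6) (x : K) :
    F.eval x = F.coeff 0 + F.coeff 1 * x + F.coeff 2 * x ^ 2 + F.coeff 3 * x ^ 3
      + F.coeff 4 * x ^ 4 + F.coeff 5 * x ^ 5 + F.coeff 6 * x ^ 6 := by
  conv_lhs => rw [eq_sum_of_natDegree_le hF]
  simp [Finset.sum_range_succ]

/-- `K₂` is the square of the difference of the `X`-coordinates. -/
theorem quartic_kummer {R : Type*} [CommRing R] (f : ℕ → R) (x z u w d : R) :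
    quartic f ![z * w, x * w + u * z, x * u, d] = (x * w - u * z) ^ 2 * d ^ 2
      - 2 * formF0 f (z * w) (x * w + u * z) (x * u) * d
      + formK0 f (z * w) (x * w + u * z) (x * u) := by
  simp only [quartic, formK2, Matrix.cons_val_zero, Matrix.cons_val_one, Matrix.cons_val]
  ring

/-- At a double root of the binary quadratic form `(ξ₁, ξ₂, ξ₃)` over a root of `F`, the form `K₀`
is a square of the derivative. -/
theorem formK0_root (hF : IsSmoothSextic F) {x : K} (hx : F.eval x = 0) :
    formK0 F.coeff 1 (x + x) (x * x) ≠ 0 := by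
  have h : formK0 F.coeff 1 (x + x) (x * x) = (derivative F).eval x ^ 2 := by
    rw [eval_of_natDegree_le hF.natDegree_le] at hx
    rw [eval_derivative_of_natDegree_le hF.natDegree_le]
    have h0 : F.coeff 0 = -(F.coeff 1 * x + F.coeff 2 * x ^ 2 + F.coeff 3 * x ^ 3
      + F.coeff 4 * x ^ 4 + F.coeff 5 * x ^ 5 + F.coeff 6 * x ^ 6) := by linear_combination hx
    simp only [formK0, h0]
    ring
  rw [h]
  exact pow_ne_zero _ (hF.derivative_ne_zero hx)

/-- Over given `X`-coordinates the quartic has the two solutions `β₀` in `ξ₄`, which belong to the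
two choices of the sign of `Y` at the second point. -/
theorem exists_kummerVec_of_quartic (hF : IsSmoothSextic F) (p q : CurvePoint F) {d : K}
    (h : quartic F.coeff ![p.zCoord * q.zCoord, p.xCoord * q.zCoord + q.xCoord * p.zCoord,
      p.xCoord * q.xCoord, d] = 0) :
    ∃ q' : CurvePoint F, kummerVec p q' = ![p.zCoord * q.zCoord,
      p.xCoord * q.zCoord + q.xCoord * p.zCoord, p.xCoord * q.xCoord, d] := by
  have h2 := hF.two_ne_zero
  rw [quartic_kummer] at h
  have hrel := formF0_sq_sub F.coeff p.xCoord p.zCoord q.xCoord q.zCoord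
  rw [mul_assoc, ← p.sextic_eq hF.natDegree_le, ← q.sextic_eq hF.natDegree_le] at hrel
  by_cases hd : p.xCoord * q.zCoord - q.xCoord * p.zCoord = 0
  · obtain ⟨hx, hz⟩ := CurvePoint.coord_eq hd
    have hF0 := formF0_self F.coeff p.xCoord p.zCoord
    rw [← p.sextic_eq hF.natDegree_le] at hF0
    rw [← hx, ← hz, sub_self] at h
    rw [hF0] at h
    have hy : p.yCoord ≠ 0 := by
      intro hy
      cases p with
      | affine x y hxy =>
        obtain rfl : y = 0 := hy
        refine formK0_root hF (x := x) (by rw [← hxy]; ring) ?_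
        simp only [CurvePoint.xCoord, CurvePoint.zCoord, CurvePoint.yCoord] at h
        rw [mul_one, mul_one] at h
        linear_combination h
      | infinity s hs => exact hF.yCoord_infinity_ne_zero hs hy
    refine ⟨p, ?_⟩
    have hpp : p.yCoord ≠ -p.yCoord := fun h' => by
      have : 2 * p.yCoord = 0 := by linear_combination h'
      exact (mul_ne_zero h2 hy) this
    rw [kummerVec_of_double (sub_self _) hpp, ← hx, ← hz, hF0,
      show formK0 F.coeff (p.zCoord * p.zCoord) (p.xCoord * p.zCoord + p.xCoord * p.zCoord)
        (p.xCoord * p.xCoord) = 2 * (2 * p.yCoord ^ 2) * d by linear_combination h,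
      mul_div_cancel_left₀ _ (mul_ne_zero h2 (mul_ne_zero h2 (pow_ne_zero 2 hy)))]
  · have key : (formF0 F.coeff (p.zCoord * q.zCoord)
        (p.xCoord * q.zCoord + q.xCoord * p.zCoord) (p.xCoord * q.xCoord)
        - (p.xCoord * q.zCoord - q.xCoord * p.zCoord) ^ 2 * d) ^ 2
        = (2 * p.yCoord * q.yCoord) ^ 2 := by
      linear_combination hrel + (p.xCoord * q.zCoord - q.xCoord * p.zCoord) ^ 2 * h
    rcases sq_eq_sq_iff_eq_or_eq_neg.1 key with h1 | h1
    · refine ⟨q, ?_⟩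
      rw [kummerVec_of_ne hd, ← h1, sub_sub_cancel, mul_div_cancel_left₀ _ (pow_ne_zero 2 hd)]
    · refine ⟨q.conj, ?_⟩
      rw [kummerVec_of_ne (by simpa using hd)]
      simp only [CurvePoint.xCoord_conj, CurvePoint.zCoord_conj, CurvePoint.yCoord_conj]
      rw [mul_neg, ← h1, sub_sub_cancel, mul_div_cancel_left₀ _ (pow_ne_zero 2 hd)]

theorem exists_curvePoint [IsAlgClosed K] (x : K) : ∃ y, ∃ h : y ^ 2 = F.eval x,
    ∃ p : CurvePoint F, p = .affine x y h := by
  obtain ⟨y, hy⟩ := IsAlgClosed.exists_pow_nat_eq (F.eval x) (n := 2) two_pos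
  exact ⟨y, hy, _, rfl⟩

/-- Every zero of the Kummer quartic is the image of a divisor. -/
theorem exists_smul_kummerVec_of_quartic [IsAlgClosed K] (hF : IsSmoothSextic F) {ξ : Fin 4 → K}
    (hξ : ξ ≠ 0) (h : quartic F.coeff ξ = 0) :
    ∃ (p q : CurvePoint F) (κ : K), κ ≠ 0 ∧ ξ = κ • kummerVec p q := by
  set P : K[X] := C (ξ 0) * X ^ 2 - C (ξ 1) * X + C (ξ 2) with hP
  by_cases h0 : P = 0
  · obtain ⟨-, -, p, -⟩ := exists_curvePoint (F := F) 0
    have c0 : ξ 2 = 0 := by simpa [hP] using congrArg (coeff · 0) h0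
    have c1 : ξ 1 = 0 := by simpa [hP, coeff_X] using congrArg (coeff · 1) h0
    have c2 : ξ 0 = 0 := by simpa [hP, coeff_X] using congrArg (coeff · 2) h0
    have e : ξ = ξ 3 • kummerVec p p.conj := by
      rw [kummerVec_conj_right_self]
      funext j
      fin_cases j <;> simp [c0, c1, c2]
    refine ⟨p, p.conj, ξ 3, fun h3 => hξ ?_, e⟩
    rw [e, h3, zero_smul]
  · obtain ⟨l, κ, hl, hκ, e⟩ := exists_eq_lines F 2 (H := P) (by rw [hP]; compute_degree) h0
    obtain ⟨p, q, rfl⟩ := List.length_eq_two.1 hl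
    have e' : P = C κ * (p.line * q.line) := by rw [e]; simp [lines]
    rw [CurvePoint.line_mul_line, hP] at e'
    have c0 : ξ 2 = κ * (p.xCoord * q.xCoord) := by
      simpa using congrArg (coeff · 0) e'
    have c1 : ξ 1 = κ * (p.xCoord * q.zCoord + q.xCoord * p.zCoord) := by
      have := congrArg (coeff · 1) e'
      simp only [coeff_add, coeff_sub, coeff_C_mul, coeff_X_pow, coeff_X, coeff_C] at this
      norm_num at this
      linear_combination -this
    have c2 : ξ 0 = κ * (p.zCoord * q.zCoord) := by
      have := congrArg (coeff · 2) e'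
      simp only [coeff_add, coeff_sub, coeff_C_mul, coeff_X_pow, coeff_X, coeff_C] at this
      norm_num at this
      linear_combination this
    have e2 : ξ = κ • ![p.zCoord * q.zCoord, p.xCoord * q.zCoord + q.xCoord * p.zCoord,
        p.xCoord * q.xCoord, ξ 3 / κ] := by
      funext j
      fin_cases j
      · simpa using c2
      · simpa using c1
      · simpa using c0
      · simp; field_simp
    rw [e2, quartic_smul] at h
    obtain ⟨q', hq'⟩ := exists_kummerVec_of_quartic hF p q
      ((mul_eq_zero.1 h).resolve_left (pow_ne_zero _ hκ))
    exact ⟨p, q', κ, hκ, by rw [hq']; exact e2⟩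

theorem mk_mem_kummerSurface [IsAlgClosed K] (hF : IsSmoothSextic F) {ξ : Fin 4 → K}
    (hξ : ξ ≠ 0) (h : quartic F.coeff ξ = 0) : Projectivization.mk K ξ hξ ∈ kummerSurface F := by
  obtain ⟨p, q, κ, -, e⟩ := exists_smul_kummerVec_of_quartic hF hξ h
  exact ⟨p, q, (Projectivization.mk_eq_mk_iff' _ _ _ _ _).2 ⟨κ, e.symm⟩⟩

/-- A plane which is a multiple of the gradient at a nonzero point of the quartic is tangent. -/
theorem mk_mem_tangentPlanes [IsAlgClosed K] (hF : IsSmoothSextic F) {τ : Fin 4 → K}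
    (h : quartic F.coeff τ = 0) (hg : quarticGrad F.coeff τ ≠ 0) :
    Projectivization.mk K (quarticGrad F.coeff τ) hg ∈ tangentPlanes F := by
  have hτ : τ ≠ 0 := by
    rintro rfl
    apply hg
    rw [← zero_smul K (0 : Fin 4 → K), quarticGrad_smul]
    simp
  obtain ⟨t, ht⟩ := Projectivization.exists_smul_eq_mk_rep K τ hτ
  have e : kummerGradient F (Projectivization.mk K τ hτ).rep
      = (t : K) ^ 3 • quarticGrad F.coeff τ := by
    rw [kummerGradient_eq, ← ht, ← quarticGrad_smul]
    rfl
  have hne : kummerGradient F (Projectivization.mk K τ hτ).rep ≠ 0 := by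
    rw [e]
    exact smul_ne_zero (pow_ne_zero _ t.ne_zero) hg
  refine ⟨_, mk_mem_kummerSurface hF hτ h, hne, ?_⟩
  rw [Projectivization.mk_eq_mk_iff']
  exact ⟨((t : K) ^ 3)⁻¹, by rw [e, smul_smul, inv_mul_cancel₀ (pow_ne_zero _ t.ne_zero), one_smul]⟩

end Surface

/-! ### Density on the curve -/

section Density

variable {K : Type*} [Field K] {F : K[X]}

/-- The coordinate ring of an irreducible curve `Y² = E(X)` is a domain. -/
theorem elt_eq_zero_of_mul [IsAlgClosed K] {E : K[X]}
    (hE : ∀ A B : K[X], A ^ 2 = E * B ^ 2 → B = 0) {z w : AffineRing E} (h : z * w = 0) :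
    z = 0 ∨ w = 0 := by
  obtain ⟨A, B, rfl⟩ := exists_eq_elt z
  obtain ⟨A', B', rfl⟩ := exists_eq_elt w
  have hz : ∀ A B : K[X], A ^ 2 - E * B ^ 2 = 0 → elt E A B = 0 := by
    intro A B h0
    have hB := hE A B (sub_eq_zero.1 h0)
    rw [hB] at h0
    exact elt_eq_zero_iff.2 ⟨by simpa using h0, hB⟩
  have h1 : elt E A B * elt E A' B' * (elt E A (-B) * elt E A' (-B'))
      = elt E ((A ^ 2 - E * B ^ 2) * (A' ^ 2 - E * B' ^ 2)) 0 := by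
    simp only [elt_mul]
    congr 1 <;> ring
  rw [h, zero_mul] at h1
  have h2 := (elt_eq_zero_iff.1 h1.symm).1
  exact (mul_eq_zero.1 h2).imp (hz A B) (hz A' B')

theorem eq_zero_of_evalAt [IsAlgClosed K] (h2 : (2 : K) ≠ 0) {E : K[X]} (hE : E ≠ 0)
    {z : AffineRing E}
    (h : ∀ (x y : K) (hxy : y ^ 2 = E.eval x), evalAt hxy z = 0) : z = 0 := by
  obtain ⟨A, B, rfl⟩ := exists_eq_elt z
  have key : ∀ x, A.eval x = 0 ∧ (E * B ^ 2).eval x = 0 := by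
    intro x
    obtain ⟨y, hy⟩ := IsAlgClosed.exists_pow_nat_eq (E.eval x) (n := 2) two_pos
    have e1 := h x y hy
    have e2 := h x (-y) (by rw [neg_sq, hy])
    rw [evalAt_elt] at e1 e2
    have hA : A.eval x = 0 := by
      have : 2 * A.eval x = 0 := by linear_combination e1 + e2
      exact (mul_eq_zero.1 this).resolve_left h2
    refine ⟨hA, ?_⟩
    rw [eval_mul, eval_pow, ← hy]
    linear_combination (B.eval x * y) * e1 - B.eval x * y * hA
  have hA : A = 0 := Polynomial.funext fun x => by simpa using (key x).1
  have hB : E * B ^ 2 = 0 := Polynomial.funext fun x => by simpa using (key x).2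
  exact elt_eq_zero_iff.2 ⟨hA, by simpa [hE] using hB⟩

/-- On an irreducible curve `Y² = E(X)`, a polynomial function that vanishes wherever another one,
not identically zero, does not vanish, is zero. -/
theorem eval_eq_zero_of_mul [IsAlgClosed K] (h2 : (2 : K) ≠ 0) {E : K[X]}
    (hE : ∀ A B : K[X], A ^ 2 = E * B ^ 2 → B = 0) {σ : Type*} {g : σ → AffineRing E}
    {c : K → K → σ → K}
    (hg : ∀ (x y : K) (hxy : y ^ 2 = E.eval x) (i : σ), evalAt hxy (g i) = c x y i)
    {P Q : MvPolynomial σ K} (hQ : ∃ x y, y ^ 2 = E.eval x ∧ MvPolynomial.eval (c x y) Q ≠ 0)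
    (h : ∀ x y, y ^ 2 = E.eval x →
      MvPolynomial.eval (c x y) P * MvPolynomial.eval (c x y) Q = 0) :
    ∀ x y, y ^ 2 = E.eval x → MvPolynomial.eval (c x y) P = 0 := by
  have hE0 : E ≠ 0 := by
    rintro rfl
    exact one_ne_zero (hE 0 1 (by simp))
  set φ : MvPolynomial σ K → AffineRing E := MvPolynomial.eval₂
    ((AdjoinRoot.of ((X : K[X][X]) ^ 2 - C E)).comp C) g with hφ
  have hev : ∀ (x y : K) (hxy : y ^ 2 = E.eval x) (P : MvPolynomial σ K),
      evalAt hxy (φ P) = MvPolynomial.eval (c x y) P := by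
    intro x y hxy P
    have e1 : (evalAt hxy).comp ((AdjoinRoot.of ((X : K[X][X]) ^ 2 - C E)).comp C)
        = RingHom.id K := by
      ext a
      simp [evalAt_of]
    have e2 : (fun i => evalAt hxy (g i)) = c x y := funext (hg x y hxy)
    rw [hφ, MvPolynomial.hom_eval₂, e1, e2, MvPolynomial.eval₂_id]
  have hPQ : φ P * φ Q = 0 := eq_zero_of_evalAt h2 hE0 fun x y hxy => by
    rw [map_mul, hev, hev, h x y hxy]
  rcases elt_eq_zero_of_mul hE hPQ with h0 | h0
  · intro x y hxy
    rw [← hev x y hxy, h0, map_zero]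
  · obtain ⟨x, y, hxy, hne⟩ := hQ
    exact absurd (by rw [← hev x y hxy, h0, map_zero]) hne

theorem sextic_one_right (hF : F.natDegree ≤ 6) (x : K) : sextic F.coeff x 1 = F.eval x := by
  rw [eval_of_natDegree_le hF, sextic]
  ring

theorem sextic_one_left (hF : F.natDegree ≤ 6) (w : K) :
    sextic F.coeff 1 w = (F.reflect 6).eval w := by
  have h : (F.reflect 6).natDegree ≤ 6 := natDegree_reflect_le.trans (by simpa using hF)
  rw [eval_of_natDegree_le h, sextic]
  simp only [coeff_reflect]
  norm_num [revAt_le]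
  ring

theorem eval_eq_zero_of_mul_affine [IsAlgClosed K] (hF : IsSmoothSextic F)
    {P Q : MvPolynomial (Fin 3) K}
    (hQ : ∃ u v : K, v ^ 2 = F.eval u ∧ MvPolynomial.eval ![u, 1, v] Q ≠ 0)
    (h : ∀ u v : K, v ^ 2 = F.eval u →
      MvPolynomial.eval ![u, 1, v] P * MvPolynomial.eval ![u, 1, v] Q = 0) :
    ∀ u v : K, v ^ 2 = F.eval u → MvPolynomial.eval ![u, 1, v] P = 0 :=
  eval_eq_zero_of_mul hF.two_ne_zero hF.not_sq
    (g := ![AdjoinRoot.of _ X, 1, AdjoinRoot.root _]) (c := fun u v => ![u, 1, v])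
    (fun x y hxy i => by fin_cases i <;> simp [evalAt_of, evalAt_root]) hQ h

theorem eval_eq_zero_of_mul_infinity [IsAlgClosed K] (hF : IsSmoothSextic F)
    {P Q : MvPolynomial (Fin 3) K}
    (hQ : ∃ w v : K, v ^ 2 = sextic F.coeff 1 w ∧ MvPolynomial.eval ![1, w, v] Q ≠ 0)
    (h : ∀ w v : K, v ^ 2 = sextic F.coeff 1 w →
      MvPolynomial.eval ![1, w, v] P * MvPolynomial.eval ![1, w, v] Q = 0) :
    ∀ w v : K, v ^ 2 = sextic F.coeff 1 w → MvPolynomial.eval ![1, w, v] P = 0 := by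
  simp only [sextic_one_left hF.natDegree_le] at hQ h ⊢
  exact eval_eq_zero_of_mul hF.two_ne_zero hF.not_sq_reflect
    (g := ![1, AdjoinRoot.of _ X, AdjoinRoot.root _]) (c := fun w v => ![1, w, v])
    (fun x y hxy i => by fin_cases i <;> simp [evalAt_of, evalAt_root]) hQ h

theorem exists_point_eval_ne_zero [IsAlgClosed K] (E : K[X]) {R : K[X]} (hR : R ≠ 0) :
    ∃ u v : K, v ^ 2 = E.eval u ∧ R.eval u ≠ 0 := by
  obtain ⟨u, hu⟩ : ∃ u, R.eval u ≠ 0 := by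
    by_contra! h
    exact hR (Polynomial.funext fun u => by simpa using h u)
  obtain ⟨v, hv⟩ := IsAlgClosed.exists_pow_nat_eq (E.eval u) (n := 2) two_pos
  exact ⟨u, v, hv, hu⟩

/-- A polynomial in the weighted homogeneous coordinates of the curve vanishes on both charts if it
does so off the zeros of a polynomial which is not identically zero on either of them. -/
theorem eval_eq_zero_on_charts [IsAlgClosed K] (hF : IsSmoothSextic F)
    {P Q : MvPolynomial (Fin 3) K}
    (hQ : ∃ u v : K, v ^ 2 = F.eval u ∧ MvPolynomial.eval ![u, 1, v] Q ≠ 0)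
    (hQ' : ∃ w v : K, v ^ 2 = (F.reflect 6).eval w ∧ MvPolynomial.eval ![1, w, v] Q ≠ 0)
    (h : ∀ u w v : K, (w = 1 ∨ u = 1) → v ^ 2 = sextic F.coeff u w →
      MvPolynomial.eval ![u, w, v] Q ≠ 0 → MvPolynomial.eval ![u, w, v] P = 0) :
    ∀ u w v : K, (w = 1 ∨ u = 1) → v ^ 2 = sextic F.coeff u w →
      MvPolynomial.eval ![u, w, v] P = 0 := by
  have h' : ∀ u w v : K, (w = 1 ∨ u = 1) → v ^ 2 = sextic F.coeff u w →
      MvPolynomial.eval ![u, w, v] P * MvPolynomial.eval ![u, w, v] Q = 0 := by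
    intro u w v hc hv
    by_cases h0 : MvPolynomial.eval ![u, w, v] Q = 0
    · rw [h0, mul_zero]
    · rw [h u w v hc hv h0, zero_mul]
  rintro u w v (rfl | rfl) hv
  · refine eval_eq_zero_of_mul_affine hF hQ (fun u v hv => h' u 1 v (.inl rfl) ?_) u v ?_
    · rw [hv, sextic_one_right hF.natDegree_le]
    · rw [hv, sextic_one_right hF.natDegree_le]
  · simp only [← sextic_one_left hF.natDegree_le] at hQ'
    exact eval_eq_zero_of_mul_infinity hF hQ' (fun w v hv => h' 1 w v (.inr rfl) hv) w v hv

end Density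

/-! ### The polar planes lie on the dual surface -/

/-- Kummer coordinates of a pair of points, multiplied by `K₂ = (x w - u z)²`: a polynomial in the
coordinates, which is nonzero also at conjugate pairs. -/
def kummerForm {R : Type*} [CommRing R] (f : ℕ → R) (x z y u w v : R) : Fin 4 → R :=
  ![(x * w - u * z) ^ 2 * (z * w), (x * w - u * z) ^ 2 * (x * w + u * z),
    (x * w - u * z) ^ 2 * (x * u), formF0 f (z * w) (x * w + u * z) (x * u) - 2 * y * v]

/-- Another multiple of the Kummer coordinates of a pair of points, which is nonzero at pairs of
equal points. -/
def kummerFormDouble {R : Type*} [CommRing R] (f : ℕ → R) (x z y u w v : R) : Fin 4 → R :=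
  let s := formF0 f (z * w) (x * w + u * z) (x * u) + 2 * y * v
  ![s * (z * w), s * (x * w + u * z), s * (x * u), formK0 f (z * w) (x * w + u * z) (x * u)]

/-- The gradient of the quartic at `(D a, D b, D c, d)`, divided by `D`. -/
def reducedGrad {R : Type*} [CommRing R] (f : ℕ → R) (D a b c d : R) : Fin 4 → R :=
  ![-4 * c * d ^ 2
      - 2 * D * d * (6 * f 0 * a ^ 2 + 2 * f 1 * a * b + 4 * f 2 * a * c + f 3 * b * c
        + 2 * f 4 * c ^ 2) + D ^ 2 * quarticGrad f ![a, b, c, 0] 0,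
    2 * b * d ^ 2 - 2 * D * d * (f 1 * a ^ 2 + f 3 * a * c + f 5 * c ^ 2)
      + D ^ 2 * quarticGrad f ![a, b, c, 0] 1,
    -4 * a * d ^ 2
      - 2 * D * d * (2 * f 2 * a ^ 2 + f 3 * a * b + 4 * f 4 * a * c + 2 * f 5 * b * c
        + 6 * f 6 * c ^ 2) + D ^ 2 * quarticGrad f ![a, b, c, 0] 2,
    2 * D * formK2 a b c * d - 2 * D ^ 2 * formF0 f a b c]

theorem quarticGrad_eq_reducedGrad {R : Type*} [CommRing R] (f : ℕ → R) (D a b c d : R) :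
    quarticGrad f ![D * a, D * b, D * c, d] = D • reducedGrad f D a b c d := by
  funext j
  fin_cases j <;>
  · simp [reducedGrad, quarticGrad, formF0, formK2]
    ring

theorem map_polar {R S : Type*} [CommRing R] [CommRing S] (φ : R →+* S) (f : ℕ → R) (θ : R)
    (ξ : Fin 4 → R) (i : Fin 4) :
    φ (polar f θ ξ i) = polar (fun j => φ (f j)) (φ θ) (fun j => φ (ξ j)) i := by
  fin_cases i <;> simp [polar, map_ofNat]

theorem map_pole {R S : Type*} [CommRing R] [CommRing S] (φ : R →+* S) (f : ℕ → R) (θ : R)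
    (ξ : Fin 4 → R) (i : Fin 4) :
    φ (pole f θ ξ i) = pole (fun j => φ (f j)) (φ θ) (fun j => φ (ξ j)) i := by
  fin_cases i <;> simp [pole, map_ofNat]

theorem map_quarticGrad {R S : Type*} [CommRing R] [CommRing S] (φ : R →+* S) (f : ℕ → R)
    (ξ : Fin 4 → R) (i : Fin 4) :
    φ (quarticGrad f ξ i) = quarticGrad (fun j => φ (f j)) (fun j => φ (ξ j)) i := by
  fin_cases i <;> simp [quarticGrad, formK2, formF0, map_ofNat]

theorem map_reducedGrad {R S : Type*} [CommRing R] [CommRing S] (φ : R →+* S) (f : ℕ → R)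
    (D a b c d : R) (i : Fin 4) :
    φ (reducedGrad f D a b c d i) = reducedGrad (fun j => φ (f j)) (φ D) (φ a) (φ b) (φ c) (φ d) i
    := by
  have e : (fun j => φ (![a, b, c, 0] j)) = ![φ a, φ b, φ c, 0] := by
    funext j; fin_cases j <;> simp
  fin_cases i <;> simp [reducedGrad, map_quarticGrad, e, formK2, formF0, map_ofNat]

theorem map_kummerForm {R S : Type*} [CommRing R] [CommRing S] (φ : R →+* S) (f : ℕ → R)
    (x z y u w v : R) (i : Fin 4) :
    φ (kummerForm f x z y u w v i)
      = kummerForm (fun j => φ (f j)) (φ x) (φ z) (φ y) (φ u) (φ w) (φ v) i := by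
  fin_cases i <;> simp [kummerForm, formF0, map_ofNat]

theorem map_kummerFormDouble {R S : Type*} [CommRing R] [CommRing S] (φ : R →+* S) (f : ℕ → R)
    (x z y u w v : R) (i : Fin 4) :
    φ (kummerFormDouble f x z y u w v i)
      = kummerFormDouble (fun j => φ (f j)) (φ x) (φ z) (φ y) (φ u) (φ w) (φ v) i := by
  fin_cases i <;> simp [kummerFormDouble, formF0, formK0, map_ofNat]

theorem kummerForm_comm {R : Type*} [CommRing R] (f : ℕ → R) (x z y u w v : R) :
    kummerForm f x z y u w v = kummerForm f u w v x z y := by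
  funext j
  fin_cases j <;>
  · simp [kummerForm, formF0]
    ring

theorem kummerForm_weighted {R : Type*} [CommRing R] (f : ℕ → R) (x z y u w v t : R) :
    kummerForm f x z y (t * u) (t * w) (t ^ 3 * v) = t ^ 3 • kummerForm f x z y u w v := by
  funext j
  fin_cases j <;>
  · simp [kummerForm, formF0]
    ring

/-- The two representatives of the Kummer point are proportional, because of
`F₀² - 4 F(x) F(u) = K₂ K₀`. -/
theorem formF0_smul_kummerForm {R : Type*} [CommRing R] {f : ℕ → R} {x z y u w v : R}
    (hy : y ^ 2 = sextic f x z) (hv : v ^ 2 = sextic f u w) :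
    (formF0 f (z * w) (x * w + u * z) (x * u) + 2 * y * v) • kummerForm f x z y u w v
      = (x * w - u * z) ^ 2 • kummerFormDouble f x z y u w v := by
  have h := formF0_sq_sub f x z u w
  rw [mul_assoc, ← hy, ← hv] at h
  funext j
  fin_cases j
  · simp [kummerForm, kummerFormDouble]; ring
  · simp [kummerForm, kummerFormDouble]; ring
  · simp [kummerForm, kummerFormDouble]; ring
  · simp [kummerForm, kummerFormDouble]
    linear_combination h

section Dual

variable {K : Type*} [Field K] {F : K[X]}

theorem eval_smul_of_isHomogeneous {G : MvPolynomial (Fin 4) K} {n : ℕ} (hG : G.IsHomogeneous n)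
    (c : K) (v : Fin 4 → K) :
    MvPolynomial.eval (c • v) G = c ^ n * MvPolynomial.eval v G := by
  rw [MvPolynomial.eval_eq', MvPolynomial.eval_eq', Finset.mul_sum]
  refine Finset.sum_congr rfl fun d hd => ?_
  have h : ∑ i, d i = n := by
    have h1 := hG (MvPolynomial.mem_support_iff.1 hd)
    rw [← h1, Finsupp.weight_apply, Finsupp.sum_fintype _ _ (by simp)]
    simp
  simp only [Pi.smul_apply, smul_eq_mul, mul_pow, Finset.prod_mul_distrib]
  rw [Finset.prod_pow_eq_pow_sum, h]
  ring

theorem eval_smul_eq_zero_iff {G : MvPolynomial (Fin 4) K} {n : ℕ} (hG : G.IsHomogeneous n)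
    {c : K} (hc : c ≠ 0) (v : Fin 4 → K) :
    MvPolynomial.eval (c • v) G = 0 ↔ MvPolynomial.eval v G = 0 := by
  rw [eval_smul_of_isHomogeneous hG]
  simp [hc]

theorem eval_rep_eq_zero_iff {G : MvPolynomial (Fin 4) K} {n : ℕ} (hG : G.IsHomogeneous n)
    {v : Fin 4 → K} (hv : v ≠ 0) :
    MvPolynomial.eval (Projectivization.mk K v hv).rep G = 0 ↔ MvPolynomial.eval v G = 0 := by
  obtain ⟨t, ht⟩ := Projectivization.exists_smul_eq_mk_rep K v hv
  rw [← ht]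
  exact eval_smul_eq_zero_iff hG t.ne_zero v

theorem kummerForm_eq_smul {R : Type*} [Field R] {f : ℕ → R} {x z y u w v : R}
    (hd : x * w - u * z ≠ 0) :
    kummerForm f x z y u w v = (x * w - u * z) ^ 2 • ![z * w, x * w + u * z, x * u,
      (formF0 f (z * w) (x * w + u * z) (x * u) - 2 * y * v) / (x * w - u * z) ^ 2] := by
  funext j
  fin_cases j
  · simp [kummerForm]
  · simp [kummerForm]
  · simp [kummerForm]
  · simp [kummerForm]
    rw [mul_div_cancel₀ _ (pow_ne_zero 2 hd)]

/-- At a generic class the polar plane is a tangent plane. -/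
theorem eval_polar_of_reducedGrad_ne_zero [IsAlgClosed K] (hF : IsSmoothSextic F) {θ : K}
    (hθ : F.eval θ = 0) {G : MvPolynomial (Fin 4) K} {n : ℕ} (hG : G.IsHomogeneous n)
    (hGt : ∀ τ ∈ tangentPlanes F, MvPolynomial.eval τ.rep G = 0) {x y u v : K}
    (hy : y ^ 2 = F.eval x) (hv : v ^ 2 = F.eval u) (hxu : x ≠ u) (hxθ : x ≠ θ) (huθ : u ≠ θ)
    (hN : quarticGrad F.coeff (pole F.coeff θ (reducedGrad F.coeff ((x * 1 - u * 1) ^ 2) (1 * 1)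
      (x * 1 + u * 1) (x * u) (formF0 F.coeff (1 * 1) (x * 1 + u * 1) (x * u) - 2 * y * v))) 2
        ≠ 0) :
    MvPolynomial.eval (polar F.coeff θ (kummerForm F.coeff x 1 y u 1 v)) G = 0 := by
  have hd : x * 1 - u * 1 ≠ 0 := by simpa using sub_ne_zero.2 hxu
  have hform := kummerForm_eq_smul (f := F.coeff) (y := y) (v := v) hd
  set ξ := kummerForm F.coeff x 1 y u 1 v with hξ
  set D := (x * 1 - u * 1) ^ 2 with hD
  have hD0 : D ≠ 0 := pow_ne_zero _ hd
  set g := reducedGrad F.coeff D (1 * 1) (x * 1 + u * 1) (x * u)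
    (formF0 F.coeff (1 * 1) (x * 1 + u * 1) (x * u) - 2 * y * v) with hg
  set d := (formF0 F.coeff (1 * 1) (x * 1 + u * 1) (x * u) - 2 * y * v) / D with hd'
  have hQ : quartic F.coeff ![1, x + u, x * u, d] = 0 := by
    have h := formF0_sq_sub F.coeff x 1 u 1
    rw [mul_assoc, sextic_one_right hF.natDegree_le, sextic_one_right hF.natDegree_le, ← hy,
      ← hv, ← hD] at h
    have h1 := quartic_kummer F.coeff x 1 u 1 d
    have hdD : D * d = formF0 F.coeff (1 * 1) (x * 1 + u * 1) (x * u) - 2 * y * v := by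
      rw [hd']; field_simp
    have h2 : D * quartic F.coeff ![1 * 1, x * 1 + u * 1, x * u, d] = 0 := by
      rw [h1]
      linear_combination (D * d - formF0 F.coeff (1 * 1) (x * 1 + u * 1) (x * u)
        - 2 * y * v) * hdD - h
    have h3 := (mul_eq_zero.1 h2).resolve_left hD0
    simpa only [mul_one] using h3
  obtain ⟨hτ0, h, hτ⟩ := (polarIsTangent_of_ne (f := F.coeff) (by
    rw [← hθ, eval_of_natDegree_le hF.natDegree_le]) hxu hxθ huθ hQ).smul D
  have hξ' : D • ![1, x + u, x * u, d] = ξ := by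
    rw [hform]
    simp only [mul_one]
  have hgrad : quarticGrad F.coeff ξ = D • g := by
    rw [hg, ← quarticGrad_eq_reducedGrad]
    rfl
  rw [hξ', hgrad, pole_smul, quartic_smul] at hτ0
  rw [hξ', hgrad, pole_smul, quarticGrad_smul] at hτ
  replace hτ0 := (mul_eq_zero.1 hτ0).resolve_left (pow_ne_zero _ hD0)
  have hne : quarticGrad F.coeff (pole F.coeff θ g) ≠ 0 := fun h0 => hN (congrFun h0 2)
  have hval := (eval_rep_eq_zero_iff hG hne).1 (hGt _ (mk_mem_tangentPlanes hF hτ0 hne))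
  rw [← eval_smul_eq_zero_iff hG (pow_ne_zero 3 hD0), hτ] at hval
  refine (eval_smul_eq_zero_iff hG ?_ _).1 hval
  rintro rfl
  rw [zero_smul] at hτ
  exact hne ((smul_eq_zero.1 hτ).resolve_left (pow_ne_zero _ hD0))

/-- At a pair of conjugate points the reduced gradient is a trope, and the polar plane is tangent
there. -/
theorem quarticGrad_pole_reducedGrad_conj (hF : IsSmoothSextic F) {θ : K} (hθ : F.eval θ = 0)
    {x y : K} (hy : y ^ 2 = F.eval x) (hy0 : y ≠ 0) :
    quarticGrad F.coeff (pole F.coeff θ (reducedGrad F.coeff ((x * 1 - x * 1) ^ 2) (1 * 1)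
      (x * 1 + x * 1) (x * x)
        (formF0 F.coeff (1 * 1) (x * 1 + x * 1) (x * x) - 2 * y * (-y)))) 2 ≠ 0 := by
  have h2 := hF.two_ne_zero
  have e0 : formF0 F.coeff (1 * 1) (x * 1 + x * 1) (x * x) - 2 * y * (-y) = 4 * y ^ 2 := by
    rw [formF0_self, sextic_one_right hF.natDegree_le, ← hy]
    ring
  have e1 : reducedGrad F.coeff ((x * 1 - x * 1) ^ 2) (1 * 1) (x * 1 + x * 1) (x * x)
      (4 * y ^ 2) = (-64 * y ^ 4) • ![x ^ 2, -x, 1, 0] := by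
    funext j
    fin_cases j <;>
    · simp [reducedGrad]
      try ring
  have h4 : (4 : K) ≠ 0 := by
    rw [show (4 : K) = 2 * 2 by norm_num]
    exact mul_ne_zero h2 h2
  have h64 : (64 : K) ≠ 0 := by
    rw [show (64 : K) = 4 * 4 * 4 by norm_num]
    exact mul_ne_zero (mul_ne_zero h4 h4) h4
  rw [e0, e1, pole_smul, quarticGrad_smul, Pi.smul_apply, smul_eq_mul,
    quarticGrad_pole_trope F.coeff x (by rw [← hθ, eval_of_natDegree_le hF.natDegree_le]),
    ← eval_of_natDegree_le hF.natDegree_le, ← hy]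
  have hd := hF.derivative_ne_zero hθ
  rw [eval_derivative_of_natDegree_le hF.natDegree_le] at hd
  refine mul_ne_zero (pow_ne_zero _ (mul_ne_zero (neg_ne_zero.2 h64) (pow_ne_zero _ hy0)))
    (mul_ne_zero (mul_ne_zero h4 hd) (pow_ne_zero _ hy0))

/-- The value of `G` at the polar plane of a pair of points, as a polynomial in the coordinates of
the second point. -/
noncomputable def polarPoly (F : K[X]) (θ : K) (G : MvPolynomial (Fin 4) K) (x z y : K) :
    MvPolynomial (Fin 3) K :=
  MvPolynomial.aeval (polar (fun j => MvPolynomial.C (F.coeff j)) (MvPolynomial.C θ)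
    (kummerForm (fun j => MvPolynomial.C (F.coeff j)) (MvPolynomial.C x) (MvPolynomial.C z)
      (MvPolynomial.C y) (MvPolynomial.X 0) (MvPolynomial.X 1) (MvPolynomial.X 2))) G

theorem eval_polarPoly (θ : K) (G : MvPolynomial (Fin 4) K) (x z y u w v : K) :
    MvPolynomial.eval ![u, w, v] (polarPoly F θ G x z y)
      = MvPolynomial.eval (polar F.coeff θ (kummerForm F.coeff x z y u w v)) G := by
  rw [polarPoly, MvPolynomial.map_aeval]
  have : (MvPolynomial.eval ![u, w, v]).comp (algebraMap K (MvPolynomial (Fin 3) K))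
      = RingHom.id K := by
    ext a
    simp [MvPolynomial.algebraMap_eq]
  rw [this, MvPolynomial.coe_eval₂Hom, MvPolynomial.eval₂_id]
  congr 2
  funext i
  simp only [map_polar, map_kummerForm, MvPolynomial.eval_C, MvPolynomial.eval_X]
  rfl

/-- As `polarPoly`, for `kummerFormDouble`. -/
noncomputable def polarPolyDouble (F : K[X]) (θ : K) (G : MvPolynomial (Fin 4) K) (x z y : K) :
    MvPolynomial (Fin 3) K :=
  MvPolynomial.aeval (polar (fun j => MvPolynomial.C (F.coeff j)) (MvPolynomial.C θ)
    (kummerFormDouble (fun j => MvPolynomial.C (F.coeff j)) (MvPolynomial.C x) (MvPolynomial.C z)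
      (MvPolynomial.C y) (MvPolynomial.X 0) (MvPolynomial.X 1) (MvPolynomial.X 2))) G

theorem eval_polarPolyDouble (θ : K) (G : MvPolynomial (Fin 4) K) (x z y u w v : K) :
    MvPolynomial.eval ![u, w, v] (polarPolyDouble F θ G x z y)
      = MvPolynomial.eval (polar F.coeff θ (kummerFormDouble F.coeff x z y u w v)) G := by
  rw [polarPolyDouble, MvPolynomial.map_aeval]
  have : (MvPolynomial.eval ![u, w, v]).comp (algebraMap K (MvPolynomial (Fin 3) K))
      = RingHom.id K := by
    ext a
    simp [MvPolynomial.algebraMap_eq]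
  rw [this, MvPolynomial.coe_eval₂Hom, MvPolynomial.eval₂_id]
  congr 2
  funext i
  simp only [map_polar, map_kummerFormDouble, MvPolynomial.eval_C, MvPolynomial.eval_X]
  rfl

/-- For a fixed first point, with `Y ≠ 0`, the tangency of the polar plane holds for all but
finitely many second points, since it does not degenerate at the conjugate of the first point. -/
theorem eval_polar_kummerForm_affine [IsAlgClosed K] (hF : IsSmoothSextic F) {θ : K}
    (hθ : F.eval θ = 0) {G : MvPolynomial (Fin 4) K} {n : ℕ} (hG : G.IsHomogeneous n)
    (hGt : ∀ τ ∈ tangentPlanes F, MvPolynomial.eval τ.rep G = 0) {x y : K}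
    (hy : y ^ 2 = F.eval x) (hy0 : y ≠ 0) (u v : K) (hv : v ^ 2 = F.eval u) :
    MvPolynomial.eval (polar F.coeff θ (kummerForm F.coeff x 1 y u 1 v)) G = 0 := by
  have hxθ : x ≠ θ := by
    rintro rfl
    rw [hθ] at hy
    exact hy0 (pow_eq_zero_iff two_ne_zero |>.1 hy)
  -- the polynomial which expresses that the construction of the tangent point degenerates
  let f' : ℕ → MvPolynomial (Fin 3) K := fun j => MvPolynomial.C (F.coeff j)
  let U : MvPolynomial (Fin 3) K := MvPolynomial.X 0
  let W : MvPolynomial (Fin 3) K := MvPolynomial.X 1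
  let V : MvPolynomial (Fin 3) K := MvPolynomial.X 2
  let x' : MvPolynomial (Fin 3) K := MvPolynomial.C x
  let y' : MvPolynomial (Fin 3) K := MvPolynomial.C y
  let N : MvPolynomial (Fin 3) K := quarticGrad f' (pole f' (MvPolynomial.C θ)
    (reducedGrad f' ((x' * W - U * 1) ^ 2) (1 * W) (x' * W + U * 1) (x' * U)
      (formF0 f' (1 * W) (x' * W + U * 1) (x' * U) - 2 * y' * V))) 2
  have hN : ∀ u v : K, MvPolynomial.eval ![u, 1, v] N
      = quarticGrad F.coeff (pole F.coeff θ (reducedGrad F.coeff ((x * 1 - u * 1) ^ 2) (1 * 1)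
      (x * 1 + u * 1) (x * u)
        (formF0 F.coeff (1 * 1) (x * 1 + u * 1) (x * u) - 2 * y * v))) 2 := by
    intro u v
    simp only [N, map_quarticGrad, map_pole, map_reducedGrad]
    simp [f', U, W, V, x', y', formF0, map_ofNat]
  let Q : MvPolynomial (Fin 3) K := (MvPolynomial.C x - MvPolynomial.X 0)
    * (MvPolynomial.X 0 - MvPolynomial.C θ)
  have hQ : ∀ u v : K, MvPolynomial.eval ![u, 1, v] Q = (x - u) * (u - θ) := by
    intro u v
    simp [Q]
  rw [← eval_polarPoly]
  refine eval_eq_zero_of_mul_affine hF (P := polarPoly F θ G x 1 y) (Q := Q) ?_ (fun u v hv => ?_)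
    u v hv
  · obtain ⟨u, v, hv, hu⟩ := exists_point_eval_ne_zero F
      (mul_ne_zero (X_sub_C_ne_zero x) (X_sub_C_ne_zero θ))
    refine ⟨u, v, hv, ?_⟩
    rw [hQ]
    intro h0
    apply hu
    simp only [eval_mul, eval_sub, eval_X, eval_C]
    linear_combination -h0
  · rw [← map_mul]
    refine eval_eq_zero_of_mul_affine hF (P := polarPoly F θ G x 1 y * Q) (Q := N)
      ⟨x, -y, by rw [neg_sq, hy], ?_⟩ (fun u v hv => ?_) u v hv
    · rw [hN]
      exact quarticGrad_pole_reducedGrad_conj hF hθ hy hy0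
    · rw [map_mul, hQ]
      by_cases hxu : x = u
      · rw [hxu]; ring
      by_cases huθ : u = θ
      · rw [huθ]; ring
      by_cases h0 : MvPolynomial.eval ![u, 1, v] N = 0
      · rw [h0, mul_zero]
      · rw [hN] at h0
        rw [eval_polarPoly, eval_polar_of_reducedGrad_ne_zero hF hθ hG hGt hy hv hxu hxθ huθ h0]
        ring

/-- Weighted homogeneity and density extend the vanishing to all second points, in both charts. -/
theorem eval_polar_kummerForm_extend [IsAlgClosed K] (hF : IsSmoothSextic F) {θ : K}
    {G : MvPolynomial (Fin 4) K} {n : ℕ} (hG : G.IsHomogeneous n) {x z y : K}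
    (h : ∀ u v : K, v ^ 2 = F.eval u → v ≠ 0 →
      MvPolynomial.eval (polar F.coeff θ (kummerForm F.coeff x z y u 1 v)) G = 0) :
    ∀ u w v : K, (w = 1 ∨ u = 1) → v ^ 2 = sextic F.coeff u w →
      MvPolynomial.eval (polar F.coeff θ (kummerForm F.coeff x z y u w v)) G = 0 := by
  simp only [← eval_polarPoly] at h ⊢
  have hsq : ∀ {E : K[X]} {a b : K}, b ^ 2 = E.eval a → E.eval a ≠ 0 → b ≠ 0 := by
    rintro E a b h1 h2 rfl
    exact h2 (by rw [← h1]; ring)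
  have hR : F.reflect 6 ≠ 0 := by simpa [reflect_eq_zero_iff] using hF.ne_zero
  refine eval_eq_zero_on_charts hF (Q := MvPolynomial.X 1 * MvPolynomial.X 2) ?_ ?_ ?_
  · obtain ⟨u, v, hv, hu⟩ := exists_point_eval_ne_zero F hF.ne_zero
    exact ⟨u, v, hv, by simpa using hsq hv hu⟩
  · obtain ⟨w, v, hv, hw⟩ := exists_point_eval_ne_zero (F.reflect 6) (mul_ne_zero X_ne_zero hR)
    rw [eval_mul, eval_X] at hw
    refine ⟨w, v, hv, ?_⟩
    simpa using ⟨left_ne_zero_of_mul hw, hsq hv (right_ne_zero_of_mul hw)⟩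
  · intro u w v hc hv hne
    have hwv : w ≠ 0 ∧ v ≠ 0 := by simpa using hne
    have hs : ∀ t : K, sextic F.coeff (t * u) (t * w) = t ^ 6 * sextic F.coeff u w := by
      intro t
      simp only [sextic]
      ring
    have h1 := h (w⁻¹ * u) (w⁻¹ ^ 3 * v) (by
      have h2 := hs w⁻¹
      rw [inv_mul_cancel₀ hwv.1, sextic_one_right hF.natDegree_le, ← hv] at h2
      rw [h2]
      ring) (mul_ne_zero (pow_ne_zero _ (inv_ne_zero hwv.1)) hwv.2)
    rw [eval_polarPoly] at h1 ⊢
    have h3 := kummerForm_weighted F.coeff x z y u w v w⁻¹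
    rw [inv_mul_cancel₀ hwv.1] at h3
    rw [h3, polar_smul] at h1
    exact (eval_smul_eq_zero_iff hG (pow_ne_zero _ (inv_ne_zero hwv.1)) _).1 h1

theorem eval_polar_kummerForm [IsAlgClosed K] (hF : IsSmoothSextic F) {θ : K}
    (hθ : F.eval θ = 0) {G : MvPolynomial (Fin 4) K} {n : ℕ} (hG : G.IsHomogeneous n)
    (hGt : ∀ τ ∈ tangentPlanes F, MvPolynomial.eval τ.rep G = 0) {x z y u w v : K}
    (hx : z = 1 ∨ x = 1) (hy : y ^ 2 = sextic F.coeff x z)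
    (hu : w = 1 ∨ u = 1) (hv : v ^ 2 = sextic F.coeff u w) :
    MvPolynomial.eval (polar F.coeff θ (kummerForm F.coeff x z y u w v)) G = 0 := by
  refine eval_polar_kummerForm_extend hF hG (fun u v hv _ => ?_) u w v hu hv
  rw [kummerForm_comm]
  refine eval_polar_kummerForm_extend hF hG (fun x y hy hy0 => ?_) x z y hx hy
  rw [kummerForm_comm]
  exact eval_polar_kummerForm_affine hF hθ hG hGt hy hy0 u v hv

/-- `kummerForm` vanishes at pairs of equal points, the proportional `kummerFormDouble` does not;
the vanishing of the form passes to the latter by density in the second point. -/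
theorem eval_polar_kummerFormDouble [IsAlgClosed K] (hF : IsSmoothSextic F) {θ : K}
    (hθ : F.eval θ = 0) {G : MvPolynomial (Fin 4) K} {n : ℕ} (hG : G.IsHomogeneous n)
    (hGt : ∀ τ ∈ tangentPlanes F, MvPolynomial.eval τ.rep G = 0) {x z y : K}
    (hx : z = 1 ∨ x = 1) (hy : y ^ 2 = sextic F.coeff x z) :
    ∀ u w v : K, (w = 1 ∨ u = 1) → v ^ 2 = sextic F.coeff u w →
      MvPolynomial.eval (polar F.coeff θ (kummerFormDouble F.coeff x z y u w v)) G = 0 := by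
  simp only [← eval_polarPolyDouble]
  have hxz : x ≠ 0 ∨ z ≠ 0 := by
    rcases hx with rfl | rfl
    · exact .inr one_ne_zero
    · exact .inl one_ne_zero
  refine eval_eq_zero_on_charts hF
    (Q := MvPolynomial.C x * MvPolynomial.X 1 - MvPolynomial.X 0 * MvPolynomial.C z) ?_ ?_ ?_
  · have hR : (C x - X * C z : K[X]) ≠ 0 := by
      intro h0
      have c0 : x = 0 := by simpa using congrArg (coeff · 0) h0
      have c1 : z = 0 := by simpa [coeff_C] using congrArg (coeff · 1) h0
      exact hxz.elim (· c0) (· c1)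
    obtain ⟨u, v, hv, hu⟩ := exists_point_eval_ne_zero F hR
    refine ⟨u, v, hv, fun h0 => hu ?_⟩
    rw [eval_sub, eval_mul, eval_C, eval_X, eval_C]
    simpa using h0
  · have hR : (C x * X - C z : K[X]) ≠ 0 := by
      intro h0
      have c0 : z = 0 := by simpa using congrArg (coeff · 0) h0
      have c1 : x = 0 := by simpa [coeff_C] using congrArg (coeff · 1) h0
      exact hxz.elim (· c1) (· c0)
    obtain ⟨w, v, hv, hw⟩ := exists_point_eval_ne_zero (F.reflect 6) hR
    exact ⟨w, v, hv, by simpa using hw⟩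
  · intro u w v hu hv hne
    have hd : x * w - u * z ≠ 0 := by simpa using hne
    rw [eval_polarPolyDouble, ← eval_smul_eq_zero_iff hG (pow_ne_zero 2 hd), ← polar_smul,
      ← formF0_smul_kummerForm hy hv, polar_smul, eval_smul_of_isHomogeneous hG,
      eval_polar_kummerForm hF hθ hG hGt hx hy hu hv, mul_zero]

theorem CurvePoint.chart_cases (p : CurvePoint F) : p.zCoord = 1 ∨ p.xCoord = 1 := by
  cases p
  · exact .inl rfl
  · exact .inr rfl

/-- A form that vanishes on all tangent planes vanishes on all polar planes. -/
theorem eval_polar_kummerVec [IsAlgClosed K] (hF : IsSmoothSextic F) {θ : K}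
    (hθ : F.eval θ = 0) {G : MvPolynomial (Fin 4) K} {n : ℕ} (hG : G.IsHomogeneous n)
    (hGt : ∀ τ ∈ tangentPlanes F, MvPolynomial.eval τ.rep G = 0) (p q : CurvePoint F) :
    MvPolynomial.eval (polar F.coeff θ (kummerVec p q)) G = 0 := by
  have h2 := hF.two_ne_zero
  have h4 : (4 : K) ≠ 0 := by
    rw [show (4 : K) = 2 * 2 by norm_num]
    exact mul_ne_zero h2 h2
  by_cases hd : p.xCoord * q.zCoord - q.xCoord * p.zCoord = 0
  · obtain ⟨hx, hz⟩ := CurvePoint.coord_eq hd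
    by_cases hc : kummerVec p q = ![0, 0, 0, 1]
    · -- the canonical point is also the point of any other pair of conjugate points
      obtain ⟨x, y, hy, hx0⟩ := exists_point_eval_ne_zero F hF.ne_zero
      have hy0 : y ≠ 0 := by
        rintro rfl
        exact hx0 (by rw [← hy]; ring)
      have hsx : y ^ 2 = sextic F.coeff x 1 := by rw [sextic_one_right hF.natDegree_le, hy]
      have h := eval_polar_kummerForm hF hθ hG hGt (.inl rfl) hsx (.inl rfl)
        (show (-y) ^ 2 = sextic F.coeff x 1 by rw [neg_sq, hsx])
      have e : kummerForm F.coeff x 1 y x 1 (-y) = (4 * y ^ 2) • ![0, 0, 0, 1] := by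
        funext j
        fin_cases j
        · simp [kummerForm]
        · simp [kummerForm]
        · simp [kummerForm]
        · simp only [kummerForm, formF0_self, ← hsx]
          simp
          ring
      rw [e, polar_smul, eval_smul_eq_zero_iff hG (mul_ne_zero h4 (pow_ne_zero 2 hy0))] at h
      rw [hc]
      exact h
    · have hqp : q = p := by
        rcases CurvePoint.eq_or_eq_conj hF.natDegree_le hx.symm hz.symm with h | h
        · exact h
        · exact absurd (by rw [h, kummerVec_conj_right_self]) hc
      subst hqp
      have hyy : q.yCoord ≠ -q.yCoord := fun h => hc (kummerVec_of_canonical hd h)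
      have hy : q.yCoord ≠ 0 := fun h => hyy (by rw [h, neg_zero])
      have hs := q.sextic_eq hF.natDegree_le
      have h := eval_polar_kummerFormDouble hF hθ hG hGt q.chart_cases hs _ _ _ q.chart_cases hs
      have e : kummerFormDouble F.coeff q.xCoord q.zCoord q.yCoord q.xCoord q.zCoord q.yCoord
          = (4 * q.yCoord ^ 2) • kummerVec q q := by
        rw [kummerVec_of_double hd hyy]
        have hF0 := formF0_self F.coeff q.xCoord q.zCoord
        rw [← hs] at hF0
        have e4 : 2 * q.yCoord ^ 2 + 2 * q.yCoord * q.yCoord = 4 * q.yCoord ^ 2 := by ring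
        simp only [kummerFormDouble, hF0, e4]
        funext j
        fin_cases j
        · simp
        · simp
        · simp
        · simp
          field_simp
          ring
      rw [e, polar_smul, eval_smul_eq_zero_iff hG (mul_ne_zero h4 (pow_ne_zero 2 hy))] at h
      exact h
  · have h := eval_polar_kummerForm hF hθ hG hGt p.chart_cases (p.sextic_eq hF.natDegree_le)
      q.chart_cases (q.sextic_eq hF.natDegree_le)
    rw [kummerForm_eq_smul hd, ← kummerVec_of_ne hd, polar_smul,
      eval_smul_eq_zero_iff hG (pow_ne_zero 2 hd)] at h
    exact h

theorem mk_polar_mem_dualKummerSurface [IsAlgClosed K] (hF : IsSmoothSextic F) {θ : K}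
    (hθ : F.eval θ = 0) (p q : CurvePoint F) (h : polar F.coeff θ (kummerVec p q) ≠ 0) :
    Projectivization.mk K _ h ∈ dualKummerSurface F := fun _ _ hG hGt =>
  (eval_rep_eq_zero_iff hG h).2 (eval_polar_kummerVec hF hθ hG hGt p q)

end Dual

end GenusTwo

/-! ### The map induced by the Weierstrass point -/

theorem lemma4p11 {k kbar : Type*} [Field k] [Field kbar] [Algebra k kbar] [IsAlgClosure k kbar]
    (h2 : (2 : k) ≠ 0) (F₀ : k[X]) (hdeg : F₀.natDegree = 6) (hmonic : F₀.Monic)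
    (hsep : F₀.Separable) (F : kbar[X]) (hF : F = F₀.map (algebraMap k kbar))
    (hroots : ∀ x : kbar, F.eval x = 0 → x ≠ 0) (θ : kbar) (hθ : F.eval θ = 0) :
    (GenusTwo.weierstrassMatrix F θ).transpose = -GenusTwo.weierstrassMatrix F θ ∧
    ∃ W : GenusTwo.kummerSurface F → GenusTwo.dualKummerSurface F,
      GenusTwo.IsInducedByAddition (GenusTwo.weierstrassPoint F θ hθ) W ∧
      (∀ W' : GenusTwo.kummerSurface F → GenusTwo.dualKummerSurface F,
        GenusTwo.IsInducedByAddition (GenusTwo.weierstrassPoint F θ hθ) W' → W' = W) ∧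
      ∃ hA : Function.Injective (GenusTwo.weierstrassMatrix F θ).mulVecLin,
        ∀ ξ : GenusTwo.kummerSurface F,
          (W ξ : ℙ kbar (Fin 4 → kbar)) =
            Projectivization.map (GenusTwo.weierstrassMatrix F θ).mulVecLin hA
              (ξ : ℙ kbar (Fin 4 → kbar)) := by
  open GenusTwo in
  have : IsAlgClosed kbar := IsAlgClosure.isAlgClosed k
  have h6 : F.coeff 6 = 1 := by
    rw [hF, coeff_map, ← hdeg, hmonic.coeff_natDegree, map_one]
  have hS : IsSmoothSextic F :=
    { two_ne_zero := by
        have := (map_ne_zero (algebraMap k kbar)).2 h2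
        rwa [map_ofNat] at this
      natDegree_le := by rw [hF, natDegree_map, hdeg]
      coeff_six := by rw [h6]; exact one_ne_zero
      separable := by rw [hF]; exact hsep.map }
  have hθ' := hθ
  rw [eval_of_natDegree_le hS.natDegree_le] at hθ'
  have hmul := weierstrassMatrix_mulVec h6 (hroots θ hθ) hθ'
  have hpf := hS.derivative_ne_zero hθ
  rw [eval_derivative_of_natDegree_le hS.natDegree_le] at hpf
  have hne : ∀ {v : Fin 4 → kbar}, v ≠ 0 → polar F.coeff θ v ≠ 0 := by
    intro v hv h0
    have h := pole_polar F.coeff θ v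
    rw [h0, ← zero_smul kbar (0 : Fin 4 → kbar), pole_smul, zero_smul, eq_comm, smul_eq_zero] at h
    exact h.elim (neg_ne_zero.2 hpf) hv
  have hA : Function.Injective (weierstrassMatrix F θ).mulVecLin := by
    rw [injective_iff_map_eq_zero]
    intro v hv
    rw [Matrix.mulVecLin_apply, hmul] at hv
    by_contra h0
    exact hne h0 hv
  have hmap : ∀ p q : CurvePoint F,
      Projectivization.map (weierstrassMatrix F θ).mulVecLin hA (kummerPoint p q)
        = Projectivization.mk kbar (polar F.coeff θ (kummerVec p q))
          (hne (kummerVec_ne_zero p q)) := by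
    intro p q
    rw [kummerPoint, Projectivization.map_mk]
    congr 1
    exact hmul _
  refine ⟨?_, fun ξ => ⟨Projectivization.map (weierstrassMatrix F θ).mulVecLin hA ξ, ?_⟩, ?_, ?_,
    hA, fun _ => rfl⟩
  · ext i j
    fin_cases i <;> fin_cases j <;> simp [weierstrassMatrix, Matrix.transpose] <;> ring
  · obtain ⟨_, p, q, rfl⟩ := ξ
    rw [hmap]
    exact mk_polar_mem_dualKummerSurface hS hθ p q _
  · intro p q r s t h
    change Projectivization.orthogonal (Projectivization.map (weierstrassMatrix F θ).mulVecLin hA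
      (kummerPoint p q)) (kummerPoint s t)
    rw [hmap, kummerPoint, Projectivization.orthogonal_mk, dotProduct_comm]
    exact h.dotProduct_polar_eq_zero hS hθ
  · intro W' hW'
    funext ⟨_, p, q, rfl⟩
    apply Subtype.ext
    change _ = Projectivization.map (weierstrassMatrix F θ).mulVecLin hA (kummerPoint p q)
    rw [hmap]
    obtain ⟨v, hv, h⟩ := exists_linearIndependent_translates hS hθ p q
    obtain ⟨η, hη, e⟩ : ∃ η, ∃ hη : η ≠ 0,
        (W' ⟨kummerPoint p q, kummerPoint_mem p q⟩ : ℙ kbar (Fin 4 → kbar))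
          = Projectivization.mk kbar η hη :=
      ⟨_, _, (Projectivization.mk_rep _).symm⟩
    have hort : ∀ i, v i ⬝ᵥ η = 0 ∧ v i ⬝ᵥ polar F.coeff θ (kummerVec p q) = 0 := by
      intro i
      obtain ⟨p', q', r, s, t, hpq, hst, hl⟩ := h i
      rw [hst]
      refine ⟨?_, ?_⟩
      · have h1 := hW' p' q' r s t hl
        have h3 : (⟨kummerPoint p' q', kummerPoint_mem p' q'⟩ : kummerSurface F)
            = ⟨kummerPoint p q, kummerPoint_mem p q⟩ :=
          Subtype.ext (by simp only [kummerPoint, hpq])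
        rw [h3, e, kummerPoint, Projectivization.orthogonal_mk, dotProduct_comm] at h1
        exact h1
      · rw [← hpq]
        exact hl.dotProduct_polar_eq_zero hS hθ
    obtain ⟨c, hc⟩ := exists_smul_eq_of_orthogonal hv (hne (kummerVec_ne_zero p q))
      (fun i => (hort i).2) (fun i => (hort i).1)
    refine e.trans ((Projectivization.mk_eq_mk_iff' _ _ _ _ _).2 ⟨c, hc⟩)
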